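/- **Setting.** For $N\ge 1$ take the square lattice with $N\times N$ plaquettes and open boundary, with one spin of dimension $d=c+2$ on every edge and local space $\mathbb C^d=\mathbb C^2\oplus\mathbb C^c$ (Toric Code levels and $c$ classical colours). For $J>0$ let $$H_{\rm TC}=J\sum_s(1-A_s)+J\sum_p(1-B_p),\qquad A_s=\prod_{i\in s}\sigma^x_i,\quad B_p=\prod_{i\in p}\sigma^z_i,$$ be the Toric Code on the qubit spaces $\mathbb C^2$, where $p$ runs over the plaquettes and $s$ over the stars of the vertices with three or four incident edges. On $\bigotimes\mathbb C^d$ consider $$H^{(d)}_N=\tilde H_{\rm TC}+H_{\rm cl}+C\sum_{i\sim j}\big(\mathbb 1_{\rm tc}^i\otimes\mathbb 1_{\rm cl}^j+\mathbb 1_{\rm cl}^i\otimes\mathbb 1_{\rm tc}^j\big),$$ where $\tilde H_{\rm TC}$ is $H_{\rm TC}$ with $1$, $\sigma^x$, $\sigma^z$ extended by $0$ to $\mathbb C^d$ (each term acting on the spins of its own star or plaquette), $i\sim j$ means that two edges share a vertex, $\mathbb 1_{\rm tc},\mathbb 1_{\rm cl}$ are the projections onto $\mathbb C^2$ and $\mathbb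 C^c$, and $H_{\rm cl}$ is a translationally invariant interaction that is diagonal in the canonical basis: each plaquette contributes an energy depending on the four classical colours around it (and $0$ if one of them is not classical), and each nonempty pattern of prescribed classical colours on some of the (at most four) legs of a vertex contributes an energy wherever it occurs entirely inside the lattice. These energies do not depend on the position or on $N$, and they are half-integers (elements of $\frac12\mathbb Z$) of absolute value at most $8$. Call $n\ge1$ a *transition threshold* in dimension $d$ if some such $H_{\rm cl}$ satisfies, for all $J>0$ and $N\ge1$: * if $N\le n$, the ground state of $H^{(d)}_N$ is non-degenerate and is a product vector of the canonical basis with only classical colours, and all other eigenvalues are larger by at least $1/2$; * if $N>n$, the low-energy space is that of the Toric Code: for every $\mu<1/2$ the eigenspace of $H^{(d)}_N$ for $\mu$ is the image of the eigenspace of $H_{\rm TC}$ for $\mu$ under the inclusion $\bigotimes\mathbb C^2\subseteq\bigotimes\mathbb C^d$; moreover the ground state energy is $0$ and all other eigenvalues are at least $\min(2J,1/2)$. Let $S(q)$ be the Busy Beaver number: the largest number of steps after which a Turing machine with $q$ states and two symbols halts, when started on a blank two-way infinite tape (the step into the halting state counts; $S(0)=0$). **Theorem.** There is a constant $C>0$,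 independent of $d$, such that: 1. for every $d>3$ there are transition thresholds in dimension $d$, and there is a largest one, $N_d$; 2. $2$, $15$, $84$ and $420$ are transition thresholds in dimensions $4$, $6$, $7$ and $8$, respectively (so $N_4\ge2$, $N_6\ge15$, $N_7\ge84$, $N_8\ge420$); 3. $N_{q+4}\ge S(q)/\sqrt2$ for every $q\ge0$; moreover $N_9\ge 3.3\cdot10^7$ and $N_{10}\ge5.2\cdot10^{36534}$; 4. $N_d$ grows faster than any computable function: for every computable $f:\mathbb N\to\mathbb N$ one has $f(d)<N_d$ for all sufficiently large $d$. -/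

import Mathlib

namespace SizeDriven

/-! ### The lattice: `N × N` plaquettes, open boundary, one spin on every edge -/

/-- The four compass directions. -/
inductive Dir
  | north | east | south | west
  deriving DecidableEq

instance : Fintype Dir := ⟨{.north, .east, .south, .west}, by intro a; cases a <;> simp⟩

/-- Vertices of the lattice with `N × N` plaquettes: pairs (column, row). -/
abbrev Vertex (N : ℕ) : Type := Fin (N + 1) × Fin (N + 1)

/-- Plaquettes (tiles), given by their lower left vertex: pairs (column, row). -/
abbrev Plaquette (N : ℕ) : Type := Fin N × Fin N

/-- Edges. `Sum.inl (i, j)` is the horizontal edge between the vertices `(i, j)` and `(i + 1, j)`,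
`Sum.inr (i, j)` is the vertical edge between `(i, j)` and `(i, j + 1)`. -/
abbrev Edge (N : ℕ) : Type := (Fin N × Fin (N + 1)) ⊕ (Fin (N + 1) × Fin N)

/-- The four edges around a plaquette. -/
def side {N : ℕ} (p : Plaquette N) : Dir → Edge N
  | .north => Sum.inl (p.1, p.2.succ)
  | .east => Sum.inr (p.1.succ, p.2)
  | .south => Sum.inl (p.1, p.2.castSucc)
  | .west => Sum.inr (p.1.castSucc, p.2)

/-- The edge that leaves a vertex in a given direction, if the lattice has one there. -/
def leg {N : ℕ} (v : Vertex N) : Dir → Option (Edge N)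
  | .north => if h : v.2.1 < N then some (Sum.inr (v.1, ⟨v.2.1, h⟩)) else none
  | .east => if h : v.1.1 < N then some (Sum.inl (⟨v.1.1, h⟩, v.2)) else none
  | .south => if h : 0 < v.2.1 then
      some (Sum.inr (v.1, ⟨v.2.1 - 1, by have := v.2.2; omega⟩)) else none
  | .west => if h : 0 < v.1.1 then
      some (Sum.inl (⟨v.1.1 - 1, by have := v.1.2; omega⟩, v.2)) else none

/-- The star of a vertex: the edges incident to it (four in the bulk, three on the sides of the
lattice, two at its corners). -/
def starEdges {N : ℕ} (v : Vertex N) : Finset (Edge N) :=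
  Finset.univ.filter fun e => ∃ a, leg v a = some e

/-- The boundary of a plaquette as a set of edges. -/
def plaquetteEdges {N : ℕ} (p : Plaquette N) : Finset (Edge N) :=
  Finset.univ.filter fun e => ∃ a, side p a = e

/-- Two different spins are adjacent if their edges have a common end point. -/
def Adjacent {N : ℕ} (e e' : Edge N) : Prop :=
  e ≠ e' ∧ ∃ v : Vertex N, e ∈ starEdges v ∧ e' ∈ starEdges v

/-! ### Operators on a tensor product over the edges

With a local orthonormal basis labelled by `X`, the space `⊗_e ℂ^X` is `(Edge N → X) → ℂ`,
and operators are matrices indexed by `Edge N → X`. -/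

/-- The tensor product `⊗_e A_e` of one local matrix for every edge. -/
noncomputable def tensorOp {N : ℕ} {X Y : Type} (A : Edge N → Matrix X Y ℂ) :
    Matrix (Edge N → X) (Edge N → Y) ℂ :=
  Matrix.of fun σ τ => ∏ e, A e (σ e) (τ e)

/-- The operator `∏_{e ∈ s} A_e`, where `A_e` is `A` acting on the spin at `e`. -/
noncomputable def localProd {N : ℕ} {X : Type} [DecidableEq X] (s : Finset (Edge N))
    (A : Matrix X X ℂ) : Matrix (Edge N → X) (Edge N → X) ℂ :=
  tensorOp fun e => if e ∈ s then A else 1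

/-! ### The Toric Code -/

/-- The Pauli matrix `σ^x`. -/
def pauliX : Matrix (Fin 2) (Fin 2) ℂ := !![0, 1; 1, 0]

/-- The Pauli matrix `σ^z`. -/
def pauliZ : Matrix (Fin 2) (Fin 2) ℂ := !![1, 0; 0, -1]

/-- `∑_s (∏_{i ∈ s} P_i - ∏_{i ∈ s} A_i) + ∑_p (∏_{i ∈ p} P_i - ∏_{i ∈ p} B_i)`, where `s` runs over
the 3- and 4-local stars and `p` over the plaquettes. -/
noncomputable def stabilizerSum (N : ℕ) {X : Type} [DecidableEq X] (P A B : Matrix X X ℂ) :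
    Matrix (Edge N → X) (Edge N → X) ℂ :=
  (∑ v ∈ Finset.univ.filter (fun v : Vertex N => 3 ≤ (starEdges v).card),
      (localProd (starEdges v) P - localProd (starEdges v) A)) +
    ∑ p : Plaquette N, (localProd (plaquetteEdges p) P - localProd (plaquetteEdges p) B)

/-- The Toric Code Hamiltonian `J ∑_s (1 - A_s) + J ∑_p (1 - B_p)` on qubits. -/
noncomputable def toricCode (N : ℕ) (J : ℝ) : Matrix (Edge N → Fin 2) (Edge N → Fin 2) ℂ :=
  (J : ℂ) • stabilizerSum N 1 pauliX pauliZ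

/-! ### The combined model with local space `ℂ² ⊕ ℂ^c` -/

/-- Basis labels of the local space `ℂ² ⊕ ℂ^c`: Toric Code levels and classical colours. -/
abbrev Spin (c : ℕ) : Type := Fin 2 ⊕ Fin c

/-- A local operator on `ℂ²`, extended by `0` to `ℂ² ⊕ ℂ^c`. -/
def extend (c : ℕ) (A : Matrix (Fin 2) (Fin 2) ℂ) : Matrix (Spin c) (Spin c) ℂ :=
  Matrix.fromBlocks A 0 0 0

/-- The isometry `⊗ ℂ² → ⊗ (ℂ² ⊕ ℂ^c)` that comes from the local inclusions `ℂ² ⊆ ℂ² ⊕ ℂ^c`. -/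
noncomputable def inclusion (N c : ℕ) : Matrix (Edge N → Spin c) (Edge N → Fin 2) ℂ :=
  tensorOp fun _ => Matrix.of fun x k => if x = Sum.inl k then 1 else 0

/-- Coupling constants of a translationally invariant classical interaction on `c` colours.
`plaq w` is the energy of the tile `w`. `star t` is the energy of the pattern `t` around a vertex,
where `t a = none` means that the pattern does not involve the leg in direction `a`.
Neither depends on the position in the lattice. -/
structure Couplings (c : ℕ) where
  plaq : (Dir → Fin c) → ℝ
  star : (Dir → Option (Fin c)) → ℝ

/-- All couplings are half-integers of absolute value at most `8`, and the empty pattern does not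
contribute (so that the interaction acts on classical colours only). -/
def Couplings.Admissible {c : ℕ} (W : Couplings c) : Prop :=
  (∀ w, ∃ k : ℤ, |k| ≤ 16 ∧ W.plaq w = k / 2) ∧
  (∀ t, ∃ k : ℤ, |k| ≤ 16 ∧ W.star t = k / 2) ∧
  W.star (fun _ => none) = 0

/-- The four spins around `p` carry the colours of the tile `w`. -/
def TileAt {N c : ℕ} (w : Dir → Fin c) (σ : Edge N → Spin c) (p : Plaquette N) : Prop :=
  ∀ a, σ (side p a) = Sum.inr (w a)

/-- All the legs that the pattern `t` involves are present at `v` and carry the colours of `t`.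
On the lattice boundary only the patterns that are entirely inside the lattice occur. -/
def PatternAt {N c : ℕ} (t : Dir → Option (Fin c)) (σ : Edge N → Spin c) (v : Vertex N) : Prop :=
  ∀ a k, t a = some k → ∃ e, leg v a = some e ∧ σ e = Sum.inr k

open Classical in
/-- The energy of a basis configuration under the classical interaction: the sum over all plaquettes
and vertices of the tile and star energies. -/
noncomputable def classicalEnergy {N c : ℕ} (W : Couplings c) (σ : Edge N → Spin c) : ℝ :=
  (∑ p : Plaquette N, ∑ w : Dir → Fin c, if TileAt w σ p then W.plaq w else 0) +
    ∑ v : Vertex N, ∑ t : Dir → Option (Fin c), if PatternAt t σ v then W.star t else 0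

open Classical in
/-- The number of adjacent pairs of spins of which one is in the Toric Code sector and the other in
the classical sector, that is, the eigenvalue of
`∑_{i ∼ j} (𝟙_tc ⊗ 𝟙_cl + 𝟙_cl ⊗ 𝟙_tc)` at a basis configuration. -/
noncomputable def mismatches {N c : ℕ} (σ : Edge N → Spin c) : ℕ :=
  (Finset.univ.filter fun x : Edge N × Edge N =>
    Adjacent x.1 x.2 ∧ (σ x.1).isLeft ∧ (σ x.2).isRight).card

/-- The Hamiltonian `H_tc + H_cl + H'` on `⊗ (ℂ² ⊕ ℂ^c)`: the Toric Code on the Toric Code sector,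
the classical interaction, and the penalty `C` for adjacent spins in different sectors. -/
noncomputable def hamiltonian (N : ℕ) {c : ℕ} (J C : ℝ) (W : Couplings c) :
    Matrix (Edge N → Spin c) (Edge N → Spin c) ℂ :=
  (J : ℂ) • stabilizerSum N (extend c 1) (extend c pauliX) (extend c pauliZ) +
    Matrix.diagonal (fun σ => ((classicalEnergy W σ : ℝ) : ℂ)) +
    Matrix.diagonal (fun σ => ((C * (mismatches σ : ℝ) : ℝ) : ℂ))

theorem localProd_isHermitian {N : ℕ} {X : Type} [DecidableEq X] (s : Finset (Edge N))
    {A : Matrix X X ℂ} (hA : A.IsHermitian) : (localProd s A).IsHermitian := by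
  refine Matrix.IsHermitian.ext fun σ τ => ?_
  simp only [localProd, tensorOp, Matrix.of_apply, star_prod]
  refine Finset.prod_congr rfl fun e _ => ?_
  split_ifs
  · exact hA.apply _ _
  · exact Matrix.isHermitian_one.apply _ _

theorem stabilizerSum_isHermitian (N : ℕ) {X : Type} [DecidableEq X] {P A B : Matrix X X ℂ}
    (hP : P.IsHermitian) (hA : A.IsHermitian) (hB : B.IsHermitian) :
    (stabilizerSum N P A B).IsHermitian := by
  have key : ∀ {ι : Type} (s : Finset ι) (f : ι → Matrix (Edge N → X) (Edge N → X) ℂ),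
      (∀ i, (f i).IsHermitian) → (∑ i ∈ s, f i).IsHermitian := by
    intro ι s f hf
    unfold Matrix.IsHermitian
    rw [Matrix.conjTranspose_sum]
    exact Finset.sum_congr rfl fun i _ => hf i
  exact (key _ _ fun v => (localProd_isHermitian _ hP).sub (localProd_isHermitian _ hA)).add
    (key _ _ fun p => (localProd_isHermitian _ hP).sub (localProd_isHermitian _ hB))

/-- The Hamiltonian is Hermitian, so that its real eigenvalues are its whole spectrum. -/
theorem hamiltonian_isHermitian (N : ℕ) {c : ℕ} (J C : ℝ) (W : Couplings c) :
    (hamiltonian N J C W).IsHermitian := by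
  have hext : ∀ A : Matrix (Fin 2) (Fin 2) ℂ, A.IsHermitian → (extend c A).IsHermitian := by
    intro A hA
    exact Matrix.IsHermitian.fromBlocks hA (by simp) Matrix.isHermitian_zero
  have hX : pauliX.IsHermitian := by
    ext i j; fin_cases i <;> fin_cases j <;> simp [pauliX]
  have hZ : pauliZ.IsHermitian := by
    ext i j; fin_cases i <;> fin_cases j <;> simp [pauliZ]
  have hsmul : ((J : ℂ) • stabilizerSum N (extend c 1) (extend c pauliX)
      (extend c pauliZ)).IsHermitian := by
    unfold Matrix.IsHermitian
    rw [Matrix.conjTranspose_smul, (stabilizerSum_isHermitian N (hext _ Matrix.isHermitian_one)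
      (hext _ hX) (hext _ hZ)).eq]
    simp
  refine (hsmul.add ?_).add ?_
  · refine Matrix.isHermitian_diagonal_of_self_adjoint _ ?_
    ext σ; simp
  · refine Matrix.isHermitian_diagonal_of_self_adjoint _ ?_
    ext σ; simp

/-! ### The two regimes and the threshold -/

/-- The ground state of `H` is non-degenerate and is a product basis state of classical colours,
and there is a spectral gap of at least `1/2` above it. -/
def ClassicalRegime {N c : ℕ} (H : Matrix (Edge N → Spin c) (Edge N → Spin c) ℂ) : Prop :=
  ∃ (E : ℝ) (ω : Edge N → Fin c),
    Module.End.eigenspace (Matrix.toLin' H) (E : ℂ) =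
      Submodule.span ℂ {Pi.single (fun e => (Sum.inr (ω e) : Spin c)) (1 : ℂ)} ∧
    ∀ μ : ℝ, Module.End.HasEigenvalue (Matrix.toLin' H) (μ : ℂ) → μ = E ∨ E + 1 / 2 ≤ μ

/-- Below energy `1/2` the eigenvalues and eigenspaces of `H` are exactly those of the Toric Code;
the ground state energy is `0`, with a spectral gap of at least `min (2 J) (1/2)` above it. -/
def ToricRegime {N c : ℕ} (J : ℝ) (H : Matrix (Edge N → Spin c) (Edge N → Spin c) ℂ) : Prop :=
  (∀ μ : ℝ, μ < 1 / 2 →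
    Module.End.eigenspace (Matrix.toLin' H) (μ : ℂ) =
      (Module.End.eigenspace (Matrix.toLin' (toricCode N J)) (μ : ℂ)).map
        (Matrix.toLin' (inclusion N c))) ∧
  Module.End.HasEigenvalue (Matrix.toLin' H) 0 ∧
  ∀ μ : ℝ, Module.End.HasEigenvalue (Matrix.toLin' H) (μ : ℂ) → μ = 0 ∨ min (2 * J) (1 / 2) ≤ μ

/-- `n` is the transition threshold of the model with local dimension `c + 2` given by `C`, `W`,
for every strength `J > 0` of the Toric Code. -/
def HasTransitionAt {c : ℕ} (C : ℝ) (W : Couplings c) (n : ℕ) : Prop :=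
  1 ≤ n ∧ ∀ J : ℝ, 0 < J → ∀ N : ℕ, 1 ≤ N →
    (N ≤ n → ClassicalRegime (hamiltonian N J C W)) ∧
    (n < N → ToricRegime J (hamiltonian N J C W))

/-- Some model with local dimension `d` has transition threshold `n`. -/
def IsThreshold (C : ℝ) (d n : ℕ) : Prop :=
  ∃ W : Couplings (d - 2), W.Admissible ∧ HasTransitionAt C W n

/-! ### Busy Beavers -/

/-- Head moves. -/
inductive Move
  | left | right

/-- A Turing machine with `q` states and tape symbols `false` (blank) and `true`: in a given state,
reading a given symbol, it writes a symbol, moves, and goes to a state or halts (`none`). -/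
abbrev Machine (q : ℕ) : Type := Fin q → Bool → Bool × Move × Option (Fin q)

/-- Configurations of a machine on a two-way infinite tape; `state = none` means halted. -/
structure Config (q : ℕ) where
  state : Option (Fin q)
  tape : ℤ → Bool
  head : ℤ

/-- State `0` (if there is a state), blank tape. -/
def Config.init (q : ℕ) : Config q where
  state := if h : 0 < q then some ⟨0, h⟩ else none
  tape := fun _ => false
  head := 0

/-- One step of a machine; a halted machine stays as it is. -/
def Machine.step {q : ℕ} (M : Machine q) (x : Config q) : Config q :=
  match x.state with
  | none => x
  | some s =>
    { state := (M s (x.tape x.head)).2.2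
      tape := Function.update x.tape x.head (M s (x.tape x.head)).1
      head := match (M s (x.tape x.head)).2.1 with
        | .left => x.head - 1
        | .right => x.head + 1 }

/-- Started on the blank tape, the machine halts after exactly `t` steps. -/
def Machine.HaltsAfter {q : ℕ} (M : Machine q) (t : ℕ) : Prop :=
  (M.step^[t] (Config.init q)).state = none ∧
    ∀ t' < t, (M.step^[t'] (Config.init q)).state ≠ none

/-- The Busy Beaver number `S(q)`: the largest number of steps after which a machine with `q` states
and two symbols halts on the blank tape. -/
noncomputable def busyBeaver (q : ℕ) : ℕ :=
  sSup {t | ∃ M : Machine q, M.HaltsAfter t}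

end SizeDriven

/-!
The classical energies encode a deterministic tiling rule: at each vertex the colours of the west
and south legs force those of the north and east legs. A violation of the rule costs energy, and the
lower left corner, the only vertex whose legs are exactly the north and the east one, gains `1/2`.
So as long as the rule does not get stuck, the one configuration that obeys it has energy `-1/2`,
and every other classical configuration has energy at least `1/2`; once the rule is stuck, all
classical configurations have energy at least `1/2`. If Toric Code and classical spins occur
together, then only the corners of the classical region gain energy, and all but one of them are
paid for by the adjacent domain wall, so the energy is at least `1/2` in any case. The star and
plaquette terms are positive semidefinite and preserve the set of classical spins and their colours,
hence an eigenvector for `μ` vanishes where the diagonal energy exceeds `μ`. The threshold is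
therefore the size at which the rule gets stuck.

The rules that run long are a counter, with its digits in the colours, for small `d`; a counter
whose length is the period of another counter and hence doubly exponential; and the space-time
diagram of a Turing machine drawn along the diagonals, which runs for as long as the machine does.
For each `d` there are finitely many admissible interactions, each with at most one threshold, so a
largest threshold exists. It outgrows the computable functions since the Busy Beaver numbers do: a
program for `f` becomes a stack machine and then a Post machine, and a Turing machine whose number
of states is linear in the input writes down the input and imitates it.
-/

open scoped Matrix ComplexOrder

namespace SizeDriven

/-! ### Spectra of sums of local terms -/

section Spectral

theorem mem_eigenspace_toLin' {ι R : Type*} [Fintype ι] [DecidableEq ι] [CommRing R]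
    {A : Matrix ι ι R} {μ : R} {ψ : ι → R} :
    ψ ∈ Module.End.eigenspace (Matrix.toLin' A) μ ↔ A *ᵥ ψ = μ • ψ := by
  rw [Module.End.mem_eigenspace_iff, Matrix.toLin'_apply]

theorem exists_eigenvector {ι R : Type*} [Fintype ι] [DecidableEq ι] [CommRing R]
    {A : Matrix ι ι R} {μ : R} (h : Module.End.HasEigenvalue (Matrix.toLin' A) μ) :
    ∃ ψ, ψ ≠ 0 ∧ A *ᵥ ψ = μ • ψ := by
  obtain ⟨ψ, hψ⟩ := h.exists_hasEigenvector
  exact ⟨ψ, hψ.2, mem_eigenspace_toLin'.1 hψ.1⟩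

theorem eq_smul_single {ι R : Type*} [DecidableEq ι] [Semiring R] {ψ : ι → R} {i : ι}
    (h : ∀ j ≠ i, ψ j = 0) : ψ = ψ i • Pi.single i 1 := by
  rw [← Pi.single_smul, smul_eq_mul, mul_one]
  funext j
  rcases eq_or_ne j i with rfl | hj
  · rw [Pi.single_eq_same]
  · rw [Pi.single_eq_of_ne hj, h j hj]

theorem eigenspace_eq_span_single {ι R : Type*} [Fintype ι] [DecidableEq ι] [CommRing R]
    {A : Matrix ι ι R} {i : ι} {μ : R} (hi : A *ᵥ Pi.single i 1 = μ • Pi.single i 1)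
    (h : ∀ ψ : ι → R, A *ᵥ ψ = μ • ψ → ∀ j ≠ i, ψ j = 0) :
    Module.End.eigenspace (Matrix.toLin' A) μ = Submodule.span R {Pi.single i 1} := by
  ext ψ
  rw [mem_eigenspace_toLin', Submodule.mem_span_singleton]
  constructor
  · exact fun hψ => ⟨ψ i, (eq_smul_single (h ψ hψ)).symm⟩
  · rintro ⟨a, rfl⟩
    rw [Matrix.mulVec_smul, hi, smul_comm]

theorem eq_of_eigenvector_supported_on_single {ι R : Type*} [Fintype ι] [DecidableEq ι]
    [CommRing R] [IsDomain R] {A : Matrix ι ι R} {i : ι} {μ ν : R}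
    (hi : A *ᵥ Pi.single i 1 = μ • Pi.single i 1) {ψ : ι → R} (hψ0 : ψ ≠ 0)
    (hψ : A *ᵥ ψ = ν • ψ) (h : ∀ j ≠ i, ψ j = 0) : ν = μ := by
  have hsingle := eq_smul_single h
  have h0 : ψ i ≠ 0 := fun h0 => hψ0 (by rw [hsingle, h0, zero_smul])
  rw [hsingle, Matrix.mulVec_smul, hi] at hψ
  have hat := congrFun hψ i
  simp only [Pi.smul_apply, Pi.single_eq_same, smul_eq_mul, mul_one] at hat
  exact (mul_right_cancel₀ h0 (by rw [← hat, mul_comm])).symm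

theorem mulVec_ite_of_block {ι R : Type*} [Fintype ι] [NonUnitalNonAssocSemiring R]
    {S : Matrix ι ι R} {p : ι → Prop} [DecidablePred p] (hp : ∀ i j, S i j ≠ 0 → (p i ↔ p j))
    (ψ : ι → R) :
    (S *ᵥ fun i => if p i then ψ i else 0) = fun i => if p i then (S *ᵥ ψ) i else 0 := by
  funext i
  simp only [Matrix.mulVec, dotProduct, mul_ite, mul_zero]
  trans ∑ j, if p i then S i j * ψ j else 0
  · refine Finset.sum_congr rfl fun j _ => ?_
    rcases eq_or_ne (S i j) 0 with h0 | h0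
    · simp only [h0, zero_mul, ite_self]
    · simp only [hp i j h0]
  · split_ifs
    · rfl
    · exact Finset.sum_const_zero

variable {ι 𝕜 : Type*} [Fintype ι] [RCLike 𝕜]

theorem eq_zero_of_posSemidef_of_mulVec_eq_neg {S : Matrix ι ι 𝕜} (hS : S.PosSemidef) {r : ι → ℝ}
    {ψ : ι → 𝕜} (h : ∀ i, (S *ᵥ ψ) i = (r i : 𝕜) * ψ i) (hr : ∀ i, ψ i ≠ 0 → r i < 0) :
    ψ = 0 := by
  have hnonneg : 0 ≤ ∑ i, r i * ‖ψ i‖ ^ 2 := by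
    have hform : star ψ ⬝ᵥ (S *ᵥ ψ) = ((∑ i, r i * ‖ψ i‖ ^ 2 : ℝ) : 𝕜) := by
      push_cast
      refine Finset.sum_congr rfl fun i _ => ?_
      rw [h, Pi.star_apply, mul_left_comm, RCLike.star_def, RCLike.conj_mul]
    rw [← RCLike.ofReal_nonneg (K := 𝕜), ← hform]
    exact hS.dotProduct_mulVec_nonneg ψ
  have hle : ∀ i ∈ Finset.univ, r i * ‖ψ i‖ ^ 2 ≤ 0 := by
    intro i _
    rcases eq_or_ne (ψ i) 0 with h0 | h0
    · simp [h0]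
    · exact mul_nonpos_of_nonpos_of_nonneg (hr i h0).le (sq_nonneg _)
  have hzero := (Finset.sum_eq_zero_iff_of_nonpos hle).1
    (le_antisymm (Finset.sum_nonpos hle) hnonneg)
  funext i
  by_contra h0
  exact (mul_neg_of_neg_of_pos (hr i h0) (by positivity)).ne (hzero i (Finset.mem_univ i))

theorem eigenvector_apply_eq_zero_of_lt [DecidableEq ι] {S : Matrix ι ι 𝕜} (hS : S.PosSemidef)
    {D : ι → ℝ} (hD : ∀ i j, S i j ≠ 0 → D i = D j) {μ : ℝ} {ψ : ι → 𝕜}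
    (h : (S + Matrix.diagonal fun i => (D i : 𝕜)) *ᵥ ψ = (μ : 𝕜) • ψ) {i : ι} (hi : μ < D i) :
    ψ i = 0 := by
  have hS_apply : ∀ j, (S *ᵥ ψ) j = ((μ - D j : ℝ) : 𝕜) * ψ j := by
    intro j
    have hj := congrFun h j
    rw [Matrix.add_mulVec, Pi.add_apply, Matrix.mulVec_diagonal, Pi.smul_apply, smul_eq_mul] at hj
    push_cast
    linear_combination hj
  -- `S` preserves the part of `ψ` at high potential and would have to be negative there.
  have hhigh : (fun j => if μ < D j then ψ j else 0) = 0 := by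
    refine eq_zero_of_posSemidef_of_mulVec_eq_neg hS (r := fun j => μ - D j) (fun j => ?_)
      fun j hj => ?_
    · rw [mulVec_ite_of_block fun i j hij => by rw [hD i j hij]]
      simp only [hS_apply, mul_ite, mul_zero]
    · by_contra hlt
      exact hj (if_neg fun h => hlt (sub_neg.2 h))
  simpa only [if_pos hi, Pi.zero_apply] using congrFun hhigh i

theorem nonneg_of_posSemidef_of_mulVec_eq_smul {A : Matrix ι ι 𝕜} (hA : A.PosSemidef) {μ : ℝ}
    {ψ : ι → 𝕜} (hψ : ψ ≠ 0) (h : A *ᵥ ψ = (μ : 𝕜) • ψ) : 0 ≤ μ := by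
  by_contra hneg
  exact hψ (eq_zero_of_posSemidef_of_mulVec_eq_neg hA (fun i => congrFun h i)
    fun _ _ => not_le.1 hneg)

theorem posSemidef_of_mul_self_eq_smul {T : Matrix ι ι 𝕜} (hT : T.IsHermitian) {r : ℝ}
    (hr : 0 < r) (h : T * T = (r : 𝕜) • T) : T.PosSemidef := by
  have hscale : T = ((r⁻¹ : ℝ) : 𝕜) • (Tᴴ * T) := by
    rw [hT.eq, h, smul_smul, ← RCLike.ofReal_mul, inv_mul_cancel₀ hr.ne', RCLike.ofReal_one,
      one_smul]
  rw [hscale]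
  exact (Matrix.posSemidef_conjTranspose_mul_self T).smul
    (RCLike.ofReal_nonneg.2 (inv_nonneg.2 hr.le))

theorem posSemidef_mul_of_commute {T U : Matrix ι ι 𝕜} (hT : T.IsHermitian) (hU : U.IsHermitian)
    {r : ℝ} (hr : 0 < r) (hTT : T * T = (r : 𝕜) • T) (hUU : U * U = (r : 𝕜) • U)
    (h : Commute T U) : (T * U).PosSemidef := by
  refine posSemidef_of_mul_self_eq_smul ?_ (mul_pos hr hr) ?_
  · rw [Matrix.IsHermitian, Matrix.conjTranspose_mul, hT.eq, hU.eq, h.eq]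
  · rw [h.symm.mul_mul_mul_comm, hTT, hUU, Matrix.smul_mul, Matrix.mul_smul, smul_smul,
      RCLike.ofReal_mul]

section CommutingTerms

variable {κ : Type*} [Fintype κ] {T : κ → Matrix ι ι 𝕜} {r : ℝ}

theorem sum_mul_sum_sub_smul_posSemidef (hT : ∀ k, (T k).IsHermitian) (hr : 0 < r)
    (hTT : ∀ k, T k * T k = (r : 𝕜) • T k) (hcomm : ∀ k l, Commute (T k) (T l)) :
    ((∑ k, T k) * (∑ k, T k) - (r : 𝕜) • ∑ k, T k).PosSemidef := by
  classical
  have hoffdiag : (∑ k, T k) * (∑ k, T k) - (r : 𝕜) • ∑ k, T k =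
      ∑ k, ∑ l ∈ Finset.univ.erase k, T k * T l := by
    rw [Finset.sum_mul_sum, Finset.smul_sum, ← Finset.sum_sub_distrib]
    refine Finset.sum_congr rfl fun k _ => ?_
    rw [← Finset.add_sum_erase _ _ (Finset.mem_univ k), hTT, add_sub_cancel_left]
  rw [hoffdiag]
  exact Matrix.posSemidef_sum _ fun k _ => Matrix.posSemidef_sum _ fun l _ =>
    posSemidef_mul_of_commute (hT k) (hT l) hr (hTT k) (hTT l) (hcomm k l)

theorem eigenvalue_sum_eq_zero_or_le (hT : ∀ k, (T k).IsHermitian) (hr : 0 < r)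
    (hTT : ∀ k, T k * T k = (r : 𝕜) • T k) (hcomm : ∀ k l, Commute (T k) (T l)) {μ : ℝ}
    {ψ : ι → 𝕜} (hψ : ψ ≠ 0) (h : (∑ k, T k) *ᵥ ψ = (μ : 𝕜) • ψ) : μ = 0 ∨ r ≤ μ := by
  have hμ : 0 ≤ μ := nonneg_of_posSemidef_of_mulVec_eq_smul (Matrix.posSemidef_sum _ fun k _ =>
    posSemidef_of_mul_self_eq_smul (hT k) hr (hTT k)) hψ h
  have hsq : 0 ≤ μ * μ - r * μ := by
    refine nonneg_of_posSemidef_of_mulVec_eq_smul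
      (sum_mul_sum_sub_smul_posSemidef hT hr hTT hcomm) hψ ?_
    rw [Matrix.sub_mulVec, Matrix.smul_mulVec, ← Matrix.mulVec_mulVec, h, Matrix.mulVec_smul, h,
      smul_smul, smul_smul, ← sub_smul]
    push_cast
    rfl
  refine hμ.eq_or_lt'.imp_right fun hpos => ?_
  rw [← sub_mul] at hsq
  exact sub_nonneg.1 (nonneg_of_mul_nonneg_left hsq hpos)

end CommutingTerms

end Spectral

/-! ### Tensor products of local matrices -/

section Tensor

variable {N : ℕ}

theorem tensorOp_mul {X Y Z : Type} [Fintype Y] (A : Edge N → Matrix X Y ℂ)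
    (B : Edge N → Matrix Y Z ℂ) :
    tensorOp A * tensorOp B = tensorOp fun e => A e * B e := by
  classical
  ext σ τ
  simp only [tensorOp, Matrix.mul_apply, Matrix.of_apply]
  rw [Finset.prod_univ_sum, Fintype.piFinset_univ]
  exact Finset.sum_congr rfl fun ρ _ => Finset.prod_mul_distrib.symm

variable {X : Type} [DecidableEq X]

theorem localProd_one (s : Finset (Edge N)) : localProd s (1 : Matrix X X ℂ) = 1 := by
  ext σ τ
  simp only [localProd, tensorOp, ite_self, Matrix.of_apply, Matrix.one_apply]
  rw [Finset.prod_boole]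
  simp only [Finset.mem_univ, true_implies, funext_iff]

theorem apply_ne_zero_of_localProd_apply_ne_zero {s : Finset (Edge N)} {A : Matrix X X ℂ}
    {σ τ : Edge N → X} (h : localProd s A σ τ ≠ 0) {e : Edge N} (he : e ∈ s) :
    A (σ e) (τ e) ≠ 0 := by
  simpa only [if_pos he] using Finset.prod_ne_zero_iff.1 h e (Finset.mem_univ e)

theorem eq_of_localProd_apply_ne_zero {s : Finset (Edge N)} {A : Matrix X X ℂ}
    {σ τ : Edge N → X} (h : localProd s A σ τ ≠ 0) {e : Edge N} (he : e ∉ s) : σ e = τ e := by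
  by_contra hne
  have hfactor := Finset.prod_ne_zero_iff.1 h e (Finset.mem_univ e)
  simp only [if_neg he] at hfactor
  exact hfactor (Matrix.one_apply_ne hne)

variable [Fintype X]

theorem localProd_mul (s : Finset (Edge N)) (A B : Matrix X X ℂ) :
    localProd s A * localProd s B = localProd s (A * B) := by
  rw [localProd, localProd, tensorOp_mul, localProd]
  congr 1
  ext1 e
  split_ifs
  exacts [rfl, one_mul 1]

theorem commute_localProd (s t : Finset (Edge N)) {A B : Matrix X X ℂ} (hAB : Commute A B) :
    Commute (localProd s A) (localProd t B) := by
  rw [Commute, SemiconjBy, localProd, localProd, tensorOp_mul, tensorOp_mul]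
  congr 1
  ext1 e
  split_ifs
  exacts [hAB.eq, by simp only [mul_one, one_mul], by simp only [mul_one, one_mul], rfl]

theorem commute_localProd_of_anticommute (s t : Finset (Edge N)) {A B : Matrix X X ℂ}
    (hAB : A * B = -(B * A)) (hst : Even (s ∩ t).card) :
    Commute (localProd s A) (localProd t B) := by
  rw [Commute, SemiconjBy, localProd, localProd, tensorOp_mul, tensorOp_mul]
  ext σ τ
  simp only [tensorOp, Matrix.of_apply]
  have hfactor : ∀ e, ((if e ∈ s then A else 1) * (if e ∈ t then B else 1)) (σ e) (τ e) =
      (if e ∈ s ∩ t then -1 else 1) *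
        ((if e ∈ t then B else 1) * (if e ∈ s then A else 1)) (σ e) (τ e) := by
    intro e
    by_cases hs : e ∈ s <;> by_cases ht : e ∈ t <;> simp [hs, ht, hAB]
  have hsign : ∏ e, (if e ∈ s ∩ t then (-1 : ℂ) else 1) = 1 := by
    rw [Finset.prod_ite_mem, Finset.univ_inter, Finset.prod_const, hst.neg_one_pow]
  rw [Finset.prod_congr rfl fun e _ => hfactor e, Finset.prod_mul_distrib, hsign, one_mul]

end Tensor

/-! ### Incidence of edges, vertices and plaquettes -/

section Incidence

variable {N : ℕ}

/-- The lower or left end point of an edge. -/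
def source : Edge N → Vertex N
  | .inl (i, j) => (i.castSucc, j)
  | .inr (i, j) => (i, j.castSucc)

/-- The upper or right end point of an edge. -/
def target : Edge N → Vertex N
  | .inl (i, j) => (i.succ, j)
  | .inr (i, j) => (i, j.succ)

theorem source_ne_target (e : Edge N) : source e ≠ target e := by
  rcases e with ⟨i, j⟩ | ⟨i, j⟩ <;> simp [source, target, Prod.ext_iff, Fin.ext_iff]

theorem mem_starEdges {v : Vertex N} {e : Edge N} :
    e ∈ starEdges v ↔ v = source e ∨ v = target e := by
  obtain ⟨⟨x, hx⟩, ⟨y, hy⟩⟩ := v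
  simp only [starEdges, Finset.mem_filter, Finset.mem_univ, true_and]
  constructor
  · rintro ⟨a, ha⟩
    cases a <;> simp only [leg, Option.dite_none_right_eq_some, Option.some.injEq] at ha <;>
      obtain ⟨h, rfl⟩ := ha <;>
      simp [source, target] <;> omega
  · rcases e with ⟨⟨i, hi⟩, ⟨j, hj⟩⟩ | ⟨⟨i, hi⟩, ⟨j, hj⟩⟩
    · rintro (h | h)
      · simp only [source, Prod.ext_iff, Fin.ext_iff, Fin.val_castSucc] at h
        obtain ⟨rfl, rfl⟩ := h
        exact ⟨.east, by simp [leg, hi]⟩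
      · simp only [target, Prod.ext_iff, Fin.ext_iff, Fin.val_succ] at h
        obtain ⟨rfl, rfl⟩ := h
        exact ⟨.west, by simp [leg]⟩
    · rintro (h | h)
      · simp only [source, Prod.ext_iff, Fin.ext_iff, Fin.val_castSucc] at h
        obtain ⟨rfl, rfl⟩ := h
        exact ⟨.north, by simp [leg, hj]⟩
      · simp only [target, Prod.ext_iff, Fin.ext_iff, Fin.val_succ] at h
        obtain ⟨rfl, rfl⟩ := h
        exact ⟨.south, by simp [leg]⟩

theorem side_injective (p : Plaquette N) : Function.Injective (side p) := by
  intro a b h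
  cases a <;> cases b <;> simp [side, Fin.ext_iff] at h ⊢

theorem plaquetteEdges_eq_image (p : Plaquette N) :
    plaquetteEdges p = Finset.univ.image (side p) := by
  ext e; simp [plaquetteEdges]

theorem sum_dir {M : Type*} [AddCommMonoid M] (f : Dir → M) :
    ∑ a, f a = f .north + f .east + f .south + f .west := by
  have : (Finset.univ : Finset Dir) = {.north, .east, .south, .west} := rfl
  rw [this, Finset.sum_insert (by simp), Finset.sum_insert (by simp), Finset.sum_insert (by simp),
    Finset.sum_singleton]
  abel

theorem sum_plaquetteEdges_coboundary (p : Plaquette N) (g : Vertex N → ZMod 2) :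
    ∑ e ∈ plaquetteEdges p, (g (source e) + g (target e)) = 0 := by
  rw [plaquetteEdges_eq_image, Finset.sum_image fun a _ b _ h => side_injective p h, sum_dir]
  simp only [side, source, target]
  have : ∀ x : ZMod 2, x + x = 0 := by decide
  linear_combination this (g (p.1.castSucc, p.2.succ)) + this (g (p.1.succ, p.2.succ)) +
    this (g (p.1.succ, p.2.castSucc)) + this (g (p.1.castSucc, p.2.castSucc))

theorem indicator_starEdges (v : Vertex N) (e : Edge N) :
    (if e ∈ starEdges v then (1 : ZMod 2) else 0) =
      (if source e = v then 1 else 0) + (if target e = v then 1 else 0) := by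
  have := source_ne_target e
  simp only [mem_starEdges]
  by_cases h1 : source e = v
  · by_cases h2 : target e = v
    · exact absurd (h1.trans h2.symm) this
    · simp [h1, h2]
  · by_cases h2 : target e = v
    · simp [h1, h2]
    · simp [h1, h2, Ne.symm h1, Ne.symm h2]

theorem even_card_starEdges_inter_plaquetteEdges (v : Vertex N) (p : Plaquette N) :
    Even (starEdges v ∩ plaquetteEdges p).card := by
  rw [← ZMod.natCast_eq_zero_iff_even, Finset.inter_comm, ← Finset.filter_mem_eq_inter,
    Finset.card_filter, Nat.cast_sum,
    ← sum_plaquetteEdges_coboundary p fun w => if w = v then 1 else 0]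
  refine Finset.sum_congr rfl fun e _ => ?_
  rw [← indicator_starEdges]
  split_ifs <;> simp

end Incidence

/-! ### Stabilizer Hamiltonians -/

section Stabilizer

theorem commute_of_mul_self_eq {S : Type*} [Semigroup S] {a p : S} (h : a * a = p) :
    Commute p a := by
  rw [← h]
  exact (Commute.refl a).mul_left (Commute.refl a)

theorem isHermitian_of_mul_self_eq {X : Type*} [Fintype X] {P A : Matrix X X ℂ}
    (hA : A.IsHermitian) (hAA : A * A = P) : P.IsHermitian := by
  rw [← hAA, Matrix.IsHermitian, Matrix.conjTranspose_mul, hA.eq]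

variable {N : ℕ} {X : Type} [DecidableEq X]

/-- The terms of `stabilizerSum`. -/
noncomputable def stabilizerTerm (P A B : Matrix X X ℂ) :
    {v : Vertex N // 3 ≤ (starEdges v).card} ⊕ Plaquette N →
      Matrix (Edge N → X) (Edge N → X) ℂ
  | .inl v => localProd (starEdges v.1) P - localProd (starEdges v.1) A
  | .inr p => localProd (plaquetteEdges p) P - localProd (plaquetteEdges p) B

theorem stabilizerSum_eq_sum_stabilizerTerm (P A B : Matrix X X ℂ) :
    stabilizerSum N P A B = ∑ k, stabilizerTerm P A B k := by
  rw [Fintype.sum_sum_type, stabilizerSum]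
  congr 1
  exact Finset.sum_subtype _ (by simp only [Finset.mem_filter_univ, implies_true]) _

variable [Fintype X]

/-- `A` and `B` are anticommuting reflections on the range of the projection `P` and vanish on its
complement, like the Pauli matrices extended to a larger local space. That `P` is a projection
which commutes with `A` and `B` follows from these relations. -/
structure IsPauliPair (P A B : Matrix X X ℂ) : Prop where
  isHermitian_left : A.IsHermitian
  isHermitian_right : B.IsHermitian
  left_mul_self : A * A = P
  right_mul_self : B * B = P
  mul_left : P * A = A
  mul_right : P * B = B
  anticommute : A * B = -(B * A)

theorem localProd_sub_mul_self (s : Finset (Edge N)) {P A : Matrix X X ℂ} (hAA : A * A = P)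
    (hPA : P * A = A) :
    (localProd s P - localProd s A) * (localProd s P - localProd s A) =
      ((2 : ℝ) : ℂ) • (localProd s P - localProd s A) := by
  have hAP : A * P = A := by rw [← (commute_of_mul_self_eq hAA).eq, hPA]
  have hPP : P * P = P := by rw [← hAA, mul_assoc, ← mul_assoc A A A, hAA, hPA, hAA]
  rw [sub_mul, mul_sub, mul_sub, localProd_mul, localProd_mul, localProd_mul, localProd_mul, hPP,
    hPA, hAP, hAA, Complex.ofReal_ofNat, two_smul]
  abel

namespace IsPauliPair

variable {P A B : Matrix X X ℂ}

theorem isHermitian_stabilizerTerm (h : IsPauliPair P A B) :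
    ∀ k, (stabilizerTerm (N := N) P A B k).IsHermitian
  | .inl _ => (localProd_isHermitian _ (isHermitian_of_mul_self_eq h.isHermitian_left
      h.left_mul_self)).sub (localProd_isHermitian _ h.isHermitian_left)
  | .inr _ => (localProd_isHermitian _ (isHermitian_of_mul_self_eq h.isHermitian_left
      h.left_mul_self)).sub (localProd_isHermitian _ h.isHermitian_right)

theorem stabilizerTerm_mul_self (h : IsPauliPair P A B) :
    ∀ k, stabilizerTerm (N := N) P A B k * stabilizerTerm P A B k =
      ((2 : ℝ) : ℂ) • stabilizerTerm P A B k
  | .inl _ => localProd_sub_mul_self _ h.left_mul_self h.mul_left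
  | .inr _ => localProd_sub_mul_self _ h.right_mul_self h.mul_right

theorem commute_star_plaquette (h : IsPauliPair P A B) (v : Vertex N) (p : Plaquette N) :
    Commute (localProd (starEdges v) P - localProd (starEdges v) A)
      (localProd (plaquetteEdges p) P - localProd (plaquetteEdges p) B) := by
  have hPA := commute_of_mul_self_eq h.left_mul_self
  have hPB := commute_of_mul_self_eq h.right_mul_self
  exact ((commute_localProd _ _ (.refl P)).sub_right (commute_localProd _ _ hPB)).sub_left
    ((commute_localProd _ _ hPA.symm).sub_right (commute_localProd_of_anticommute _ _ h.anticommute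
      (even_card_starEdges_inter_plaquetteEdges v p)))

theorem commute_localProd_sub {P A : Matrix X X ℂ} (hPA : Commute P A) (s t : Finset (Edge N)) :
    Commute (localProd s P - localProd s A) (localProd t P - localProd t A) :=
  ((commute_localProd _ _ (.refl P)).sub_right (commute_localProd _ _ hPA)).sub_left
    ((commute_localProd _ _ hPA.symm).sub_right (commute_localProd _ _ (.refl A)))

theorem commute_stabilizerTerm (h : IsPauliPair P A B) :
    ∀ k l, Commute (stabilizerTerm (N := N) P A B k) (stabilizerTerm P A B l)
  | .inl _, .inl _ => commute_localProd_sub (commute_of_mul_self_eq h.left_mul_self) _ _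
  | .inl _, .inr _ => h.commute_star_plaquette _ _
  | .inr _, .inl _ => (h.commute_star_plaquette _ _).symm
  | .inr _, .inr _ => commute_localProd_sub (commute_of_mul_self_eq h.right_mul_self) _ _

theorem stabilizerSum_posSemidef (h : IsPauliPair P A B) : (stabilizerSum N P A B).PosSemidef := by
  rw [stabilizerSum_eq_sum_stabilizerTerm]
  exact Matrix.posSemidef_sum _ fun k _ => posSemidef_of_mul_self_eq_smul
    (h.isHermitian_stabilizerTerm k) two_pos (h.stabilizerTerm_mul_self k)

theorem stabilizerSum_eigenvalue (h : IsPauliPair P A B) {μ : ℝ} {ψ : (Edge N → X) → ℂ}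
    (hψ : ψ ≠ 0) (hμ : stabilizerSum N P A B *ᵥ ψ = (μ : ℂ) • ψ) : μ = 0 ∨ 2 ≤ μ := by
  rw [stabilizerSum_eq_sum_stabilizerTerm] at hμ
  exact eigenvalue_sum_eq_zero_or_le h.isHermitian_stabilizerTerm two_pos
    h.stabilizerTerm_mul_self h.commute_stabilizerTerm hψ hμ

end IsPauliPair

end Stabilizer

/-! ### The Toric Code -/

section ToricCode

variable {N : ℕ}

theorem isPauliPair_pauli : IsPauliPair 1 pauliX pauliZ where
  isHermitian_left := by ext i j; fin_cases i <;> fin_cases j <;> simp [pauliX]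
  isHermitian_right := by ext i j; fin_cases i <;> fin_cases j <;> simp [pauliZ]
  left_mul_self := by ext i j; fin_cases i <;> fin_cases j <;> simp [pauliX]
  right_mul_self := by ext i j; fin_cases i <;> fin_cases j <;> simp [pauliZ]
  mul_left := one_mul _
  mul_right := one_mul _
  anticommute := by ext i j; fin_cases i <;> fin_cases j <;> simp [pauliX, pauliZ]

theorem toricCode_eigenvalue {J : ℝ} (hJ : 0 < J) {μ : ℝ} {ψ : (Edge N → Fin 2) → ℂ}
    (hψ : ψ ≠ 0) (h : toricCode N J *ᵥ ψ = (μ : ℂ) • ψ) : μ = 0 ∨ 2 * J ≤ μ := by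
  have hdiv : stabilizerSum N 1 pauliX pauliZ *ᵥ ψ = ((μ / J : ℝ) : ℂ) • ψ := by
    rw [toricCode, Matrix.smul_mulVec] at h
    have hJ' : (J : ℂ) ≠ 0 := by exact_mod_cast hJ.ne'
    push_cast
    rw [div_eq_inv_mul, ← smul_smul, ← h, smul_smul, inv_mul_cancel₀ hJ', one_smul]
  rcases isPauliPair_pauli.stabilizerSum_eigenvalue hψ hdiv with h0 | h2
  · exact .inl ((div_eq_zero_iff.1 h0).resolve_right hJ.ne')
  · exact .inr ((le_div_iff₀ hJ).1 h2)

/-- The configuration `σ` with the spins in `s` flipped. -/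
def flip (s : Finset (Edge N)) (σ : Edge N → Fin 2) : Edge N → Fin 2 :=
  fun e => if e ∈ s then σ e + 1 else σ e

theorem flip_flip (s : Finset (Edge N)) (σ : Edge N → Fin 2) : flip s (flip s σ) = σ := by
  have hadd : ∀ a : Fin 2, a + 1 + 1 = a := by decide
  funext e
  by_cases he : e ∈ s
  · simp only [flip, he, if_true, hadd]
  · simp only [flip, he, if_false]

theorem val_flip (s : Finset (Edge N)) (σ : Edge N → Fin 2) (e : Edge N) :
    ((flip s σ e).val : ZMod 2) = (σ e).val + if e ∈ s then 1 else 0 := by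
  have hadd : ∀ a : Fin 2, ((a + 1 : Fin 2).val : ZMod 2) = a.val + 1 := by decide
  rw [flip]
  split_ifs
  exacts [hadd _, (add_zero _).symm]

theorem localProd_pauliX_apply (s : Finset (Edge N)) (σ τ : Edge N → Fin 2) :
    localProd s pauliX σ τ = if τ = flip s σ then 1 else 0 := by
  have hX : ∀ a b : Fin 2, pauliX a b = if b = a + 1 then 1 else 0 := by
    intro a b
    fin_cases a <;> fin_cases b <;> simp [pauliX]
  have hfactor : ∀ e, (if e ∈ s then pauliX else 1) (σ e) (τ e) =
      if τ e = flip s σ e then (1 : ℂ) else 0 := by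
    intro e
    by_cases he : e ∈ s
    · simp only [flip, he, if_true, hX]
    · simp only [flip, he, if_false, Matrix.one_apply, eq_comm]
  simp only [localProd, tensorOp, Matrix.of_apply, hfactor, Finset.prod_boole, Finset.mem_univ,
    true_implies, funext_iff]

theorem localProd_pauliX_mulVec (s : Finset (Edge N)) (ψ : (Edge N → Fin 2) → ℂ)
    (σ : Edge N → Fin 2) : (localProd s pauliX *ᵥ ψ) σ = ψ (flip s σ) := by
  simp only [Matrix.mulVec, dotProduct, localProd_pauliX_apply, ite_mul, one_mul, zero_mul,
    Finset.sum_ite_eq', Finset.mem_univ, if_true]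

theorem localProd_pauliZ_eq_diagonal (s : Finset (Edge N)) :
    localProd s pauliZ = Matrix.diagonal fun σ => (-1) ^ ∑ e ∈ s, (σ e).val := by
  have hZ : ∀ a : Fin 2, pauliZ a a = (-1) ^ a.val := by
    intro a
    fin_cases a <;> simp [pauliZ]
  have hZ_ne : ∀ a b : Fin 2, a ≠ b → pauliZ a b = 0 := by
    intro a b
    fin_cases a <;> fin_cases b <;> simp [pauliZ]
  ext σ τ
  rcases eq_or_ne σ τ with rfl | hne
  · rw [Matrix.diagonal_apply_eq, ← Finset.prod_pow_eq_pow_sum, localProd, tensorOp,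
      Matrix.of_apply, ← Finset.prod_subset (Finset.subset_univ s)]
    · exact Finset.prod_congr rfl fun e he => by rw [if_pos he, hZ]
    · exact fun e _ he => by rw [if_neg he, Matrix.one_apply_eq]
  · obtain ⟨e, he⟩ := Function.ne_iff.1 hne
    rw [Matrix.diagonal_apply_ne _ hne]
    refine Finset.prod_eq_zero (Finset.mem_univ e) ?_
    by_cases hs : e ∈ s
    · simp only [if_pos hs, hZ_ne _ _ he]
    · simp only [if_neg hs, Matrix.one_apply_ne he]

/-- A configuration is a coboundary if the up spins form a cut: the vertices carry labels in `ℤ/2`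
such that every spin is the sum of the labels at the ends of its edge. -/
def IsCoboundary (σ : Edge N → Fin 2) : Prop :=
  ∃ g : Vertex N → ZMod 2, ∀ e, ((σ e).val : ZMod 2) = g (source e) + g (target e)

theorem isCoboundary_zero : IsCoboundary (0 : Edge N → Fin 2) :=
  ⟨0, fun _ => rfl⟩

theorem IsCoboundary.flip_star {σ : Edge N → Fin 2} (h : IsCoboundary σ) (v : Vertex N) :
    IsCoboundary (flip (starEdges v) σ) := by
  obtain ⟨g, hg⟩ := h
  refine ⟨fun w => g w + if w = v then 1 else 0, fun e => ?_⟩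
  rw [val_flip, indicator_starEdges, hg]
  ring

theorem isCoboundary_flip_star_iff {σ : Edge N → Fin 2} (v : Vertex N) :
    IsCoboundary (flip (starEdges v) σ) ↔ IsCoboundary σ :=
  ⟨fun h => flip_flip (starEdges v) σ ▸ h.flip_star v, fun h => h.flip_star v⟩

theorem IsCoboundary.even_sum_plaquetteEdges {σ : Edge N → Fin 2} (h : IsCoboundary σ)
    (p : Plaquette N) : Even (∑ e ∈ plaquetteEdges p, (σ e).val) := by
  obtain ⟨g, hg⟩ := h
  rw [← ZMod.natCast_eq_zero_iff_even, Nat.cast_sum, ← sum_plaquetteEdges_coboundary p g]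
  exact Finset.sum_congr rfl fun e _ => hg e

open Classical in
/-- The equal-weight superposition of all coboundaries, a ground state of the Toric Code. -/
noncomputable def coboundaryState (N : ℕ) (σ : Edge N → Fin 2) : ℂ :=
  if IsCoboundary σ then 1 else 0

theorem localProd_pauliX_mulVec_coboundaryState (v : Vertex N) :
    localProd (starEdges v) pauliX *ᵥ coboundaryState N = coboundaryState N := by
  funext σ
  classical
  simp only [localProd_pauliX_mulVec, coboundaryState]
  exact if_congr (isCoboundary_flip_star_iff v) rfl rfl

theorem localProd_pauliZ_mulVec_coboundaryState (p : Plaquette N) :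
    localProd (plaquetteEdges p) pauliZ *ᵥ coboundaryState N = coboundaryState N := by
  funext σ
  rw [localProd_pauliZ_eq_diagonal, Matrix.mulVec_diagonal, coboundaryState]
  split_ifs with h
  · rw [(h.even_sum_plaquetteEdges p).neg_one_pow, one_mul]
  · rw [mul_zero]

theorem coboundaryState_ne_zero (N : ℕ) : coboundaryState N ≠ 0 := by
  refine Function.ne_iff.2 ⟨0, ?_⟩
  rw [coboundaryState, if_pos isCoboundary_zero]
  exact one_ne_zero

theorem toricCode_mulVec_coboundaryState (N : ℕ) (J : ℝ) :
    toricCode N J *ᵥ coboundaryState N = 0 := by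
  rw [toricCode, stabilizerSum_eq_sum_stabilizerTerm, Matrix.smul_mulVec, Matrix.sum_mulVec,
    Finset.sum_eq_zero, smul_zero]
  rintro (v | p) _
  · rw [stabilizerTerm, Matrix.sub_mulVec, localProd_one, Matrix.one_mulVec,
      localProd_pauliX_mulVec_coboundaryState, sub_self]
  · rw [stabilizerTerm, Matrix.sub_mulVec, localProd_one, Matrix.one_mulVec,
      localProd_pauliZ_mulVec_coboundaryState, sub_self]

end ToricCode

/-! ### Energies of basis configurations -/

section Energy

variable {N c : ℕ}

theorem extend_mul (c : ℕ) (A B : Matrix (Fin 2) (Fin 2) ℂ) :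
    extend c A * extend c B = extend c (A * B) := by
  simp only [extend, Matrix.fromBlocks_multiply, Matrix.mul_zero, Matrix.zero_mul, add_zero]

theorem extend_neg (c : ℕ) (A : Matrix (Fin 2) (Fin 2) ℂ) : extend c (-A) = -extend c A := by
  simp only [extend, Matrix.fromBlocks_neg, neg_zero]

theorem isHermitian_extend (c : ℕ) {A : Matrix (Fin 2) (Fin 2) ℂ} (hA : A.IsHermitian) :
    (extend c A).IsHermitian :=
  hA.fromBlocks Matrix.conjTranspose_zero Matrix.isHermitian_zero

theorem isPauliPair_extend (c : ℕ) {P A B : Matrix (Fin 2) (Fin 2) ℂ} (h : IsPauliPair P A B) :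
    IsPauliPair (extend c P) (extend c A) (extend c B) where
  isHermitian_left := isHermitian_extend c h.isHermitian_left
  isHermitian_right := isHermitian_extend c h.isHermitian_right
  left_mul_self := by rw [extend_mul, h.left_mul_self]
  right_mul_self := by rw [extend_mul, h.right_mul_self]
  mul_left := by rw [extend_mul, h.mul_left]
  mul_right := by rw [extend_mul, h.mul_right]
  anticommute := by rw [extend_mul, extend_mul, h.anticommute, extend_neg]

theorem extend_apply_ne_zero {A : Matrix (Fin 2) (Fin 2) ℂ} {x y : Spin c}
    (h : extend c A x y ≠ 0) : x.isLeft ∧ y.isLeft := by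
  rcases x with x | x <;> rcases y with y | y
  · exact ⟨rfl, rfl⟩
  all_goals exact absurd rfl h

/-- The diagonal part of the Hamiltonian at a basis configuration. -/
noncomputable def energy (C : ℝ) (W : Couplings c) (σ : Edge N → Spin c) : ℝ :=
  classicalEnergy W σ + C * mismatches σ

theorem hamiltonian_eq (J C : ℝ) (W : Couplings c) :
    hamiltonian N J C W =
      (J : ℂ) • stabilizerSum N (extend c 1) (extend c pauliX) (extend c pauliZ) +
        Matrix.diagonal fun σ => (energy C W σ : ℂ) := by
  rw [hamiltonian, add_assoc, Matrix.diagonal_add]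
  simp only [energy, Complex.ofReal_add]

open Classical in
theorem energy_congr (C : ℝ) (W : Couplings c) {σ τ : Edge N → Spin c}
    (h : ∀ e, (σ e).getRight? = (τ e).getRight?) : energy C W σ = energy C W τ := by
  have hinr : ∀ e k, σ e = .inr k ↔ τ e = .inr k := fun e k => by
    rw [← Sum.getRight?_eq_some_iff, h, Sum.getRight?_eq_some_iff]
  have hright : ∀ e, (σ e).isRight = (τ e).isRight := fun e => by
    rw [Bool.eq_iff_iff, ← Sum.isSome_getRight?_iff_isRight, h, Sum.isSome_getRight?_iff_isRight]
  have hleft : ∀ e, (σ e).isLeft = (τ e).isLeft := fun e => by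
    rw [← Sum.bnot_isRight, hright, Sum.bnot_isRight]
  have hmismatches : mismatches σ = mismatches τ := by
    simp only [mismatches, hright, hleft]
  rw [energy, energy, hmismatches, classicalEnergy, classicalEnergy]
  refine congrArg (· + _) (congrArg₂ (· + ·) (Finset.sum_congr rfl fun p _ => Finset.sum_congr rfl
    fun w _ => if_congr ?_ rfl rfl) (Finset.sum_congr rfl fun v _ => Finset.sum_congr rfl
    fun t _ => if_congr ?_ rfl rfl))
  · simp only [TileAt, hinr]
  · simp only [PatternAt, hinr]

theorem localProd_extend_apply_ne_zero {s : Finset (Edge N)} (hs : s.Nonempty)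
    {A : Matrix (Fin 2) (Fin 2) ℂ} {σ τ : Edge N → Spin c}
    (h : localProd s (extend c A) σ τ ≠ 0) :
    (∀ e, (σ e).getRight? = (τ e).getRight?) ∧ ∃ e, (τ e).isLeft := by
  have hleft : ∀ e ∈ s, (σ e).isLeft ∧ (τ e).isLeft := fun e he =>
    extend_apply_ne_zero (apply_ne_zero_of_localProd_apply_ne_zero h he)
  refine ⟨fun e => ?_, hs.imp fun e he => (hleft e he).2⟩
  by_cases he : e ∈ s
  · rw [Sum.getRight?_eq_none_iff.2 (hleft e he).1, Sum.getRight?_eq_none_iff.2 (hleft e he).2]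
  · rw [eq_of_localProd_apply_ne_zero h he]

theorem plaquetteEdges_nonempty (p : Plaquette N) : (plaquetteEdges p).Nonempty :=
  ⟨side p .north, (Finset.mem_filter_univ _).2 ⟨.north, rfl⟩⟩

theorem stabilizerSum_extend_apply_ne_zero {P A B : Matrix (Fin 2) (Fin 2) ℂ}
    {σ τ : Edge N → Spin c}
    (h : stabilizerSum N (extend c P) (extend c A) (extend c B) σ τ ≠ 0) :
    (∀ e, (σ e).getRight? = (τ e).getRight?) ∧ ∃ e, (τ e).isLeft := by
  have hsub : ∀ {s : Finset (Edge N)} (_ : s.Nonempty) {A B : Matrix (Fin 2) (Fin 2) ℂ},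
      (localProd s (extend c A) - localProd s (extend c B)) σ τ ≠ 0 →
      (∀ e, (σ e).getRight? = (τ e).getRight?) ∧ ∃ e, (τ e).isLeft := by
    intro s hs A B hAB
    by_cases hA : localProd s (extend c A) σ τ = 0
    · refine localProd_extend_apply_ne_zero hs (A := B) fun hB => hAB ?_
      rw [Matrix.sub_apply, hA, hB, sub_zero]
    · exact localProd_extend_apply_ne_zero hs hA
  rw [stabilizerSum_eq_sum_stabilizerTerm, Matrix.sum_apply] at h
  obtain ⟨v | p, -, hterm⟩ := Finset.exists_ne_zero_of_sum_ne_zero h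
  · exact hsub (Finset.card_pos.1 (three_pos.trans_le v.2)) hterm
  · exact hsub (plaquetteEdges_nonempty p) hterm

theorem eigenvector_apply_eq_zero_of_lt_energy {J : ℝ} (hJ : 0 ≤ J) {C : ℝ} {W : Couplings c}
    {μ : ℝ} {ψ : (Edge N → Spin c) → ℂ} (h : hamiltonian N J C W *ᵥ ψ = (μ : ℂ) • ψ)
    {σ : Edge N → Spin c} (hσ : μ < energy C W σ) : ψ σ = 0 := by
  rw [hamiltonian_eq] at h
  refine eigenvector_apply_eq_zero_of_lt
    ((isPauliPair_extend c isPauliPair_pauli).stabilizerSum_posSemidef.smul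
      (Complex.zero_le_real.2 hJ))
    (fun σ τ hστ => energy_congr C W (stabilizerSum_extend_apply_ne_zero
      (right_ne_zero_of_mul (a := (J : ℂ)) hστ)).1) h hσ

end Energy

/-! ### The two regimes from energy estimates -/

section Regimes

variable {N c : ℕ}

theorem hamiltonian_mulVec_single_inr (J C : ℝ) (W : Couplings c) (ω : Edge N → Fin c) :
    hamiltonian N J C W *ᵥ Pi.single (fun e => .inr (ω e)) 1 =
      ((energy C W fun e => .inr (ω e) : ℝ) : ℂ) • Pi.single (fun e => .inr (ω e)) 1 := by
  have hstab : stabilizerSum N (extend c 1) (extend c pauliX) (extend c pauliZ) *ᵥ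
      Pi.single (fun e => .inr (ω e)) 1 = 0 := by
    rw [Matrix.mulVec_single_one]
    funext σ
    by_contra hne
    obtain ⟨_, he⟩ := (stabilizerSum_extend_apply_ne_zero hne).2
    exact Bool.false_ne_true he
  rw [hamiltonian_eq, Matrix.add_mulVec, Matrix.smul_mulVec, hstab, smul_zero, zero_add,
    Matrix.diagonal_mulVec_single, mul_one, ← Pi.single_smul, smul_eq_mul, mul_one]

theorem classicalRegime_of_energy {J : ℝ} (hJ : 0 ≤ J) {C : ℝ} {W : Couplings c}
    (ω : Edge N → Fin c) (h : ∀ σ : Edge N → Spin c, σ ≠ (fun e => .inr (ω e)) →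
      energy C W (fun e => .inr (ω e)) + 1 / 2 ≤ energy C W σ) :
    ClassicalRegime (hamiltonian N J C W) := by
  have hground := hamiltonian_mulVec_single_inr J C W ω
  have hvanish : ∀ (μ : ℝ) (ψ : (Edge N → Spin c) → ℂ),
      μ < energy C W (fun e => .inr (ω e)) + 1 / 2 →
      hamiltonian N J C W *ᵥ ψ = (μ : ℂ) • ψ → ∀ σ ≠ fun e => .inr (ω e), ψ σ = 0 :=
    fun μ ψ hμ hψ σ hσ => eigenvector_apply_eq_zero_of_lt_energy hJ hψ (hμ.trans_le (h σ hσ))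
  refine ⟨energy C W fun e => .inr (ω e), ω, eigenspace_eq_span_single hground fun ψ hψ =>
    hvanish _ ψ (lt_add_of_pos_right _ one_half_pos) hψ, fun μ hμ => ?_⟩
  obtain ⟨ψ, hψ0, hψ⟩ := exists_eigenvector hμ
  refine or_iff_not_imp_right.2 fun hlt => Complex.ofReal_injective ?_
  exact eq_of_eigenvector_supported_on_single hground hψ0 hψ (hvanish μ ψ (not_le.1 hlt) hψ)

theorem inclusion_apply (σ : Edge N → Spin c) (τ : Edge N → Fin 2) :
    inclusion N c σ τ = if σ = fun e => .inl (τ e) then 1 else 0 := by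
  simp only [inclusion, tensorOp, Matrix.of_apply, Finset.prod_boole, Finset.mem_univ,
    true_implies, funext_iff]

theorem inclusion_mulVec_inl (φ : (Edge N → Fin 2) → ℂ) (τ : Edge N → Fin 2) :
    (inclusion N c *ᵥ φ) (fun e => .inl (τ e)) = φ τ := by
  have hinj : ∀ τ' : Edge N → Fin 2,
      ((fun e => .inl (τ e) : Edge N → Spin c) = fun e => .inl (τ' e)) ↔ τ = τ' := fun τ' => by
    simp only [funext_iff, Sum.inl.injEq]
  simp only [Matrix.mulVec, dotProduct, inclusion_apply, hinj, ite_mul, one_mul, zero_mul,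
    Finset.sum_ite_eq, Finset.mem_univ, if_true]

theorem inclusion_mulVec_injective (N c : ℕ) : Function.Injective (inclusion N c *ᵥ ·) :=
  fun φ φ' h => funext fun τ => by
    simpa only [inclusion_mulVec_inl] using congrFun h fun e => .inl (τ e)

theorem inclusion_mulVec_of_isRight (φ : (Edge N → Fin 2) → ℂ) {σ : Edge N → Spin c} {e : Edge N}
    (he : (σ e).isRight) : (inclusion N c *ᵥ φ) σ = 0 := by
  refine Finset.sum_eq_zero fun τ _ => ?_
  have hne : σ ≠ fun e => .inl (τ e) := by
    rintro rfl
    exact Bool.false_ne_true he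
  exact mul_eq_zero_of_left ((inclusion_apply σ τ).trans (if_neg hne)) _

theorem exists_isRight_or_eq_inl (σ : Edge N → Spin c) :
    (∃ e, (σ e).isRight) ∨ ∃ τ : Edge N → Fin 2, σ = fun e => .inl (τ e) := by
  refine or_iff_not_imp_left.2 fun h => ?_
  have hleft : ∀ e, ∃ k, σ e = .inl k := fun e =>
    Sum.isLeft_iff.1 (Sum.not_isRight.1 (not_exists.1 h e))
  choose τ hτ using hleft
  exact ⟨τ, funext hτ⟩

theorem exists_inclusion_mulVec_eq {ψ : (Edge N → Spin c) → ℂ}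
    (h : ∀ σ e, (σ e).isRight → ψ σ = 0) : ∃ φ, inclusion N c *ᵥ φ = ψ := by
  refine ⟨fun τ => ψ fun e => .inl (τ e), funext fun σ => ?_⟩
  rcases exists_isRight_or_eq_inl σ with ⟨e, he⟩ | ⟨τ, rfl⟩
  · rw [inclusion_mulVec_of_isRight _ he, h σ e he]
  · rw [inclusion_mulVec_inl]

theorem localProd_extend_mul_inclusion (s : Finset (Edge N)) (A : Matrix (Fin 2) (Fin 2) ℂ) :
    localProd s (extend c A) * inclusion N c = inclusion N c * localProd s A := by
  rw [localProd, localProd, inclusion, tensorOp_mul, tensorOp_mul]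
  congr 1
  ext1 e
  split_ifs
  · ext x k
    rw [Matrix.mul_apply, Matrix.mul_apply, Fintype.sum_sum_type]
    rcases x with x | x <;> simp [extend]
  · rw [Matrix.one_mul, Matrix.mul_one]

theorem stabilizerSum_extend_mul_inclusion (P A B : Matrix (Fin 2) (Fin 2) ℂ) :
    stabilizerSum N (extend c P) (extend c A) (extend c B) * inclusion N c =
      inclusion N c * stabilizerSum N P A B := by
  simp only [stabilizerSum, Matrix.add_mul, Matrix.mul_add, Matrix.sum_mul, Matrix.mul_sum,
    Matrix.sub_mul, Matrix.mul_sub, localProd_extend_mul_inclusion]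

theorem hamiltonian_mulVec_inclusion {J C : ℝ} {W : Couplings c}
    (h : ∀ τ : Edge N → Fin 2, energy C W (fun e => .inl (τ e)) = 0)
    (φ : (Edge N → Fin 2) → ℂ) :
    hamiltonian N J C W *ᵥ (inclusion N c *ᵥ φ) = inclusion N c *ᵥ (toricCode N J *ᵥ φ) := by
  have hdiag : (Matrix.diagonal fun σ => (energy C W σ : ℂ)) *ᵥ (inclusion N c *ᵥ φ) = 0 := by
    funext σ
    rw [Matrix.mulVec_diagonal, Pi.zero_apply]
    rcases exists_isRight_or_eq_inl σ with ⟨e, he⟩ | ⟨τ, rfl⟩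
    · rw [inclusion_mulVec_of_isRight _ he, mul_zero]
    · rw [h, Complex.ofReal_zero, zero_mul]
  rw [hamiltonian_eq, Matrix.add_mulVec, hdiag, add_zero, Matrix.smul_mulVec,
    Matrix.mulVec_mulVec, stabilizerSum_extend_mul_inclusion, toricCode, Matrix.smul_mulVec,
    Matrix.mulVec_smul, Matrix.mulVec_mulVec]

theorem hamiltonian_mulVec_inclusion_eq_smul_iff {J C : ℝ} {W : Couplings c}
    (h : ∀ τ : Edge N → Fin 2, energy C W (fun e => .inl (τ e)) = 0)
    {φ : (Edge N → Fin 2) → ℂ} {μ : ℂ} :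
    hamiltonian N J C W *ᵥ (inclusion N c *ᵥ φ) = μ • (inclusion N c *ᵥ φ) ↔
      toricCode N J *ᵥ φ = μ • φ := by
  rw [hamiltonian_mulVec_inclusion h, ← Matrix.mulVec_smul]
  exact (inclusion_mulVec_injective N c).eq_iff

theorem exists_toricCode_eigenvector {J : ℝ} (hJ : 0 ≤ J) {C : ℝ} {W : Couplings c}
    (h0 : ∀ τ : Edge N → Fin 2, energy C W (fun e => .inl (τ e)) = 0)
    (h : ∀ (σ : Edge N → Spin c) (e : Edge N), (σ e).isRight → 1 / 2 ≤ energy C W σ) {μ : ℝ}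
    (hμ : μ < 1 / 2) {ψ : (Edge N → Spin c) → ℂ}
    (hψ : hamiltonian N J C W *ᵥ ψ = (μ : ℂ) • ψ) :
    ∃ φ, toricCode N J *ᵥ φ = (μ : ℂ) • φ ∧ inclusion N c *ᵥ φ = ψ := by
  obtain ⟨φ, rfl⟩ := exists_inclusion_mulVec_eq (ψ := ψ) fun σ e he =>
    eigenvector_apply_eq_zero_of_lt_energy hJ hψ (hμ.trans_le (h σ e he))
  exact ⟨φ, (hamiltonian_mulVec_inclusion_eq_smul_iff h0).1 hψ, rfl⟩

theorem toricRegime_of_energy {J : ℝ} (hJ : 0 < J) {C : ℝ} {W : Couplings c}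
    (h0 : ∀ τ : Edge N → Fin 2, energy C W (fun e => .inl (τ e)) = 0)
    (h : ∀ (σ : Edge N → Spin c) (e : Edge N), (σ e).isRight → 1 / 2 ≤ energy C W σ) :
    ToricRegime J (hamiltonian N J C W) := by
  refine ⟨fun μ hμ => ?_, ?_, fun μ hμ => ?_⟩
  · ext ψ
    rw [mem_eigenspace_toLin', Submodule.mem_map]
    constructor
    · intro hψ
      obtain ⟨φ, hφ, rfl⟩ := exists_toricCode_eigenvector hJ.le h0 h hμ hψ
      exact ⟨φ, mem_eigenspace_toLin'.2 hφ, rfl⟩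
    · rintro ⟨φ, hφ, rfl⟩
      exact (hamiltonian_mulVec_inclusion_eq_smul_iff h0).2 (mem_eigenspace_toLin'.1 hφ)
  · refine Module.End.hasEigenvalue_of_hasEigenvector (x := inclusion N c *ᵥ coboundaryState N)
      ⟨?_, ?_⟩
    · rw [mem_eigenspace_toLin', hamiltonian_mulVec_inclusion h0,
        toricCode_mulVec_coboundaryState, Matrix.mulVec_zero, zero_smul]
    · rw [← Matrix.mulVec_zero (inclusion N c)]
      exact (inclusion_mulVec_injective N c).ne (coboundaryState_ne_zero N)
  · obtain ⟨ψ, hψ0, hψ⟩ := exists_eigenvector hμ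
    rcases le_or_gt (1 / 2) μ with hle | hlt
    · exact .inr (min_le_of_right_le hle)
    · obtain ⟨φ, hφ, rfl⟩ := exists_toricCode_eigenvector hJ.le h0 h hlt hψ
      have hφ0 : φ ≠ 0 := by
        rintro rfl
        exact hψ0 (Matrix.mulVec_zero _)
      exact (toricCode_eigenvalue hJ hφ0 hφ).imp_right min_le_of_left_le

end Regimes

/-! ### Uniqueness and finiteness of thresholds -/

section Finiteness

variable {N c : ℕ}

theorem ClassicalRegime.not_toricRegime {J : ℝ} {H : Matrix (Edge N → Spin c) (Edge N → Spin c) ℂ}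
    (hcl : ClassicalRegime H) (hN : 1 ≤ N) (hJ : 0 < J) : ¬ToricRegime J H := by
  rintro ⟨hlow, hzero, hgap⟩
  obtain ⟨E, ω, hE, hclgap⟩ := hcl
  have hmem : Pi.single (fun e => (Sum.inr (ω e) : Spin c)) (1 : ℂ) ∈
      Module.End.eigenspace (Matrix.toLin' H) (E : ℂ) :=
    hE ▸ Submodule.mem_span_singleton_self _
  have hE_gap := hgap E (Module.End.hasEigenvalue_of_hasEigenvector
    ⟨hmem, (Pi.single_eq_zero_iff).not.2 one_ne_zero⟩)
  have hE0 : E = 0 := by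
    rcases hclgap 0 (by exact_mod_cast hzero) with h0 | hneg
    · exact h0.symm
    · have hmin : (0 : ℝ) < min (2 * J) (1 / 2) := lt_min (mul_pos two_pos hJ) one_half_pos
      exact hE_gap.resolve_right (by linarith)
  rw [hlow E (hE0 ▸ one_half_pos), Submodule.mem_map] at hmem
  obtain ⟨φ, -, hφ⟩ := hmem
  have happly := congrFun hφ fun e => .inr (ω e)
  rw [Matrix.toLin'_apply, inclusion_mulVec_of_isRight (e := .inr (0, ⟨0, hN⟩)) _ rfl,
    Pi.single_eq_same] at happly
  exact zero_ne_one happly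

theorem HasTransitionAt.le {C : ℝ} {W : Couplings c} {m n : ℕ} (hm : HasTransitionAt C W m)
    (hn : HasTransitionAt C W n) : n ≤ m := by
  by_contra hlt
  exact ((hn.2 1 one_pos n hn.1).1 le_rfl).not_toricRegime hn.1 one_pos
    ((hm.2 1 one_pos n hn.1).2 (not_le.1 hlt))

theorem finite_setOf_admissible (c : ℕ) : {W : Couplings c | W.Admissible}.Finite := by
  let values : Set ℝ := (fun k : ℤ => (k : ℝ) / 2) '' {k | |k| ≤ 16}
  have hvalues : values.Finite :=
    ((Set.finite_Icc (-16 : ℤ) 16).subset fun _ hk => abs_le.1 hk).image _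
  have hplaq : (Set.univ.pi fun _ : Dir → Fin c => values).Finite := .pi fun _ => hvalues
  have hstar : (Set.univ.pi fun _ : Dir → Option (Fin c) => values).Finite := .pi fun _ => hvalues
  have hinj : Function.Injective fun W : Couplings c => (W.plaq, W.star) := by
    rintro ⟨p, s⟩ ⟨p', s'⟩ h
    exact congrArg₂ Couplings.mk (Prod.ext_iff.1 h).1 (Prod.ext_iff.1 h).2
  refine ((hplaq.prod hstar).preimage hinj.injOn).subset ?_
  rintro W ⟨hp, hs, -⟩
  exact ⟨fun w _ => (hp w).imp fun k hk => ⟨hk.1, hk.2.symm⟩,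
    fun t _ => (hs t).imp fun k hk => ⟨hk.1, hk.2.symm⟩⟩

theorem finite_setOf_isThreshold (C : ℝ) (d : ℕ) : {n | IsThreshold C d n}.Finite := by
  have hunion : {n | IsThreshold C d n} =
      ⋃ W ∈ {W : Couplings (d - 2) | W.Admissible}, {n | HasTransitionAt C W n} := by
    ext n
    simp only [IsThreshold, Set.mem_ofPred_eq, Set.mem_iUnion, exists_prop]
  rw [hunion]
  exact (finite_setOf_admissible _).biUnion fun W _ =>
    Set.Subsingleton.finite fun m hm n hn => le_antisymm (hn.le hm) (hm.le hn)

end Finiteness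

/-! ### Deterministic tiling rules -/

/-- A rule assigns to the colours of the west and south legs of a vertex (`none` if the leg is
absent) the colours of the north and east legs, or `none` if there is no admissible choice. -/
abbrev Rule (K : Type*) : Type _ := Option K → Option K → Option (K × K)

/-- The colours of the north and east legs of the vertex `(i, j)` that a rule forces, or `none` if
the rule gets stuck there or before. -/
def Rule.evolve {K : Type*} (ϕ : Rule K) : ℕ → ℕ → Option (K × K)
  | 0, 0 => ϕ none none
  | i + 1, 0 => (ϕ.evolve i 0).bind fun p => ϕ (some p.2) none
  | 0, j + 1 => (ϕ.evolve 0 j).bind fun q => ϕ none (some q.1)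
  | i + 1, j + 1 => (ϕ.evolve i (j + 1)).bind fun p =>
      (ϕ.evolve (i + 1) j).bind fun q => ϕ (some p.2) (some q.1)
  termination_by i j => i + j

/-- The rule does not get stuck at vertices of the `N × N` lattice that have a north or east leg. -/
def Rule.Survives {K : Type*} (ϕ : Rule K) (N : ℕ) : Prop :=
  ∀ i j, i ≤ N → j ≤ N → (i < N ∨ j < N) → (ϕ.evolve i j).isSome

theorem Rule.Survives.mono {K : Type*} {ϕ : Rule K} {M N : ℕ} (h : ϕ.Survives N) (hMN : M ≤ N) :
    ϕ.Survives M :=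
  fun i j hi hj hij => h i j (hi.trans hMN) (hj.trans hMN) (by omega)

section Evolve

variable {K : Type*} {ϕ : Rule K}

theorem Rule.evolve_eq_of_solution {P : ℕ → ℕ → Prop} {v h : ℕ → ℕ → K}
    (hPi : ∀ i j, P (i + 1) j → P i j) (hPj : ∀ i j, P i (j + 1) → P i j)
    (h00 : P 0 0 → ϕ none none = some (v 0 0, h 0 0))
    (hi0 : ∀ i, P (i + 1) 0 → ϕ (some (h i 0)) none = some (v (i + 1) 0, h (i + 1) 0))
    (h0j : ∀ j, P 0 (j + 1) → ϕ none (some (v 0 j)) = some (v 0 (j + 1), h 0 (j + 1)))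
    (hij : ∀ i j, P (i + 1) (j + 1) → ϕ (some (h i (j + 1))) (some (v (i + 1) j)) =
      some (v (i + 1) (j + 1), h (i + 1) (j + 1))) :
    ∀ i j, P i j → ϕ.evolve i j = some (v i j, h i j)
  | 0, 0, hP => by rw [Rule.evolve, h00 hP]
  | i + 1, 0, hP => by
    rw [Rule.evolve, evolve_eq_of_solution hPi hPj h00 hi0 h0j hij i 0 (hPi _ _ hP),
      Option.bind_some, hi0 i hP]
  | 0, j + 1, hP => by
    rw [Rule.evolve, evolve_eq_of_solution hPi hPj h00 hi0 h0j hij 0 j (hPj _ _ hP),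
      Option.bind_some, h0j j hP]
  | i + 1, j + 1, hP => by
    rw [Rule.evolve, evolve_eq_of_solution hPi hPj h00 hi0 h0j hij i (j + 1) (hPi _ _ hP),
      evolve_eq_of_solution hPi hPj h00 hi0 h0j hij (i + 1) j (hPj _ _ hP),
      Option.bind_some, Option.bind_some, hij i j hP]
  termination_by i j => i + j

/-- Renaming the colours of a rule. -/
def Rule.rename {L : Type*} (e : K ≃ L) (ϕ : Rule K) : Rule L :=
  fun w s => (ϕ (w.map e.symm) (s.map e.symm)).map (Prod.map e e)

theorem Rule.evolve_rename {L : Type*} (e : K ≃ L) :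
    ∀ i j, (ϕ.rename e).evolve i j = (ϕ.evolve i j).map (Prod.map e e)
  | 0, 0 => by rw [Rule.evolve, Rule.evolve]; rfl
  | i + 1, 0 => by
    rw [Rule.evolve, Rule.evolve, evolve_rename e i 0]
    cases ϕ.evolve i 0 <;> simp [Rule.rename]
  | 0, j + 1 => by
    rw [Rule.evolve, Rule.evolve, evolve_rename e 0 j]
    cases ϕ.evolve 0 j <;> simp [Rule.rename]
  | i + 1, j + 1 => by
    rw [Rule.evolve, Rule.evolve, evolve_rename e i (j + 1), evolve_rename e (i + 1) j]
    cases ϕ.evolve i (j + 1) <;> cases ϕ.evolve (i + 1) j <;> simp [Rule.rename]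
  termination_by i j => i + j

theorem Rule.survives_rename {L : Type*} (e : K ≃ L) (N : ℕ) :
    (ϕ.rename e).Survives N ↔ ϕ.Survives N := by
  simp [Rule.Survives, Rule.evolve_rename]

end Evolve

/-! ### Vertex energies -/

section VertexEnergy

variable {c : ℕ}

theorem sum_powerset_alternating {α : Type*} [DecidableEq α] (f : Finset α → ℤ) (U : Finset α) :
    ∑ A ∈ U.powerset, ∑ B ∈ A.powerset, (-1) ^ (A \ B).card * f B = f U := by
  induction U using Finset.induction_on generalizing f with
  | empty => simp
  | insert x U hx ih =>
    rw [Finset.sum_powerset_insert hx, ← Finset.sum_add_distrib, ← ih fun B => f (insert x B)]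
    refine Finset.sum_congr rfl fun A hA => ?_
    have hxA : x ∉ A := fun h => hx (Finset.mem_powerset.1 hA h)
    rw [Finset.sum_powerset_insert hxA, ← add_assoc, ← Finset.sum_add_distrib,
      Finset.sum_eq_zero, zero_add]
    · refine Finset.sum_congr rfl fun B _ => ?_
      rw [Finset.insert_sdiff_insert, Finset.sdiff_insert_of_notMem hxA]
    · intro B hB
      have hxB : x ∉ B := fun h => hxA (Finset.mem_powerset.1 hB h)
      rw [Finset.insert_sdiff_of_notMem _ hxB, Finset.card_insert_of_notMem (by simp [hxA]),
        pow_succ]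
      ring

/-- The legs that a pattern involves. -/
def legs (t : Dir → Option (Fin c)) : Finset Dir :=
  Finset.univ.filter fun a => (t a).isSome

theorem mem_legs {t : Dir → Option (Fin c)} {a : Dir} : a ∈ legs t ↔ (t a).isSome := by
  simp [legs]

/-- The part of a pattern on a set of legs. -/
def restrict (t : Dir → Option (Fin c)) (B : Finset Dir) : Dir → Option (Fin c) :=
  fun a => if a ∈ B then t a else none

theorem legs_restrict (t : Dir → Option (Fin c)) {B : Finset Dir} (hB : B ⊆ legs t) :
    legs (restrict t B) = B := by
  ext a
  rw [mem_legs, restrict]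
  by_cases h : a ∈ B
  · simpa [h] using mem_legs.1 (hB h)
  · simp [h]

theorem restrict_restrict (t : Dir → Option (Fin c)) {A B : Finset Dir} (h : B ⊆ A) :
    restrict (restrict t A) B = restrict t B := by
  funext a
  by_cases ha : a ∈ B
  · simp [restrict, ha, h ha]
  · simp [restrict, ha]

theorem restrict_legs (t : Dir → Option (Fin c)) : restrict t (legs t) = t := by
  funext a
  by_cases ha : a ∈ legs t
  · simp [restrict, ha]
  · rw [mem_legs, Option.not_isSome_iff_eq_none] at ha
    simp [restrict, ha]

/-- The north and east legs of a pattern are as the rule prescribes. -/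
def Rule.Obeys (ϕ : Rule (Fin c)) (t : Dir → Option (Fin c)) : Prop :=
  (∀ k, t .north = some k → (ϕ (t .west) (t .south)).map Prod.fst = some k) ∧
    ∀ k, t .east = some k → (ϕ (t .west) (t .south)).map Prod.snd = some k

/-- Twice the penalty for violating a rule, depending on the legs present. -/
def penalty (B : Finset Dir) : ℤ :=
  if B = {.north, .east} then 1
  else if B = {.south, .east} ∨ B = {.north, .west} ∨ 3 ≤ B.card then 2 else 0

theorem penalty_nonneg (B : Finset Dir) : 0 ≤ penalty B := by
  unfold penalty
  split_ifs <;> norm_num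

theorem penalty_eq_two {B : Finset Dir} (hne : .north ∈ B ∨ .east ∈ B)
    (hns : .north ∈ B ∨ .south ∈ B) (hew : .east ∈ B ∨ .west ∈ B) (hsw : .south ∈ B ∨ .west ∈ B) :
    penalty B = 2 := by
  revert B
  decide

theorem sum_penalty : ∑ B : Finset Dir, penalty B = 15 := by decide

open Classical in
/-- Twice the energy of a vertex: violations of the rule are penalised, and the lower left corner
of the lattice gets a bonus. -/
noncomputable def Rule.vertexEnergy (ϕ : Rule (Fin c)) (t : Dir → Option (Fin c)) : ℤ :=
  if ϕ.Obeys t then (if legs t = {.north, .east} then -1 else 0) else penalty (legs t)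

theorem Rule.abs_vertexEnergy_le (ϕ : Rule (Fin c)) (t : Dir → Option (Fin c)) :
    |ϕ.vertexEnergy t| ≤ penalty (legs t) := by
  unfold Rule.vertexEnergy
  split_ifs with hobeys hcorner
  · rw [hcorner]; decide
  · simpa using penalty_nonneg _
  · rw [abs_of_nonneg (penalty_nonneg _)]

theorem legs_none : legs (fun _ => (none : Option (Fin c))) = ∅ := by
  simp [legs]

theorem Rule.obeys_of_notMem_legs (ϕ : Rule (Fin c)) {t : Dir → Option (Fin c)}
    (hnorth : .north ∉ legs t) (heast : .east ∉ legs t) : ϕ.Obeys t := by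
  rw [mem_legs, Option.not_isSome_iff_eq_none] at hnorth heast
  simp [Rule.Obeys, hnorth, heast]

theorem Rule.vertexEnergy_none (ϕ : Rule (Fin c)) : ϕ.vertexEnergy (fun _ => none) = 0 := by
  have hobeys : ϕ.Obeys fun _ => none :=
    ϕ.obeys_of_notMem_legs (by simp [legs_none]) (by simp [legs_none])
  rw [Rule.vertexEnergy, if_pos hobeys, legs_none, if_neg (by decide)]

/-- The star energies that add up to `vertexEnergy`, by inclusion-exclusion. -/
noncomputable def Rule.starEnergy (ϕ : Rule (Fin c)) (t : Dir → Option (Fin c)) : ℤ :=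
  ∑ B ∈ (legs t).powerset, (-1) ^ (legs t \ B).card * ϕ.vertexEnergy (restrict t B)

theorem Rule.abs_starEnergy_le (ϕ : Rule (Fin c)) (t : Dir → Option (Fin c)) :
    |ϕ.starEnergy t| ≤ 16 := by
  calc |ϕ.starEnergy t| ≤ ∑ B ∈ (legs t).powerset,
        |(-1) ^ (legs t \ B).card * ϕ.vertexEnergy (restrict t B)| :=
        Finset.abs_sum_le_sum_abs _ _
    _ ≤ ∑ B ∈ (legs t).powerset, penalty B := by
        refine Finset.sum_le_sum fun B hB => ?_
        rw [abs_mul, abs_pow, abs_neg, abs_one, one_pow, one_mul]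
        simpa only [legs_restrict t (Finset.mem_powerset.1 hB)] using
          ϕ.abs_vertexEnergy_le (restrict t B)
    _ ≤ ∑ B : Finset Dir, penalty B :=
        Finset.sum_le_sum_of_subset_of_nonneg (Finset.subset_univ _) fun B _ _ => penalty_nonneg B
    _ ≤ 16 := by rw [sum_penalty]; norm_num

theorem sum_starEnergy (ϕ : Rule (Fin c)) (P : Dir → Option (Fin c)) :
    ∑ t ∈ (legs P).powerset.image (restrict P), ϕ.starEnergy t = ϕ.vertexEnergy P := by
  rw [Finset.sum_image, ← restrict_legs P,
    ← sum_powerset_alternating (fun B => ϕ.vertexEnergy (restrict P B)) (legs P), restrict_legs]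
  · refine Finset.sum_congr rfl fun A hA => ?_
    rw [Rule.starEnergy, legs_restrict P (Finset.mem_powerset.1 hA)]
    refine Finset.sum_congr rfl fun B hB => ?_
    rw [restrict_restrict P (Finset.mem_powerset.1 hB)]
  · intro A hA B hB (hAB : restrict P A = restrict P B)
    rw [← legs_restrict P (Finset.mem_powerset.1 hA), hAB,
      legs_restrict P (Finset.mem_powerset.1 hB)]

/-- The classical interaction that enforces a rule. -/
noncomputable def Rule.couplings (ϕ : Rule (Fin c)) : Couplings c where
  plaq _ := 0
  star t := (ϕ.starEnergy t : ℝ) / 2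

theorem Rule.starEnergy_none (ϕ : Rule (Fin c)) : ϕ.starEnergy (fun _ => none) = 0 := by
  have hrestrict : restrict (fun _ => (none : Option (Fin c))) ∅ = fun _ => none := by
    simpa only [legs_none] using restrict_legs fun _ => (none : Option (Fin c))
  simp [Rule.starEnergy, legs_none, hrestrict, ϕ.vertexEnergy_none]

theorem Rule.couplings_admissible (ϕ : Rule (Fin c)) : ϕ.couplings.Admissible :=
  ⟨fun _ => ⟨0, by norm_num, by simp [couplings]⟩,
    fun t => ⟨ϕ.starEnergy t, ϕ.abs_starEnergy_le t, rfl⟩,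
    by simp [couplings, ϕ.starEnergy_none]⟩

end VertexEnergy

section RuleEnergy

variable {N c : ℕ}

/-- The classical colours around a vertex. -/
def patternOf (σ : Edge N → Spin c) (v : Vertex N) : Dir → Option (Fin c) :=
  fun a => (leg v a).bind fun e => (σ e).getRight?

theorem patternAt_iff {σ : Edge N → Spin c} {v : Vertex N} {t : Dir → Option (Fin c)} :
    PatternAt t σ v ↔ t ∈ (legs (patternOf σ v)).powerset.image (restrict (patternOf σ v)) := by
  have patternAt_iff_le :
      PatternAt t σ v ↔ ∀ a k, t a = some k → patternOf σ v a = some k := by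
    simp only [PatternAt, patternOf, Option.bind_eq_some_iff, Sum.getRight?_eq_some_iff]
  rw [patternAt_iff_le, Finset.mem_image]
  constructor
  · intro h
    refine ⟨legs t, Finset.mem_powerset.2 fun a ha => ?_, ?_⟩
    · simp only [mem_legs, Option.isSome_iff_exists] at ha ⊢
      obtain ⟨k, hk⟩ := ha
      exact ⟨k, h a k hk⟩
    · funext a
      rcases ht : t a with _ | k
      · simp [restrict, mem_legs, ht]
      · simp [restrict, mem_legs, ht, h a k ht]
  · rintro ⟨A, -, rfl⟩ a k h
    by_cases ha : a ∈ A
    · simpa [restrict, ha] using h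
    · simp [restrict, ha] at h

open Classical in
theorem classicalEnergy_couplings (ϕ : Rule (Fin c)) (σ : Edge N → Spin c) :
    classicalEnergy ϕ.couplings σ = ((∑ v, ϕ.vertexEnergy (patternOf σ v) : ℤ) : ℝ) / 2 := by
  rw [classicalEnergy, Finset.sum_eq_zero, zero_add]
  · push_cast
    rw [Finset.sum_div]
    refine Finset.sum_congr rfl fun v _ => ?_
    rw [← sum_starEnergy, Int.cast_sum, Finset.sum_div, ← Finset.sum_filter]
    refine Finset.sum_congr ?_ fun t _ => rfl
    ext t
    rw [Finset.mem_filter, patternAt_iff]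
    simp
  · intro p _
    refine Finset.sum_eq_zero fun w _ => ?_
    simp [Rule.couplings]

theorem exists_leg_iff (v : Vertex N) (a : Dir) :
    (∃ e, leg v a = some e) ↔ match a with
      | .north => v.2.1 < N
      | .east => v.1.1 < N
      | .south => 0 < v.2.1
      | .west => 0 < v.1.1 := by
  cases a <;> simp [leg]

theorem mismatches_inl (τ : Edge N → Fin 2) :
    mismatches (fun e => .inl (τ e) : Edge N → Spin c) = 0 := by
  simp [mismatches]

theorem mismatches_inr (ω : Edge N → Fin c) :
    mismatches (fun e => .inr (ω e) : Edge N → Spin c) = 0 := by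
  simp [mismatches]

theorem energy_couplings (C : ℝ) (ϕ : Rule (Fin c)) (σ : Edge N → Spin c) :
    energy C ϕ.couplings σ =
      ((∑ v, ϕ.vertexEnergy (patternOf σ v) : ℤ) : ℝ) / 2 + C * mismatches σ := by
  rw [energy, classicalEnergy_couplings]

theorem energy_inl (C : ℝ) (ϕ : Rule (Fin c)) (τ : Edge N → Fin 2) :
    energy C ϕ.couplings (fun e => .inl (τ e)) = 0 := by
  have patternOf_inl (v : Vertex N) :
      patternOf (fun e => .inl (τ e) : Edge N → Spin c) v = fun _ => none := by
    funext a
    simp [patternOf]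
  simp [energy_couplings, mismatches_inl, patternOf_inl, ϕ.vertexEnergy_none]

/-- The configuration obeys the rule at every vertex. -/
def Rule.Tiling (ϕ : Rule (Fin c)) (ω : Edge N → Fin c) : Prop :=
  ∀ v, ϕ.Obeys (patternOf (fun e => .inr (ω e)) v)

theorem patternOf_inr (ω : Edge N → Fin c) (v : Vertex N) (a : Dir) :
    patternOf (fun e => .inr (ω e)) v a = (leg v a).map ω := by
  cases h : leg v a <;> simp [patternOf, h]

theorem mem_legs_patternOf_inr (ω : Edge N → Fin c) (v : Vertex N) (a : Dir) :
    a ∈ legs (patternOf (fun e => .inr (ω e)) v) ↔ ∃ e, leg v a = some e := by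
  rw [mem_legs, patternOf_inr, Option.isSome_map, Option.isSome_iff_exists]

theorem column_pos_or_row_pos {v : Vertex N} (hv : v ≠ 0) : 0 < v.1.1 ∨ 0 < v.2.1 := by
  by_contra! hcon
  exact hv (Prod.ext (Fin.ext (by simpa using hcon.1)) (Fin.ext (by simpa using hcon.2)))

theorem legs_patternOf_inr_eq_iff (hN : 1 ≤ N) (ω : Edge N → Fin c) (v : Vertex N) :
    legs (patternOf (fun e => .inr (ω e)) v) = {.north, .east} ↔ v = 0 := by
  have legs_eq_iff : legs (patternOf (fun e => .inr (ω e)) v) = {.north, .east} ↔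
      v.2.1 < N ∧ v.1.1 < N ∧ ¬0 < v.2.1 ∧ ¬0 < v.1.1 := by
    rw [Finset.ext_iff]
    simp only [mem_legs_patternOf_inr, exists_leg_iff]
    constructor
    · intro h
      exact ⟨by simpa using h .north, by simpa using h .east, by simpa using h .south,
        by simpa using h .west⟩
    · rintro ⟨_, _, _, _⟩ a
      cases a <;> simp_all
  rw [legs_eq_iff, Prod.ext_iff, Fin.ext_iff, Fin.ext_iff]
  simp only [Prod.fst_zero, Prod.snd_zero, Fin.val_zero]
  omega

theorem energy_inr_of_tiling (hN : 1 ≤ N) (C : ℝ) {ϕ : Rule (Fin c)} {ω : Edge N → Fin c}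
    (h : ϕ.Tiling ω) : energy C ϕ.couplings (fun e => .inr (ω e)) = -1 / 2 := by
  have vertexEnergy_eq (v : Vertex N) :
      ϕ.vertexEnergy (patternOf (fun e => .inr (ω e)) v) = if v = 0 then -1 else 0 := by
    rw [Rule.vertexEnergy, if_pos (h v)]
    exact if_congr (legs_patternOf_inr_eq_iff hN ω v) rfl rfl
  simp [energy_couplings, mismatches_inr, vertexEnergy_eq]

theorem vertexEnergy_nonneg_of_ne_zero (hN : 1 ≤ N) (ϕ : Rule (Fin c)) (ω : Edge N → Fin c)
    {v : Vertex N} (hv : v ≠ 0) : 0 ≤ ϕ.vertexEnergy (patternOf (fun e => .inr (ω e)) v) := by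
  rw [Rule.vertexEnergy, if_neg (mt (legs_patternOf_inr_eq_iff hN ω v).1 hv)]
  split_ifs
  · exact le_rfl
  · exact penalty_nonneg _

theorem vertexEnergy_eq_two_of_not_obeys (hN : 1 ≤ N) {ϕ : Rule (Fin c)} {ω : Edge N → Fin c}
    {v : Vertex N} (hv : v ≠ 0) (h : ¬ϕ.Obeys (patternOf (fun e => .inr (ω e)) v)) :
    ϕ.vertexEnergy (patternOf (fun e => .inr (ω e)) v) = 2 := by
  have hpos := column_pos_or_row_pos hv
  rw [Rule.vertexEnergy, if_neg h]
  refine penalty_eq_two ?_ ?_ ?_ ?_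
  · by_contra! hcon
    exact h (ϕ.obeys_of_notMem_legs hcon.1 hcon.2)
  all_goals
    simp only [mem_legs_patternOf_inr, exists_leg_iff]
    omega

theorem one_le_sum_vertexEnergy (hN : 1 ≤ N) {ϕ : Rule (Fin c)} {ω : Edge N → Fin c}
    (h : ¬ϕ.Tiling ω) : 1 ≤ ∑ v : Vertex N, ϕ.vertexEnergy (patternOf (fun e => .inr (ω e)) v) := by
  have hnonneg : ∀ v ∈ Finset.univ.erase (0 : Vertex N),
      0 ≤ ϕ.vertexEnergy (patternOf (fun e => .inr (ω e)) v) :=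
    fun v hv => vertexEnergy_nonneg_of_ne_zero hN ϕ ω (Finset.ne_of_mem_erase hv)
  have hcorner := (legs_patternOf_inr_eq_iff hN ω 0).2 rfl
  rw [← Finset.add_sum_erase _ _ (Finset.mem_univ 0)]
  by_cases hobeys : ϕ.Obeys (patternOf (fun e => .inr (ω e)) 0)
  · obtain ⟨v, hv⟩ := not_forall.1 h
    have hv0 : v ≠ 0 := by
      rintro rfl
      exact hv hobeys
    have hsingle := Finset.single_le_sum hnonneg (Finset.mem_erase.2 ⟨hv0, Finset.mem_univ v⟩)
    rw [vertexEnergy_eq_two_of_not_obeys hN hv0 hv] at hsingle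
    rw [Rule.vertexEnergy, if_pos hobeys, if_pos hcorner]
    omega
  · have hpenalty : penalty {.north, .east} = 1 := by decide
    rw [Rule.vertexEnergy, if_neg hobeys, hcorner, hpenalty]
    linarith [Finset.sum_nonneg hnonneg]

theorem one_half_le_energy_inr (hN : 1 ≤ N) (C : ℝ) {ϕ : Rule (Fin c)} {ω : Edge N → Fin c}
    (h : ¬ϕ.Tiling ω) : 1 / 2 ≤ energy C ϕ.couplings (fun e => .inr (ω e)) := by
  rw [energy_couplings, mismatches_inr, Nat.cast_zero, mul_zero, add_zero]
  gcongr
  exact_mod_cast one_le_sum_vertexEnergy hN h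

/-! ### Domain walls -/

theorem isLeft_eq_of_mem_starEdges {σ : Edge N → Spin c} (h : mismatches σ = 0)
    {v : Vertex N} {e e' : Edge N} (he : e ∈ starEdges v) (he' : e' ∈ starEdges v) :
    (σ e).isLeft = (σ e').isLeft := by
  classical
  have isLeft_of_isLeft : ∀ e e' : Edge N, e ∈ starEdges v → e' ∈ starEdges v → (σ e).isLeft →
      (σ e').isLeft := by
    intro e e' he he' hleft
    by_contra hright
    rw [mismatches, Finset.card_eq_zero, Finset.filter_eq_empty_iff] at h
    refine h (Finset.mem_univ (e, e')) ⟨⟨?_, v, he, he'⟩, hleft, ?_⟩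
    · exact ne_of_apply_ne (fun f => (σ f).isLeft) fun heq => hright (heq ▸ hleft)
    · simpa using hright
  exact Bool.eq_iff_iff.2 ⟨isLeft_of_isLeft e e' he he', isLeft_of_isLeft e' e he' he⟩

theorem source_mem (e : Edge N) : e ∈ starEdges (source e) := mem_starEdges.2 (.inl rfl)

theorem target_mem (e : Edge N) : e ∈ starEdges (target e) := mem_starEdges.2 (.inr rfl)

/-- All edges at `v` and `w` are in the same sector. -/
def SameSector (σ : Edge N → Spin c) (v w : Vertex N) : Prop :=
  ∀ e e', e ∈ starEdges v → e' ∈ starEdges w → (σ e).isLeft = (σ e').isLeft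

theorem SameSector.target {σ : Edge N → Spin c} (h : mismatches σ = 0) {v : Vertex N} {f : Edge N}
    (hv : SameSector σ v (source f)) : SameSector σ v (target f) := fun e _ he he' =>
  (hv e f he (source_mem f)).trans (isLeft_eq_of_mem_starEdges h (target_mem f) he')

theorem sameSector_zero {σ : Edge N → Spin c} (h : mismatches σ = 0) (v : Vertex N) :
    SameSector σ 0 v := by
  have firstColumn : ∀ (j : ℕ) (hj : j < N + 1), SameSector σ 0 (0, ⟨j, hj⟩) := by
    intro j
    induction j with
    | zero => exact fun _ _ _ he he' => isLeft_eq_of_mem_starEdges h he he'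
    | succ j ih => exact fun _ => (ih (by omega)).target h (f := .inr (0, ⟨j, by omega⟩))
  have anyColumn : ∀ (i : ℕ) (hi : i < N + 1) (y : Fin (N + 1)), SameSector σ 0 (⟨i, hi⟩, y) := by
    intro i
    induction i with
    | zero => exact fun _ y => firstColumn y.1 y.2
    | succ i ih => exact fun _ y => (ih (by omega) y).target h (f := .inl (⟨i, by omega⟩, y))
  exact anyColumn v.1.1 v.1.2 v.2

theorem isLeft_eq_of_mismatches_eq_zero {σ : Edge N → Spin c} (h : mismatches σ = 0)
    (e e' : Edge N) : (σ e).isLeft = (σ e').isLeft := by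
  have hN : 0 < N := by
    rcases e with ⟨i, -⟩ | ⟨-, i⟩ <;> exact i.pos
  have hcorner : (.inr (0, ⟨0, hN⟩) : Edge N) ∈ starEdges (0 : Vertex N) :=
    mem_starEdges.2 (.inl rfl)
  exact (sameSector_zero h (source e) _ e hcorner (source_mem e)).symm.trans
    (sameSector_zero h (source e') _ e' hcorner (source_mem e'))

theorem exists_mismatch_of_corner {σ : Edge N → Spin c} {v : Vertex N}
    (hv : legs (patternOf σ v) = {.north, .east}) (hv0 : v ≠ 0) :
    ∃ e e', Adjacent e e' ∧ (σ e).isLeft ∧ (σ e').isRight ∧ leg v .north = some e' := by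
  have mem_corner_iff (a : Dir) :
      a ∈ ({.north, .east} : Finset Dir) ↔ ∃ e, leg v a = some e ∧ (σ e).isRight := by
    rw [← hv, mem_legs, patternOf]
    rcases leg v a with _ | e
    · simp
    · rcases h : σ e with x | x <;> simp [h]
  obtain ⟨e', he', hright⟩ := (mem_corner_iff .north).1 (by decide)
  obtain ⟨a, ha, e, he⟩ : ∃ a, a ∉ ({.north, .east} : Finset Dir) ∧ ∃ e, leg v a = some e := by
    rcases column_pos_or_row_pos hv0 with h | h
    · exact ⟨.west, by decide, (exists_leg_iff v .west).2 h⟩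
    · exact ⟨.south, by decide, (exists_leg_iff v .south).2 h⟩
  have hleft : ¬(σ e).isRight := fun h => ha ((mem_corner_iff a).2 ⟨e, he, h⟩)
  refine ⟨e, e', ⟨?_, v, ?_, ?_⟩, Sum.not_isRight.1 hleft, hright, he'⟩
  · rintro rfl
    exact hleft hright
  · simpa [starEdges] using ⟨a, he⟩
  · simpa [starEdges] using ⟨Dir.north, he'⟩

theorem leg_north_injective {v w : Vertex N} {e : Edge N} (hv : leg v .north = some e)
    (hw : leg w .north = some e) : v = w := by
  simp only [leg, Option.dite_none_right_eq_some, Option.some.injEq] at hv hw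
  obtain ⟨_, hv⟩ := hv
  obtain ⟨_, hw⟩ := hw
  have hvw := hv.trans hw.symm
  simp only [Sum.inr.injEq, Prod.mk.injEq, Fin.mk.injEq] at hvw
  exact Prod.ext hvw.1 (Fin.ext hvw.2)

theorem card_corners_le (σ : Edge N → Spin c) :
    (Finset.univ.filter fun v : Vertex N => legs (patternOf σ v) = {.north, .east}).card ≤
      mismatches σ + 1 := by
  classical
  rw [← Nat.sub_le_iff_le_add]
  refine (Finset.pred_card_le_card_erase (a := (0 : Vertex N))).trans ?_
  refine Finset.card_le_card_of_forall_subsingleton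
    (fun v x => leg v .north = some x.2) (fun v hv => ?_) fun x _ v hv w hw => ?_
  · obtain ⟨hv0, hv⟩ := Finset.mem_erase.1 hv
    obtain ⟨e, e', hadj, hleft, hright, hleg⟩ :=
      exists_mismatch_of_corner (Finset.mem_filter.1 hv).2 hv0
    exact ⟨(e, e'), Finset.mem_filter.2 ⟨Finset.mem_univ _, hadj, hleft, hright⟩, hleg⟩
  · exact leg_north_injective hv.2 hw.2

/-- Only the corners of the classical region gain energy, and all but one of them are paid for by
the domain wall next to them. -/
theorem one_half_le_energy_of_mixed {C : ℝ} (hC : 3 / 2 ≤ C) (ϕ : Rule (Fin c))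
    {σ : Edge N → Spin c} (h : mismatches σ ≠ 0) : 1 / 2 ≤ energy C ϕ.couplings σ := by
  have neg_one_le (v : Vertex N) :
      -(if legs (patternOf σ v) = {.north, .east} then (1 : ℤ) else 0) ≤
        ϕ.vertexEnergy (patternOf σ v) := by
    have := penalty_nonneg (legs (patternOf σ v))
    unfold Rule.vertexEnergy
    split_ifs <;> omega
  have hsum := Finset.sum_le_sum fun v (_ : v ∈ Finset.univ) => neg_one_le v
  rw [Finset.sum_neg_distrib, ← Finset.sum_filter, Finset.sum_const, nsmul_eq_mul, mul_one] at hsum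
  have hcard : -((mismatches σ : ℤ) + 1) ≤ ∑ v : Vertex N, ϕ.vertexEnergy (patternOf σ v) := by
    have := card_corners_le σ
    omega
  have hcard' : -((mismatches σ : ℝ) + 1) ≤
      ((∑ v : Vertex N, ϕ.vertexEnergy (patternOf σ v) : ℤ) : ℝ) := by
    exact_mod_cast hcard
  have hmismatches : (1 : ℝ) ≤ mismatches σ := by exact_mod_cast Nat.one_le_iff_ne_zero.2 h
  rw [energy_couplings]
  nlinarith

theorem sector_cases (σ : Edge N → Spin c) :
    (∃ τ : Edge N → Fin 2, σ = fun e => .inl (τ e)) ∨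
      (∃ ω : Edge N → Fin c, σ = fun e => .inr (ω e)) ∨ mismatches σ ≠ 0 := by
  rcases exists_isRight_or_eq_inl σ with ⟨e₀, he₀⟩ | hinl
  · rw [← Sum.bnot_isLeft] at he₀
    refine .inr (or_iff_not_imp_right.2 fun h => ?_)
    have exists_inr (e : Edge N) : ∃ k, σ e = .inr k := by
      rw [← Sum.isRight_iff, ← Sum.bnot_isLeft,
        isLeft_eq_of_mismatches_eq_zero (not_not.1 h) e e₀, he₀]
    choose ω hω using exists_inr
    exact ⟨ω, funext hω⟩
  · exact .inl hinl

/-! ### Thresholds from rules -/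

theorem classicalRegime_of_tiling {C : ℝ} (hC : 3 / 2 ≤ C) (hN : 1 ≤ N) {J : ℝ} (hJ : 0 ≤ J)
    {ϕ : Rule (Fin c)} {ω : Edge N → Fin c} (hω : ϕ.Tiling ω)
    (huniq : ∀ ω' : Edge N → Fin c, ϕ.Tiling ω' → ω' = ω) :
    ClassicalRegime (hamiltonian N J C ϕ.couplings) := by
  refine classicalRegime_of_energy hJ ω fun σ hσ => ?_
  rw [energy_inr_of_tiling hN C hω]
  rcases sector_cases σ with ⟨τ, rfl⟩ | ⟨ω', rfl⟩ | h
  · rw [energy_inl]; norm_num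
  · refine le_trans (by norm_num) (one_half_le_energy_inr hN C fun h => hσ ?_)
    rw [huniq ω' h]
  · exact le_trans (by norm_num) (one_half_le_energy_of_mixed hC ϕ h)

theorem toricRegime_of_not_tiling {C : ℝ} (hC : 3 / 2 ≤ C) (hN : 1 ≤ N) {J : ℝ} (hJ : 0 < J)
    {ϕ : Rule (Fin c)} (h : ∀ ω : Edge N → Fin c, ¬ϕ.Tiling ω) :
    ToricRegime J (hamiltonian N J C ϕ.couplings) := by
  refine toricRegime_of_energy hJ (energy_inl C ϕ) fun σ e he => ?_
  rcases sector_cases σ with ⟨τ, rfl⟩ | ⟨ω', rfl⟩ | hmixed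
  · simp at he
  · exact one_half_le_energy_inr hN C (h ω')
  · exact one_half_le_energy_of_mixed hC ϕ hmixed

theorem Rule.evolve_eq_apply (ϕ : Rule (Fin c)) (ω : Edge N → Fin c) (i j : ℕ) (hi : i < N + 1)
    (hj : j < N + 1)
    (hwest : ∀ i' (h : i' + 1 = i),
      (ϕ.evolve i' j).map Prod.snd = some (ω (.inl (⟨i', by omega⟩, ⟨j, hj⟩))))
    (hsouth : ∀ j' (h : j' + 1 = j),
      (ϕ.evolve i j').map Prod.fst = some (ω (.inr (⟨i, hi⟩, ⟨j', by omega⟩)))) :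
    ϕ.evolve i j = ϕ (patternOf (fun e => .inr (ω e)) (⟨i, hi⟩, ⟨j, hj⟩) .west)
      (patternOf (fun e => .inr (ω e)) (⟨i, hi⟩, ⟨j, hj⟩) .south) := by
  simp only [patternOf_inr]
  rcases i with _ | i <;> rcases j with _ | j
  · simp [Rule.evolve, leg]
  · obtain ⟨q, hq, hq'⟩ := Option.map_eq_some_iff.1 (hsouth j rfl)
    simp [Rule.evolve, leg, hq, hq']
  · obtain ⟨p, hp, hp'⟩ := Option.map_eq_some_iff.1 (hwest i rfl)
    simp [Rule.evolve, leg, hp, hp']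
  · obtain ⟨p, hp, hp'⟩ := Option.map_eq_some_iff.1 (hwest i rfl)
    obtain ⟨q, hq, hq'⟩ := Option.map_eq_some_iff.1 (hsouth j rfl)
    simp [Rule.evolve, leg, hp, hp', hq, hq']

theorem Rule.Tiling.evolve_eq {ϕ : Rule (Fin c)} {ω : Edge N → Fin c} (h : ϕ.Tiling ω) (i j : ℕ)
    (hi : i < N + 1) (hj : j < N + 1) :
    (∀ hj' : j < N, (ϕ.evolve i j).map Prod.fst = some (ω (.inr (⟨i, hi⟩, ⟨j, hj'⟩)))) ∧
      ∀ hi' : i < N, (ϕ.evolve i j).map Prod.snd = some (ω (.inl (⟨i, hi'⟩, ⟨j, hj⟩))) := by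
  induction hn : i + j using Nat.strong_induction_on generalizing i j with
  | _ n ih =>
    have hevolve := ϕ.evolve_eq_apply ω i j hi hj
      (fun i' h' => (ih (i' + j) (by omega) i' j (by omega) hj rfl).2 (by omega))
      (fun j' h' => (ih (i + j') (by omega) i j' hi (by omega) rfl).1 (by omega))
    obtain ⟨hnorth, heast⟩ := h (⟨i, hi⟩, ⟨j, hj⟩)
    rw [← hevolve, patternOf_inr] at hnorth heast
    exact ⟨fun hj' => hnorth _ (by simp [leg, hj']), fun hi' => heast _ (by simp [leg, hi'])⟩

theorem Rule.Tiling.survives {ϕ : Rule (Fin c)} {ω : Edge N → Fin c} (h : ϕ.Tiling ω) :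
    ϕ.Survives N := by
  rintro i j hi hj (hi' | hj')
  · rw [← Option.isSome_map, (h.evolve_eq i j (by omega) (by omega)).2 hi', Option.isSome_some]
  · rw [← Option.isSome_map, (h.evolve_eq i j (by omega) (by omega)).1 hj', Option.isSome_some]

theorem Rule.Tiling.unique {ϕ : Rule (Fin c)} {ω ω' : Edge N → Fin c} (h : ϕ.Tiling ω)
    (h' : ϕ.Tiling ω') : ω' = ω := by
  funext e
  refine Option.some_injective _ ?_
  rcases e with ⟨i, j⟩ | ⟨i, j⟩
  · exact ((h'.evolve_eq i j (by omega) j.2).2 i.2).symm.trans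
      ((h.evolve_eq i j (by omega) j.2).2 i.2)
  · exact ((h'.evolve_eq i j i.2 (by omega)).1 j.2).symm.trans
      ((h.evolve_eq i j i.2 (by omega)).1 j.2)

theorem Rule.Survives.exists_tiling {ϕ : Rule (Fin c)} (h : ϕ.Survives N) :
    ∃ ω : Edge N → Fin c, ϕ.Tiling ω := by
  let ω : Edge N → Fin c
    | .inl (i, j) => ((ϕ.evolve i j).get (h i j (by omega) (by omega) (.inl i.2))).2
    | .inr (i, j) => ((ϕ.evolve i j).get (h i j (by omega) (by omega) (.inr j.2))).1
  have map_snd (i j : ℕ) (hi : i < N) (hj : j < N + 1) :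
      (ϕ.evolve i j).map Prod.snd = some (ω (.inl (⟨i, hi⟩, ⟨j, hj⟩))) := by
    rw [← Option.some_get (h i j (by omega) (by omega) (.inl hi)), Option.map_some]
  have map_fst (i j : ℕ) (hi : i < N + 1) (hj : j < N) :
      (ϕ.evolve i j).map Prod.fst = some (ω (.inr (⟨i, hi⟩, ⟨j, hj⟩))) := by
    rw [← Option.some_get (h i j (by omega) (by omega) (.inr hj)), Option.map_some]
  refine ⟨ω, fun v => ?_⟩
  obtain ⟨⟨i, hi⟩, ⟨j, hj⟩⟩ := v
  unfold Rule.Obeys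
  rw [← ϕ.evolve_eq_apply ω i j hi hj (fun i' h' => map_snd i' j (by omega) hj)
    (fun j' h' => map_fst i j' hi (by omega)), patternOf_inr, patternOf_inr]
  simp only [leg, Option.map_eq_some_iff, Option.dite_none_right_eq_some]
  refine ⟨?_, ?_⟩
  · rintro _ ⟨_, ⟨hj', hleg⟩, rfl⟩
    cases hleg
    exact Option.map_eq_some_iff.1 (map_fst i j hi hj')
  · rintro _ ⟨_, ⟨hi', hleg⟩, rfl⟩
    cases hleg
    exact Option.map_eq_some_iff.1 (map_snd i j hi' hj)

end RuleEnergy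

theorem isThreshold_of_survives {C : ℝ} (hC : 3 / 2 ≤ C) {c n : ℕ} (hn : 1 ≤ n) {ϕ : Rule (Fin c)}
    (h : ϕ.Survives n) (h' : ¬ϕ.Survives (n + 1)) : IsThreshold C (c + 2) n := by
  refine ⟨ϕ.couplings, ϕ.couplings_admissible, hn, fun J hJ N hN => ⟨fun hNn => ?_, fun hnN => ?_⟩⟩
  · obtain ⟨ω, hω⟩ := (h.mono hNn).exists_tiling
    exact classicalRegime_of_tiling hC hN hJ.le hω fun ω' hω' => hω.unique hω'
  · exact toricRegime_of_not_tiling hC hN hJ fun ω hω => h' (hω.survives.mono hnN)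

theorem exists_isThreshold_of_survives {C : ℝ} (hC : 3 / 2 ≤ C) {K : Type*} {c m : ℕ}
    (e : K ≃ Fin c) (hm : 1 ≤ m) {ϕ : Rule K} (h : ϕ.Survives m) {i j : ℕ}
    (hij : ϕ.evolve i j = none) : ∃ n, m ≤ n ∧ IsThreshold C (c + 2) n := by
  classical
  rw [← Rule.survives_rename e] at h
  have exists_not_survives : ∃ n, ¬(ϕ.rename e).Survives n := by
    refine ⟨i + j + 1, fun hs => ?_⟩
    have hisSome := hs i j (by omega) (by omega) (by omega)
    rw [Rule.evolve_rename, hij] at hisSome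
    exact absurd hisSome (by simp)
  have hlt : m < Nat.find exists_not_survives := by
    by_contra hle
    exact Nat.find_spec exists_not_survives (h.mono (not_lt.1 hle))
  refine ⟨Nat.find exists_not_survives - 1, by omega,
    isThreshold_of_survives hC (ϕ := ϕ.rename e) (by omega) ?_ ?_⟩
  · exact not_not.1 (Nat.find_min exists_not_survives (by omega))
  · rw [Nat.sub_add_cancel (by omega)]
    exact Nat.find_spec exists_not_survives

/-! ### Counters -/

section Digits

/-- The `k`-th digit of `n` in base `b`. -/
def digit (b k n : ℕ) : ℕ := n / b ^ k % b

theorem digit_lt {b : ℕ} (hb : 0 < b) (k n : ℕ) : digit b k n < b := Nat.mod_lt _ hb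

theorem digit_zero_right (b k : ℕ) : digit b k 0 = 0 := by
  simp [digit]

theorem digit_succ_of_not_dvd {b k n : ℕ} (h : ¬b ^ k ∣ n + 1) :
    digit b k (n + 1) = digit b k n := by
  rw [digit, Nat.succ_div, if_neg h, add_zero, digit]

theorem pow_succ_dvd_succ_iff {b k n : ℕ} (hb : 0 < b) (h : b ^ k ∣ n + 1) :
    b ^ (k + 1) ∣ n + 1 ↔ digit b k n + 1 = b := by
  have hdiv : (n + 1) / b ^ k = n / b ^ k + 1 := by rw [Nat.succ_div, if_pos h]
  rw [pow_succ, ← Nat.dvd_div_iff_mul_dvd h, hdiv, Nat.dvd_iff_mod_eq_zero,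
    Nat.add_mod_eq_add_mod_right 1 (Nat.mod_mod (n / b ^ k) b).symm]
  change (digit b k n + 1) % b = 0 ↔ _
  have hlt : digit b k n < b := digit_lt hb k n
  constructor
  · intro hmod
    by_contra hne
    rw [Nat.mod_eq_of_lt (by omega)] at hmod
    omega
  · intro heq
    rw [heq, Nat.mod_self]

theorem digit_succ_of_dvd {b k n : ℕ} (hb : 0 < b) (h : b ^ k ∣ n + 1) :
    digit b k (n + 1) = if digit b k n + 1 < b then digit b k n + 1 else 0 := by
  have hlt := digit_lt hb k n
  have hmod : digit b k (n + 1) = (digit b k n + 1) % b := by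
    rw [digit, Nat.succ_div, if_pos h, digit, Nat.mod_add_mod]
  rw [hmod]
  split_ifs with hcarry
  · exact Nat.mod_eq_of_lt hcarry
  · rw [show digit b k n + 1 = b by omega, Nat.mod_self]

end Digits

section OfNat

variable {c : ℕ} [NeZero c] {ψ : Rule ℕ}

/-- A rule given by a function on natural numbers, read modulo the number of colours. -/
def Rule.ofNat (c : ℕ) [NeZero c] (ψ : Rule ℕ) : Rule (Fin c) :=
  fun w s => (ψ (w.map Fin.val) (s.map Fin.val)).map (Prod.map (Fin.ofNat c) (Fin.ofNat c))

theorem Rule.ofNat_map_ofNat {w s : Option ℕ} (hw : ∀ x ∈ w, x < c) (hs : ∀ x ∈ s, x < c) :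
    Rule.ofNat c ψ (w.map (Fin.ofNat c)) (s.map (Fin.ofNat c)) =
      (ψ w s).map (Prod.map (Fin.ofNat c) (Fin.ofNat c)) := by
  have map_val (o : Option ℕ) (ho : ∀ x ∈ o, x < c) : (o.map (Fin.ofNat c)).map Fin.val = o := by
    cases o with
    | none => rfl
    | some x => exact congrArg some (Nat.mod_eq_of_lt (ho x rfl))
  rw [Rule.ofNat, map_val w hw, map_val s hs]

theorem Rule.evolve_ofNat_eq {P : ℕ → ℕ → Prop} {v h : ℕ → ℕ → ℕ}
    (hPi : ∀ i j, P (i + 1) j → P i j) (hPj : ∀ i j, P i (j + 1) → P i j)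
    (hv : ∀ i j, v i j < c) (hh : ∀ i j, h i j < c)
    (h00 : ψ none none = some (v 0 0, h 0 0))
    (hi0 : ∀ i, ψ (some (h i 0)) none = some (v (i + 1) 0, h (i + 1) 0))
    (h0j : ∀ j, ψ none (some (v 0 j)) = some (v 0 (j + 1), h 0 (j + 1)))
    (hij : ∀ i j, P (i + 1) (j + 1) → ψ (some (h i (j + 1))) (some (v (i + 1) j)) =
      some (v (i + 1) (j + 1), h (i + 1) (j + 1))) {i j : ℕ} (hP : P i j) :
    (Rule.ofNat c ψ).evolve i j = some (Fin.ofNat c (v i j), Fin.ofNat c (h i j)) := by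
  have apply_eq {w s : Option ℕ} {p : ℕ × ℕ} (hw : ∀ x ∈ w, x < c) (hs : ∀ x ∈ s, x < c)
      (hψ : ψ w s = some p) : Rule.ofNat c ψ (w.map (Fin.ofNat c)) (s.map (Fin.ofNat c)) =
        some (Fin.ofNat c p.1, Fin.ofNat c p.2) := by
    rw [Rule.ofNat_map_ofNat hw hs, hψ]
    rfl
  exact Rule.evolve_eq_of_solution (P := P) (v := fun i j => Fin.ofNat c (v i j))
    (h := fun i j => Fin.ofNat c (h i j)) hPi hPj (fun _ => apply_eq (by simp) (by simp) h00)
    (fun i _ => apply_eq (by simpa using hh i 0) (by simp) (hi0 i))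
    (fun j _ => apply_eq (by simp) (by simpa using hv 0 j) (h0j j))
    (fun i j hP => apply_eq (by simpa using hh i (j + 1)) (by simpa using hv (i + 1) j)
      (hij i j hP)) i j hP

theorem Rule.evolve_ofNat_eq_none {i j x d : ℕ} {p q : ℕ} (hx : x < c) (hd : d < c)
    (hwest : (Rule.ofNat c ψ).evolve i (j + 1) = some (Fin.ofNat c p, Fin.ofNat c x))
    (hsouth : (Rule.ofNat c ψ).evolve (i + 1) j = some (Fin.ofNat c d, Fin.ofNat c q))
    (h : ψ (some x) (some d) = none) : (Rule.ofNat c ψ).evolve (i + 1) (j + 1) = none := by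
  have happly := Rule.ofNat_map_ofNat (c := c) (ψ := ψ) (w := some x) (s := some d)
    (by simpa using hx) (by simpa using hd)
  rw [h, Option.map_none] at happly
  rw [Rule.evolve, hwest, hsouth, Option.bind_some, Option.bind_some]
  exact happly

end OfNat

section Counter

variable {c k off : ℕ}

/-- A counter with `k + 1` digits in base `c` that starts from `off` and gets stuck at overflow.
The vertical edges in column `i` carry the `i`-th digit, and the horizontal edges between the
columns `i` and `i + 1` carry `2 i`, or `2 i + 1` if there is a carry. All columns beyond the
digits are constant. -/
def counterRule (c k off : ℕ) : Rule ℕ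
  | none, none => some (digit c 0 off, 0)
  | some x, none => some (digit c (x / 2 + 1) off, 2 * min (x / 2 + 1) (k - 1))
  | none, some d => if d + 1 < c then some (d + 1, 0) else some (0, 1)
  | some x, some d =>
    if x % 2 = 0 then some (d, 2 * min (x / 2 + 1) (k - 1))
    else if d + 1 < c then some (d + 1, 2 * min (x / 2 + 1) (k - 1))
    else if x / 2 + 1 < k then some (0, 2 * (x / 2 + 1) + 1) else none

/-- The colours of the vertical edges of a running counter. -/
def counterDigit (c k off i j : ℕ) : ℕ :=
  if i ≤ k then digit c i (off + j) else digit c k off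

/-- The colours of the horizontal edges of a running counter. -/
def counterSignal (c k off i j : ℕ) : ℕ :=
  2 * min i (k - 1) + if i < k ∧ 0 < j ∧ c ^ (i + 1) ∣ off + j then 1 else 0

theorem counterDigit_lt (hc : 0 < c) (i j : ℕ) : counterDigit c k off i j < c := by
  unfold counterDigit
  split_ifs <;> exact digit_lt hc _ _

theorem counterSignal_lt (hk : 1 ≤ k) (hkc : 2 * k ≤ c) (i j : ℕ) :
    counterSignal c k off i j < c := by
  unfold counterSignal
  split_ifs <;> omega

theorem counterRule_corner :
    counterRule c k off none none = some (counterDigit c k off 0 0, counterSignal c k off 0 0) := by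
  simp [counterRule, counterDigit, counterSignal]

theorem counterRule_firstRow (hk : 1 ≤ k) (i : ℕ) :
    counterRule c k off (some (counterSignal c k off i 0)) none =
      some (counterDigit c k off (i + 1) 0, counterSignal c k off (i + 1) 0) := by
  simp only [counterRule, counterDigit, counterSignal, lt_irrefl, false_and, and_false, if_false,
    add_zero, Nat.mul_div_cancel_left _ two_pos]
  rcases lt_or_ge i k with hik | hki
  · rw [min_eq_left (by omega), if_pos (by omega)]
  · rw [min_eq_right (by omega), if_neg (by omega), show k - 1 + 1 = k by omega,
      min_eq_right (by omega), min_eq_right (by omega)]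

theorem counterRule_firstColumn (hc : 0 < c) (hk : 1 ≤ k) (j : ℕ) :
    counterRule c k off none (some (counterDigit c k off 0 j)) =
      some (counterDigit c k off 0 (j + 1), counterSignal c k off 0 (j + 1)) := by
  have hdvd : c ^ 0 ∣ off + j + 1 := by simp
  have hlt := digit_lt hc 0 (off + j)
  simp only [counterRule, counterDigit, counterSignal, Nat.zero_le, if_true, ← add_assoc,
    digit_succ_of_dvd hc hdvd, pow_succ_dvd_succ_iff hc hdvd]
  split_ifs <;> first | omega | simp

theorem counterRule_bulk (hc : 0 < c) (hk : 1 ≤ k) {i j : ℕ}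
    (hoverflow : c ^ (k + 1) ∣ off + (j + 1) → i + 1 ≠ k) :
    counterRule c k off (some (counterSignal c k off i (j + 1)))
        (some (counterDigit c k off (i + 1) j)) =
      some (counterDigit c k off (i + 1) (j + 1), counterSignal c k off (i + 1) (j + 1)) := by
  rw [← add_assoc] at hoverflow
  simp only [counterRule, counterDigit, counterSignal, Nat.succ_pos, true_and, ← add_assoc]
  by_cases hcarry : i < k ∧ c ^ (i + 1) ∣ off + j + 1
  · obtain ⟨hik, hdvd⟩ := hcarry
    have hlt := digit_lt hc (i + 1) (off + j)
    have hfit : digit c (i + 1) (off + j) + 1 = c → i + 1 < k := by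
      rw [← pow_succ_dvd_succ_iff hc hdvd]
      intro hdvd'
      by_contra hnot
      obtain rfl : k = i + 1 := by omega
      exact hoverflow hdvd' rfl
    simp only [hik, hdvd, and_self, if_true, pow_succ_dvd_succ_iff hc hdvd,
      digit_succ_of_dvd hc hdvd, min_eq_left (show i ≤ k - 1 by omega),
      if_pos (show i + 1 ≤ k by omega), show (2 * i + 1) / 2 = i by omega]
    rw [if_neg (by omega)]
    split_ifs <;> first | omega | (simp; try omega)
  · have hnocarry : ¬(i + 1 < k ∧ c ^ (i + 1 + 1) ∣ off + j + 1) := fun h =>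
      hcarry ⟨by omega, (pow_dvd_pow c (by omega)).trans h.2⟩
    have hdigit : i + 1 ≤ k → digit c (i + 1) (off + j + 1) = digit c (i + 1) (off + j) :=
      fun hik => digit_succ_of_not_dvd fun hdvd => hcarry ⟨hik, hdvd⟩
    rw [if_neg hcarry, if_neg hnocarry, add_zero, if_pos (by omega),
      Nat.mul_div_cancel_left _ two_pos, show min (min i (k - 1) + 1) (k - 1) =
        min (i + 1) (k - 1) by omega]
    split_ifs with hik
    · rw [hdigit hik, add_zero]
    · rw [add_zero]

theorem counterRule_evolve [NeZero c] (hk : 1 ≤ k) (hkc : 2 * k ≤ c) {n i j : ℕ}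
    (hn : off + (n + 1) = c ^ (k + 1)) (hij : j < n + 1 ∨ i < k) :
    (Rule.ofNat c (counterRule c k off)).evolve i j =
      some (Fin.ofNat c (counterDigit c k off i j), Fin.ofNat c (counterSignal c k off i j)) := by
  have hc : 0 < c := by omega
  refine Rule.evolve_ofNat_eq (P := fun i j => j < n + 1 ∨ i < k) (fun i j => by omega)
    (fun i j => by omega) (counterDigit_lt hc) (counterSignal_lt hk hkc) counterRule_corner
    (counterRule_firstRow hk) (counterRule_firstColumn hc hk) (fun i j hP => ?_) hij
  refine counterRule_bulk hc hk fun hdvd hik => ?_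
  have hle := Nat.le_of_dvd (by omega) hdvd
  omega

theorem counterRule_evolve_overflow [NeZero c] (hk : 1 ≤ k) (hkc : 2 * k ≤ c) {n : ℕ}
    (hn : off + (n + 1) = c ^ (k + 1)) :
    (Rule.ofNat c (counterRule c k off)).evolve k (n + 1) = none := by
  have hc : 0 < c := by omega
  obtain ⟨k, rfl⟩ := Nat.exists_eq_add_of_le' hk
  have hlast : c ^ (k + 1 + 1) ∣ off + n + 1 := by rw [add_assoc off, hn]
  have hcarry : c ^ (k + 1) ∣ off + n + 1 := (pow_dvd_pow c (by omega)).trans hlast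
  have hdigit : counterDigit c (k + 1) off (k + 1) n + 1 = c := by
    rw [counterDigit, if_pos le_rfl]
    exact (pow_succ_dvd_succ_iff hc hcarry).1 hlast
  have hsignal : counterSignal c (k + 1) off k (n + 1) = 2 * k + 1 := by
    rw [counterSignal, if_pos ⟨by omega, by omega, hcarry⟩, min_eq_left (by omega)]
  refine Rule.evolve_ofNat_eq_none (counterSignal_lt hk hkc k (n + 1))
    (counterDigit_lt hc (k + 1) n) (counterRule_evolve hk hkc hn (by omega))
    (counterRule_evolve hk hkc hn (by omega)) ?_
  rw [hsignal, counterRule, if_neg (by omega), if_neg (by omega), if_neg (by omega)]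

theorem isThreshold_of_lt_pow {C : ℝ} (hC : 3 / 2 ≤ C) {n : ℕ} (hk : 1 ≤ k) (hkc : 2 * k ≤ c)
    (hkn : k ≤ n) (hn : n < c ^ (k + 1)) : IsThreshold C (c + 2) n := by
  have : NeZero c := ⟨by omega⟩
  have hoff : c ^ (k + 1) - (n + 1) + (n + 1) = c ^ (k + 1) := Nat.sub_add_cancel hn
  refine isThreshold_of_survives hC (by omega)
    (fun i j _ hj _ => by rw [counterRule_evolve hk hkc hoff (by omega)]; rfl) fun hsurvives => ?_
  have hsome := hsurvives k (n + 1) (by omega) le_rfl (by omega)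
  rw [counterRule_evolve_overflow hk hkc hoff] at hsome
  simp at hsome

end Counter

section DoubleCounter

/-- A counter whose length is the period of another counter. In the first `b + 1` columns the
vertical edges carry the digits in base `b` of the row, and the horizontal edges the carry. The
next column changes from `b` to `b + 1` when the first counter overflows. To the right of it, the
horizontal edges carry binary digits `2`, `3` below that row and `4` above, and the vertical edges
the carry. The rule gets stuck if the carry reaches a `4`. -/
def doubleCounterRule (b : ℕ) : Rule ℕ
  | none, none => some (0, 0)
  | some x, none =>
    if x < b then some (0, x + 1) else if x = b then some (b, x + 1) else some (1, x)
  | none, some d => if d + 1 < b then some (d + 1, 0) else some (0, 1)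
  | some x, some d =>
    if x = 0 then if d < b then some (d, 0) else if d = b then some (b, 2) else some (b + 1, 4)
    else if x = 1 then
      if d + 1 < b then some (d + 1, 0) else if d < b then some (0, 1) else some (b + 1, 4)
    else if d = 0 then some (0, x)
    else if x = 2 then some (0, 3)
    else if x = 3 then some (1, 2) else none

variable {b R : ℕ}

/-- The colours of the vertical edges of a running double counter whose first counter overflows in
row `R`. -/
def doubleCounterVertical (b R i j : ℕ) : ℕ :=
  if i < b + 1 then digit b i j
  else if i = b + 1 then (if j < R then b else b + 1)
  else if j < R ∧ 2 ^ j ∣ i - (b + 1) then 1 else 0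

/-- The colours of the horizontal edges of a running double counter whose first counter overflows
in row `R`. -/
def doubleCounterHorizontal (b R i j : ℕ) : ℕ :=
  if j = 0 then min i (b + 1)
  else if i < b + 1 then (if b ^ (i + 1) ∣ j then 1 else 0)
  else if j < R then 2 + digit 2 (j - 1) (i - (b + 1)) else 4

theorem doubleCounterVertical_lt (hb : 0 < b) (i j : ℕ) :
    doubleCounterVertical b R i j < b + 2 := by
  have hlt := digit_lt hb i j
  unfold doubleCounterVertical
  split_ifs <;> omega

theorem doubleCounterHorizontal_lt (hb : 3 ≤ b) (i j : ℕ) :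
    doubleCounterHorizontal b R i j < b + 2 := by
  have hlt := digit_lt two_pos (j - 1) (i - (b + 1))
  unfold doubleCounterHorizontal
  split_ifs <;> omega

theorem doubleCounterRule_corner :
    doubleCounterRule b none none =
      some (doubleCounterVertical b R 0 0, doubleCounterHorizontal b R 0 0) := by
  simp [doubleCounterRule, doubleCounterVertical, doubleCounterHorizontal, digit_zero_right]

theorem doubleCounterRule_firstRow (hR : 0 < R) (i : ℕ) :
    doubleCounterRule b (some (doubleCounterHorizontal b R i 0)) none =
      some (doubleCounterVertical b R (i + 1) 0, doubleCounterHorizontal b R (i + 1) 0) := by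
  simp only [doubleCounterRule, doubleCounterVertical, doubleCounterHorizontal, if_true,
    digit_zero_right, hR, pow_zero, one_dvd, and_self]
  split_ifs <;> first | omega | (simp; try omega)

theorem doubleCounterRule_firstColumn (hb : 0 < b) (j : ℕ) :
    doubleCounterRule b none (some (doubleCounterVertical b R 0 j)) =
      some (doubleCounterVertical b R 0 (j + 1), doubleCounterHorizontal b R 0 (j + 1)) := by
  have hdvd : b ^ 0 ∣ j + 1 := by simp
  have hlt := digit_lt hb 0 j
  simp only [doubleCounterRule, doubleCounterVertical, doubleCounterHorizontal, Nat.succ_pos,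
    if_true, Nat.succ_ne_zero, if_false, digit_succ_of_dvd hb hdvd, pow_succ_dvd_succ_iff hb hdvd]
  split_ifs <;> first | omega | simp

theorem doubleCounterRule_digits (hb : 0 < b) {i j : ℕ} (hib : i < b) :
    doubleCounterRule b (some (doubleCounterHorizontal b R i (j + 1)))
        (some (doubleCounterVertical b R (i + 1) j)) =
      some (doubleCounterVertical b R (i + 1) (j + 1),
        doubleCounterHorizontal b R (i + 1) (j + 1)) := by
  have hlt := digit_lt hb (i + 1) j
  simp only [doubleCounterRule, doubleCounterVertical, doubleCounterHorizontal, Nat.succ_ne_zero,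
    if_false, if_pos (show i < b + 1 by omega), if_pos (show i + 1 < b + 1 by omega)]
  by_cases hcarry : b ^ (i + 1) ∣ j + 1
  · simp only [hcarry, if_true, digit_succ_of_dvd hb hcarry, pow_succ_dvd_succ_iff hb hcarry,
      one_ne_zero, if_false]
    split_ifs <;> first | omega | simp
  · have hnocarry : ¬b ^ (i + 1 + 1) ∣ j + 1 := fun h =>
      hcarry ((pow_dvd_pow b (by omega)).trans h)
    rw [if_neg hcarry, if_neg hnocarry, digit_succ_of_not_dvd hcarry, if_pos rfl, if_pos hlt]

theorem doubleCounterRule_switch (hR : R = b ^ (b + 1)) (j : ℕ) :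
    doubleCounterRule b (some (doubleCounterHorizontal b R b (j + 1)))
        (some (doubleCounterVertical b R (b + 1) j)) =
      some (doubleCounterVertical b R (b + 1) (j + 1),
        doubleCounterHorizontal b R (b + 1) (j + 1)) := by
  have hbefore : j + 1 < R → ¬R ∣ j + 1 := fun hj hdvd => by
    have hle := Nat.le_of_dvd (by omega) hdvd
    omega
  have hoverflow : j + 1 = R → R ∣ j + 1 := fun hj => hj ▸ dvd_rfl
  simp only [doubleCounterRule, doubleCounterVertical, doubleCounterHorizontal, Nat.succ_ne_zero,
    if_false, lt_irrefl, if_true, Nat.lt_succ_self, Nat.sub_self, digit_zero_right, ← hR]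
  by_cases hdvd : R ∣ j + 1
  · simp only [hdvd, if_true]
    split_ifs <;> first | omega | (simp; try omega)
  · simp only [hdvd, if_false]
    split_ifs <;> first | omega | (simp; try omega)

theorem doubleCounterRule_binary {i j : ℕ} (hbi : b < i)
    (hoverflow : j + 1 = R → ¬2 ^ j ∣ i - b) :
    doubleCounterRule b (some (doubleCounterHorizontal b R i (j + 1)))
        (some (doubleCounterVertical b R (i + 1) j)) =
      some (doubleCounterVertical b R (i + 1) (j + 1),
        doubleCounterHorizontal b R (i + 1) (j + 1)) := by
  obtain ⟨t, rfl⟩ := Nat.exists_eq_add_of_le (Nat.succ_le_of_lt hbi)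
  have hlt := digit_lt two_pos j t
  rw [show b.succ + t - b = t + 1 by omega] at hoverflow
  simp only [doubleCounterRule, doubleCounterVertical, doubleCounterHorizontal, Nat.succ_eq_add_one,
    Nat.succ_ne_zero, if_false, show ¬b + 1 + t < b + 1 by omega,
    show ¬b + 1 + t + 1 < b + 1 by omega, show b + 1 + t + 1 ≠ b + 1 by omega,
    Nat.add_sub_cancel_left, show b + 1 + t + 1 - (b + 1) = t + 1 by omega, Nat.add_sub_cancel]
  rcases lt_trichotomy (j + 1) R with hj | hj | hj
  · by_cases hcarry : 2 ^ j ∣ t + 1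
    · simp only [hj, show j < R by omega, hcarry, and_self, if_true, true_and,
        digit_succ_of_dvd two_pos hcarry, pow_succ_dvd_succ_iff two_pos hcarry]
      split_ifs <;> first | omega | (simp; try omega)
    · have hnocarry : ¬2 ^ (j + 1) ∣ t + 1 := fun h =>
        hcarry ((pow_dvd_pow 2 (by omega)).trans h)
      simp [hj, hcarry, hnocarry, digit_succ_of_not_dvd hcarry, show 2 + digit 2 j t ≠ 1 by omega]
  · simp [hj, hoverflow hj]
  · simp [show ¬j < R by omega, show ¬j + 1 < R by omega]

theorem doubleCounterRule_evolve (hb : 3 ≤ b) (hR : R = b ^ (b + 1)) {i j : ℕ}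
    (hij : i < b + 1 + 2 ^ (R - 1) ∨ j < R) :
    (Rule.ofNat (b + 2) (doubleCounterRule b)).evolve i j =
      some (Fin.ofNat (b + 2) (doubleCounterVertical b R i j),
        Fin.ofNat (b + 2) (doubleCounterHorizontal b R i j)) := by
  have hb0 : 0 < b := by omega
  have hR0 : 0 < R := hR ▸ pow_pos hb0 _
  refine Rule.evolve_ofNat_eq (P := fun i j => i < b + 1 + 2 ^ (R - 1) ∨ j < R)
    (fun i j => by omega) (fun i j => by omega) (doubleCounterVertical_lt hb0)
    (doubleCounterHorizontal_lt hb) doubleCounterRule_corner (doubleCounterRule_firstRow hR0)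
    (doubleCounterRule_firstColumn hb0) (fun i j hP => ?_) hij
  rcases lt_trichotomy i b with hib | rfl | hbi
  · exact doubleCounterRule_digits hb0 hib
  · exact doubleCounterRule_switch hR j
  · refine doubleCounterRule_binary hbi fun hj hdvd => ?_
    have hle := Nat.le_of_dvd (by omega) hdvd
    rw [← hj, Nat.add_sub_cancel] at hP
    omega

theorem doubleCounterRule_evolve_overflow (hb : 3 ≤ b) (hR : R = b ^ (b + 1)) :
    (Rule.ofNat (b + 2) (doubleCounterRule b)).evolve (b + 1 + 2 ^ (R - 1)) R = none := by
  obtain ⟨r, hr⟩ : ∃ r, R = r + 1 :=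
    Nat.exists_eq_add_of_le' (hR ▸ Nat.one_le_pow _ _ (by omega))
  obtain ⟨T, hT⟩ : ∃ T, 2 ^ r = T + 1 := Nat.exists_eq_add_of_le' Nat.one_le_two_pow
  have hsolution {i j : ℕ} (hij : i ≤ b + 1 + T ∨ j ≤ r) :=
    doubleCounterRule_evolve (i := i) (j := j) hb hR (by rw [hr, Nat.add_sub_cancel, hT]; omega)
  have hcarry : doubleCounterVertical b R (b + 1 + T + 1) r = 1 := by
    rw [doubleCounterVertical, if_neg (by omega), if_neg (by omega),
      if_pos ⟨by omega, by rw [show b + 1 + T + 1 - (b + 1) = 2 ^ r by omega]⟩]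
  have hend : doubleCounterHorizontal b R (b + 1 + T) (r + 1) = 4 := by
    rw [doubleCounterHorizontal, if_neg (by omega), if_neg (by omega), if_neg (by omega)]
  have hstuck := Rule.evolve_ofNat_eq_none (doubleCounterHorizontal_lt hb _ _)
    (doubleCounterVertical_lt (by omega) _ _) (hsolution (i := b + 1 + T) (j := r + 1) (by omega))
    (hsolution (i := b + 1 + T + 1) (j := r) (by omega)) (by rw [hend, hcarry]; rfl)
  rwa [add_assoc, ← hT, ← hr, show r = R - 1 by omega] at hstuck

theorem exists_isThreshold_two_pow {C : ℝ} (hC : 3 / 2 ≤ C) (hb : 3 ≤ b) :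
    ∃ n, 2 ^ (b ^ (b + 1) - 1) ≤ n ∧ IsThreshold C (b + 2 + 2) n :=
  exists_isThreshold_of_survives hC (Equiv.refl _) Nat.one_le_two_pow
    (fun i j hi _ _ => by rw [doubleCounterRule_evolve hb rfl (by omega)]; rfl)
    (doubleCounterRule_evolve_overflow hb rfl)

theorem mul_ten_pow_le_two_pow {m e : ℕ} (h : 4 * (2 + m) ≤ e) : 52 * 10 ^ m ≤ 2 ^ e :=
  calc 52 * 10 ^ m ≤ (2 ^ 4) ^ 2 * (2 ^ 4) ^ m :=
        Nat.mul_le_mul (by norm_num) (Nat.pow_le_pow_left (by norm_num) _)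
    _ = 2 ^ (4 * (2 + m)) := by rw [← pow_add, ← pow_mul]
    _ ≤ 2 ^ e := Nat.pow_le_pow_right two_pos h

end DoubleCounter

/-! ### Turing machines -/

section Transition

variable {q : ℕ} (M : Machine q) (z : Fin q) (r : Bool)

/-- Colours of the space-time diagram of a machine: tape symbols and states. The state `z` also
serves as a spacer between the symbols. -/
abbrev Colour (q : ℕ) : Type := Bool ⊕ Fin q

/-- The colour of the head in state `s`. As the spacer `z` cannot mark the head, a head in state `z`
is shown as a second symbol in its cell. -/
def headColour (s : Fin q) : Colour q := if s = z then .inl false else .inr s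

/-- The symbol and the state that a transition emits, to the north and to the east. -/
def transition (s : Fin q) (a : Bool) : Option (Colour q × Colour q) :=
  match M s a with
  | (_, _, none) => none
  | (b, .right, some s') => some (.inl b, .inr s')
  | (b, .left, some s') => some (.inr s', .inl b)

/-- The rule that draws the space-time diagram of a machine along the diagonals. The Boolean `r`
says that the state `z` is entered by moves to the right only (otherwise: to the left only). -/
def machineRule (s₀ : Fin q) : Rule (Colour q)
  | none, none => some (headColour z s₀, .inl false)
  | none, some x => if x = .inr z then some (.inl false, .inr z) else some (.inr z, x)
  | some x, none => if x = .inr z then some (.inr z, .inl false) else some (x, .inr z)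
  | some (.inl a), some (.inl b) => transition M z (a || b)
  | some (.inl a), some (.inr s) => if s = z then some (.inl a, .inr z) else transition M s a
  | some (.inr s), some (.inl a) => if s = z then some (.inr z, .inl a) else transition M s a
  | some (.inr s), some (.inr s') =>
    if s = z ∧ s' = z then
      if r then some (.inr z, .inl false) else some (.inl false, .inr z)
    else some (.inr s', .inr s)

/-- All transitions into the state `z` move to the right if `r` is true, and to the left if not. -/
def Machine.EntersFrom : Prop :=
  ∀ s a b mv, M s a = (b, mv, some z) → (mv = .right ↔ r = true)

/-- The west input of cell `m` at an even time, for a machine in state `s` at position `p` of the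
tape `a`; `d` says whether the head has come from the west. -/
def westInput (d : Bool) (s : Fin q) (a : ℤ → Bool) (p m : ℤ) : Colour q :=
  if m < p then .inl (a m) else if p < m then .inr z else if d then headColour z s else .inl (a m)

/-- The south input of cell `m` at an even time, as for `westInput`. -/
def southInput (d : Bool) (s : Fin q) (a : ℤ → Bool) (p m : ℤ) : Colour q :=
  if m < p then .inr z else if p < m then .inl (a m) else if d then .inl (a m) else headColour z s

/-- The outputs of cell `m` at an even time, to the north and to the east. -/
def cellOutput (s : Fin q) (a : ℤ → Bool) (p m : ℤ) : Option (Colour q × Colour q) :=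
  if m < p then some (.inl (a m), .inr z) else if p < m then some (.inr z, .inl (a m))
  else transition M s (a m)

variable {M z r} {s₀ s s' : Fin q} {a : ℤ → Bool} {p m : ℤ} {d b : Bool}

theorem transition_eq_none_iff {x : Bool} : transition M s x = none ↔ (M s x).2.2 = none := by
  unfold transition
  split <;> simp_all

theorem cellOutput_of_lt (h : m < p) : cellOutput M z s a p m = some (.inl (a m), .inr z) :=
  if_pos h

theorem cellOutput_of_gt (h : p < m) : cellOutput M z s a p m = some (.inr z, .inl (a m)) := by
  rw [cellOutput, if_neg h.not_gt, if_pos h]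

theorem cellOutput_self : cellOutput M z s a p p = transition M s (a p) := by
  rw [cellOutput, if_neg (lt_irrefl p), if_neg (lt_irrefl p)]

theorem cellOutput_isSome (h : (M s (a p)).2.2 ≠ none) : (cellOutput M z s a p m).isSome := by
  rcases lt_trichotomy m p with hmp | rfl | hpm
  · rw [cellOutput_of_lt hmp]
    rfl
  · rwa [cellOutput_self, Option.isSome_iff_ne_none, ne_eq, transition_eq_none_iff]
  · rw [cellOutput_of_gt hpm]
    rfl

theorem machineRule_none_blank (x : Bool) :
    machineRule M z r s₀ none (some (.inl x)) =
      machineRule M z r s₀ (some (.inr z)) (some (.inl x)) := by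
  simp [machineRule]

theorem machineRule_blank_none (x : Bool) :
    machineRule M z r s₀ (some (.inl x)) none =
      machineRule M z r s₀ (some (.inl x)) (some (.inr z)) := by
  simp [machineRule]

theorem machineRule_none_spacer :
    machineRule M z r s₀ none (some (.inr z)) =
      machineRule M z r s₀ (some (.inl false)) (some (.inr z)) := by
  simp [machineRule]

theorem machineRule_spacer_none :
    machineRule M z r s₀ (some (.inr z)) none =
      machineRule M z r s₀ (some (.inr z)) (some (.inl false)) := by
  simp [machineRule]

theorem machineRule_input :
    machineRule M z r s₀ (some (westInput z d s a p m)) (some (southInput z d s a p m)) =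
      cellOutput M z s a p m := by
  unfold westInput southInput cellOutput headColour
  rcases lt_trichotomy m p with h | rfl | h
  · simp [h, machineRule]
  · by_cases hs : s = z <;> cases d <;> simp [hs, machineRule]
  · simp [h, not_lt.2 h.le, machineRule]

/-- The outputs of the vertex between the cells `m` and `m + 1` at an odd time, from those of the
two cells. -/
def exchange (z : Fin q) (r : Bool) (M : Machine q) (s₀ s : Fin q) (a : ℤ → Bool) (p m : ℤ) :
    Option (Colour q × Colour q) :=
  (cellOutput M z s a p m).bind fun u =>
    (cellOutput M z s a p (m + 1)).bind fun w => machineRule M z r s₀ (some u.2) (some w.1)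

theorem exchange_right (hr : M.EntersFrom z r) (hM : M s (a p) = (b, .right, some s')) :
    exchange z r M s₀ s a p m = some (southInput z true s' (Function.update a p b) (p + 1) m,
      westInput z true s' (Function.update a p b) (p + 1) (m + 1)) := by
  have hz : s' = z → r = true := fun h => (hr s (a p) b .right (h ▸ hM)).1 rfl
  have hout : cellOutput M z s a p p = some (.inl b, .inr s') := by
    rw [cellOutput_self, transition, hM]
  unfold exchange southInput westInput headColour
  obtain h | rfl | rfl | h : m + 1 < p ∨ p = m + 1 ∨ p = m ∨ p < m := by omega
  · rw [cellOutput_of_lt (by omega), cellOutput_of_lt h, if_pos (by omega), if_pos (by omega),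
      Function.update_of_ne (by omega)]
    simp [machineRule]
  · rw [cellOutput_of_lt (by omega), hout, if_pos (by omega), if_pos (by omega),
      Function.update_self]
    simp [machineRule]
  · rw [hout, cellOutput_of_gt (by omega), if_pos (by omega), if_neg (by omega),
      if_neg (by omega), if_pos rfl]
    by_cases hs : s' = z
    · simp [machineRule, hs, hz hs]
    · simp [machineRule, hs]
  · rw [cellOutput_of_gt h, cellOutput_of_gt (by omega), if_neg (by omega),
      if_neg (show ¬m + 1 < p + 1 by omega), if_pos (show p + 1 < m + 1 by omega),
      Function.update_of_ne (by omega)]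
    simp [machineRule]

theorem exchange_left (hr : M.EntersFrom z r) (hM : M s (a p) = (b, .left, some s')) :
    exchange z r M s₀ s a p m = some (southInput z false s' (Function.update a p b) (p - 1) m,
      westInput z false s' (Function.update a p b) (p - 1) (m + 1)) := by
  have hz : s' = z → r = false := fun h => by
    simpa using hr s (a p) b .left (h ▸ hM)
  have hout : cellOutput M z s a p p = some (.inr s', .inl b) := by
    rw [cellOutput_self, transition, hM]
  unfold exchange southInput westInput headColour
  obtain h | rfl | rfl | h : m + 1 < p ∨ p = m + 1 ∨ p = m ∨ p < m := by omega
  · rw [cellOutput_of_lt (by omega), cellOutput_of_lt h, if_pos (by omega),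
      Function.update_of_ne (by omega)]
    by_cases hnear : m + 1 < p - 1
    · simp [machineRule, hnear]
    · simp [machineRule, hnear, show ¬p - 1 < m + 1 by omega]
  · rw [cellOutput_of_lt (by omega), hout]
    by_cases hs : s' = z
    · simp [machineRule, hs, hz hs]
    · simp [machineRule, hs]
  · rw [hout, cellOutput_of_gt (by omega), if_neg (by omega), if_pos (by omega),
      if_neg (by omega), if_pos (by omega), Function.update_self]
    simp [machineRule]
  · rw [cellOutput_of_gt h, cellOutput_of_gt (by omega), if_neg (by omega), if_pos (by omega),
      if_neg (by omega), if_pos (by omega), Function.update_of_ne (by omega)]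
    simp [machineRule]

-- One of the `2 q` transitions halts, so that one of the `2 q` pairs of a state and a direction is
-- not produced by any of them.
theorem exists_entersFrom (h : (M s b).2.2 = none) : ∃ z r, M.EntersFrom z r := by
  by_contra! hcon
  simp only [Machine.EntersFrom, not_forall] at hcon
  choose source symbol written mv hM hmv using hcon
  have hinj : Function.Injective fun x : Fin q × Bool => (source x.1 x.2, symbol x.1 x.2) := by
    rintro ⟨z, r⟩ ⟨z', r'⟩ heq
    simp only [Prod.mk.injEq] at heq
    have hsame := hM z r
    rw [heq.1, heq.2, hM z' r'] at hsame
    simp only [Prod.mk.injEq, Option.some.injEq] at hsame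
    obtain ⟨-, hmove, rfl⟩ := hsame
    have hne := hmv z' r
    have hne' := hmv z' r'
    rw [hmove] at hne'
    cases r <;> cases r' <;> first | rfl | (simp only [Bool.false_eq_true] at hne hne'; tauto)
  obtain ⟨⟨z, r⟩, hzr⟩ := Finite.surjective_of_injective hinj (s, b)
  simp only [Prod.mk.injEq] at hzr
  have hnonhalting := hM z r
  rw [hzr.1, hzr.2] at hnonhalting
  simp [hnonhalting] at h

end Transition

section Run

variable {q : ℕ} {M : Machine q}

/-- The configuration after `k` steps on the blank tape. -/
def Machine.run (M : Machine q) (k : ℕ) : Config q := M.step^[k] (Config.init q)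

theorem Machine.run_succ (k : ℕ) : M.run (k + 1) = M.step (M.run k) :=
  Function.iterate_succ_apply' _ _ _

theorem Machine.run_state_succ {k : ℕ} {s : Fin q} (hs : (M.run k).state = some s) :
    (M.run (k + 1)).state = (M s ((M.run k).tape (M.run k).head)).2.2 := by
  rw [Machine.run_succ, Machine.step, hs]

theorem Machine.abs_run_head_le (k : ℕ) : |(M.run k).head| ≤ k := by
  induction k with
  | zero => simp [Machine.run, Config.init]
  | succ k ih =>
    rw [Machine.run_succ, Machine.step, abs_le] at *
    push_cast
    split
    · omega
    · dsimp only
      split <;> omega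

theorem Machine.run_tape_eq_false (k : ℕ) {m : ℤ} (hm : k ≤ |m|) : (M.run k).tape m = false := by
  induction k with
  | zero => rfl
  | succ k ih =>
    have hhead := M.abs_run_head_le k
    push_cast at hm
    rw [Machine.run_succ, Machine.step]
    split
    · exact ih (by omega)
    · dsimp only
      rw [Function.update_of_ne (by rintro rfl; omega), ih (by omega)]

/-- The rule `machineRule M z r s₀` has reached step `k` of the machine: on the odd diagonal
`i + j = 2 k + 1` it emits the inputs of the cells, for a head in state `s`. -/
def Draws (M : Machine q) (z : Fin q) (r : Bool) (s₀ : Fin q) (k : ℕ) (s : Fin q) (d : Bool) :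
    Prop :=
  ∀ (i j : ℕ) (m : ℤ), i + j = 2 * k + 1 → (i : ℤ) - j = 2 * m + 1 →
    (machineRule M z r s₀).evolve i j =
      some (southInput z d s (M.run k).tape (M.run k).head m,
        westInput z d s (M.run k).tape (M.run k).head (m + 1))

variable {z : Fin q} {r : Bool} {s₀ s s' : Fin q} {k : ℕ} {d : Bool}

theorem draws_zero : Draws M z r s₀ 0 s₀ true := by
  intro i j m hij hm
  have hz : headColour z s₀ ≠ .inr z := by
    unfold headColour
    split_ifs with h <;> simp [h]
  obtain ⟨rfl, rfl⟩ | ⟨rfl, rfl⟩ : (i = 0 ∧ j = 1) ∨ (i = 1 ∧ j = 0) := by omega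
  · obtain rfl : m = -1 := by omega
    rw [Rule.evolve, Rule.evolve]
    simp [machineRule, hz, southInput, westInput, Machine.run, Config.init]
  · obtain rfl : m = 0 := by omega
    rw [Rule.evolve, Rule.evolve]
    simp [machineRule, southInput, westInput, Machine.run, Config.init]

theorem Draws.evolve_even (hk : Draws M z r s₀ k s d) {i j : ℕ} {m : ℤ} (hij : i + j = 2 * k + 2)
    (hm : (i : ℤ) - j = 2 * m) :
    (machineRule M z r s₀).evolve i j = cellOutput M z s (M.run k).tape (M.run k).head m := by
  have hhead := abs_le.1 (M.abs_run_head_le k)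
  rw [← machineRule_input (r := r) (s₀ := s₀) (d := d)]
  rcases i with _ | i <;> rcases j with _ | j
  · omega
  · obtain rfl : m = -(k + 1) := by omega
    have hwest : westInput z d s (M.run k).tape (M.run k).head (-(k + 1)) = .inl false := by
      rw [westInput, if_pos (by omega), Machine.run_tape_eq_false k (by rw [le_abs]; omega)]
    have hsouth : southInput z d s (M.run k).tape (M.run k).head (-(k + 1)) = .inr z :=
      if_pos (by omega)
    rw [Rule.evolve, hk 0 j (-(k + 1)) (by omega) (by omega), Option.bind_some, hwest, hsouth,
      machineRule_none_spacer]
  · obtain rfl : m = k + 1 := by omega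
    have hwest : westInput z d s (M.run k).tape (M.run k).head (k + 1) = .inr z := by
      rw [westInput, if_neg (by omega), if_pos (by omega)]
    have hsouth : southInput z d s (M.run k).tape (M.run k).head (k + 1) = .inl false := by
      rw [southInput, if_neg (by omega), if_pos (by omega),
        Machine.run_tape_eq_false k (by rw [le_abs]; omega)]
    rw [Rule.evolve, hk i 0 k (by omega) (by omega), Option.bind_some, hwest, hsouth,
      machineRule_spacer_none]
  · rw [Rule.evolve, hk i (j + 1) (m - 1) (by omega) (by omega),
      hk (i + 1) j m (by omega) (by omega), Option.bind_some, Option.bind_some, sub_add_cancel]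

theorem Draws.evolve_odd (hk : Draws M z r s₀ k s d) {i j : ℕ} {m : ℤ} (hij : i + j = 2 * k + 3)
    (hm : (i : ℤ) - j = 2 * m + 1) :
    (machineRule M z r s₀).evolve i j =
      exchange z r M s₀ s (M.run k).tape (M.run k).head m := by
  have hhead := abs_le.1 (M.abs_run_head_le k)
  rw [exchange]
  rcases i with _ | i <;> rcases j with _ | j
  · omega
  · rw [Rule.evolve, hk.evolve_even (m := m + 1) (by omega) (by omega),
      cellOutput_of_lt (m := m) (by omega), cellOutput_of_lt (by omega), Option.bind_some,
      Option.bind_some, Option.bind_some, machineRule_none_blank]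
  · rw [Rule.evolve, hk.evolve_even (m := m) (by omega) (by omega),
      cellOutput_of_gt (m := m) (by omega), cellOutput_of_gt (by omega), Option.bind_some,
      Option.bind_some, Option.bind_some, machineRule_blank_none]
  · rw [Rule.evolve, hk.evolve_even (m := m) (by omega) (by omega),
      hk.evolve_even (m := m + 1) (by omega) (by omega)]

theorem Draws.succ (hr : M.EntersFrom z r) (hk : Draws M z r s₀ k s d)
    (hs : (M.run k).state = some s) (hs' : (M.run (k + 1)).state = some s') :
    ∃ d', Draws M z r s₀ (k + 1) s' d' := by
  rw [Machine.run_state_succ hs] at hs'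
  rcases hM : M s ((M.run k).tape (M.run k).head) with ⟨b, mv, t⟩
  obtain rfl : t = some s' := by rw [← hs', hM]
  cases mv with
  | left =>
    refine ⟨false, fun i j m hij hm => ?_⟩
    rw [hk.evolve_odd (by omega) hm, exchange_left hr hM]
    simp [Machine.run_succ, Machine.step, hs, hM]
  | right =>
    refine ⟨true, fun i j m hij hm => ?_⟩
    rw [hk.evolve_odd (by omega) hm, exchange_right hr hM]
    simp [Machine.run_succ, Machine.step, hs, hM]

theorem exists_draws (hr : M.EntersFrom z r) (hs₀ : (Config.init q).state = some s₀)
    (hs : (M.run k).state = some s) : ∃ d, Draws M z r s₀ k s d := by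
  induction k generalizing s with
  | zero =>
    obtain rfl : s₀ = s := Option.some.inj (hs₀.symm.trans hs)
    exact ⟨true, draws_zero⟩
  | succ k ih =>
    rcases hprev : (M.run k).state with _ | s
    · simp [Machine.run_succ, Machine.step, hprev] at hs
    · obtain ⟨d, hk⟩ := ih hprev
      exact hk.succ hr hprev hs

theorem machineRule_survives (hr : M.EntersFrom z r) (hs₀ : (Config.init q).state = some s₀)
    (hrun : ∀ l ≤ k, (M.run l).state ≠ none) : (machineRule M z r s₀).Survives (k + 1) := by
  intro i j hi hj hij
  obtain h | ⟨l, h⟩ | ⟨l, h⟩ : i + j = 0 ∨ (∃ l, i + j = 2 * l + 2) ∨ ∃ l, i + j = 2 * l + 1 := by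
    rcases Nat.even_or_odd' (i + j) with ⟨l, h | h⟩
    · rcases l with _ | l
      · exact Or.inl h
      · exact Or.inr (Or.inl ⟨l, h⟩)
    · exact Or.inr (Or.inr ⟨l, h⟩)
  · obtain ⟨rfl, rfl⟩ : i = 0 ∧ j = 0 := by omega
    rw [Rule.evolve]
    rfl
  · obtain ⟨s, hs⟩ := Option.ne_none_iff_exists'.1 (hrun l (by omega))
    obtain ⟨d, hl⟩ := exists_draws hr hs₀ hs
    rw [hl.evolve_even (m := i - (l + 1)) h (by omega)]
    refine cellOutput_isSome ?_
    rw [← Machine.run_state_succ hs]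
    exact hrun (l + 1) (by omega)
  · obtain ⟨s, hs⟩ := Option.ne_none_iff_exists'.1 (hrun l (by omega))
    obtain ⟨d, hl⟩ := exists_draws hr hs₀ hs
    rw [hl i j (i - (l + 1)) h (by omega)]
    rfl

theorem exists_evolve_machineRule_eq_none (hr : M.EntersFrom z r)
    (hs₀ : (Config.init q).state = some s₀) (hs : (M.run k).state = some s)
    (hhalt : (M.run (k + 1)).state = none) : ∃ i j, (machineRule M z r s₀).evolve i j = none := by
  have hhead := abs_le.1 (M.abs_run_head_le k)
  obtain ⟨d, hk⟩ := exists_draws hr hs₀ hs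
  refine ⟨(k + 1 + (M.run k).head).toNat, (k + 1 - (M.run k).head).toNat, ?_⟩
  rw [hk.evolve_even (m := (M.run k).head) (by omega) (by omega), cellOutput_self,
    transition_eq_none_iff, ← Machine.run_state_succ hs, hhalt]

theorem Machine.HaltsAfter.exists_isThreshold {C : ℝ} (hC : 3 / 2 ≤ C) {t : ℕ}
    (h : M.HaltsAfter t) (ht : 1 ≤ t) : ∃ n, t ≤ n ∧ IsThreshold C (q + 4) n := by
  obtain ⟨k, rfl⟩ := Nat.exists_eq_add_of_le' ht
  have hhalt : (M.run (k + 1)).state = none := h.1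
  have hrun (l : ℕ) (hl : l ≤ k) : (M.run l).state ≠ none := h.2 l (by omega)
  obtain ⟨s₀, hs₀⟩ := Option.ne_none_iff_exists'.1 (hrun 0 (by omega))
  obtain ⟨s, hs⟩ := Option.ne_none_iff_exists'.1 (hrun k le_rfl)
  obtain ⟨z, r, hr⟩ := exists_entersFrom ((Machine.run_state_succ hs).symm.trans hhalt)
  obtain ⟨i, j, hstuck⟩ := exists_evolve_machineRule_eq_none hr hs₀ hs hhalt
  have e : Colour q ≃ Fin (q + 2) := Fintype.equivFinOfCardEq (by simp [Colour]; omega)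
  exact exists_isThreshold_of_survives hC e ht (machineRule_survives hr hs₀ hrun) hstuck

end Run

section BusyBeaver

variable {q : ℕ} {M : Machine q}

theorem Machine.HaltsAfter.unique {t t' : ℕ} (h : M.HaltsAfter t) (h' : M.HaltsAfter t') :
    t = t' := by
  rcases lt_trichotomy t t' with hlt | heq | hlt
  · exact absurd h.1 (h'.2 t hlt)
  · exact heq
  · exact absurd h'.1 (h.2 t' hlt)

instance : Finite Move :=
  Finite.of_surjective (fun b : Bool => if b then Move.left else Move.right) fun
    | .left => ⟨true, rfl⟩
    | .right => ⟨false, rfl⟩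

theorem finite_setOf_haltsAfter (q : ℕ) : {t | ∃ M : Machine q, M.HaltsAfter t}.Finite := by
  have : Finite (Machine q) := inferInstance
  rw [Set.ofPred_exists]
  refine Set.finite_iUnion fun M => Set.Subsingleton.finite ?_
  exact fun t ht t' ht' => Machine.HaltsAfter.unique ht ht'

theorem Machine.HaltsAfter.le_busyBeaver {t : ℕ} (h : M.HaltsAfter t) : t ≤ busyBeaver q :=
  le_csSup (finite_setOf_haltsAfter q).bddAbove ⟨M, h⟩

theorem exists_haltsAfter_busyBeaver (h : 1 ≤ busyBeaver q) :
    ∃ M : Machine q, M.HaltsAfter (busyBeaver q) := by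
  refine Nat.sSup_mem ?_ (finite_setOf_haltsAfter q).bddAbove
  by_contra hne
  rw [Set.not_nonempty_iff_eq_empty] at hne
  simp [busyBeaver, hne] at h

theorem busyBeaver_le_of_isGreatest {C : ℝ} (hC : 3 / 2 ≤ C) {N : ℕ}
    (hN : IsGreatest {n | IsThreshold C (q + 4) n} N) : busyBeaver q ≤ N := by
  rcases Nat.eq_zero_or_pos (busyBeaver q) with h | h
  · omega
  · obtain ⟨M, hM⟩ := exists_haltsAfter_busyBeaver h
    obtain ⟨n, hle, hn⟩ := hM.exists_isThreshold hC h
    exact hle.trans (hN.2 hn)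

end BusyBeaver

/-! ### Post machines -/

section PostMachines

theorem Machine.exists_haltsAfter {q : ℕ} {M : Machine q} {t : ℕ} (h : (M.run t).state = none) :
    ∃ T, M.HaltsAfter T ∧ M.run T = M.run t := by
  classical
  have hex : ∃ t, (M.run t).state = none := ⟨t, h⟩
  refine ⟨Nat.find hex, ⟨Nat.find_spec hex, fun t' ht' => Nat.find_min hex ht'⟩, ?_⟩
  obtain ⟨k, rfl⟩ := Nat.exists_eq_add_of_le (Nat.find_min' hex h)
  rw [Machine.run, Machine.run, Nat.add_comm, Function.iterate_add_apply]
  refine (Function.iterate_fixed ?_ k).symm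
  rw [← Machine.run, Machine.step, Nat.find_spec hex]

theorem Machine.abs_sub_head_lt_of_halted {q : ℕ} {M : Machine q} {t : ℕ} {m : ℤ}
    (h : (M.run t).state = none) (hm : (M.run t).tape m = true) :
    |m - (M.run t).head| < 2 * busyBeaver q := by
  obtain ⟨T, hT, hrun⟩ := Machine.exists_haltsAfter h
  rw [← hrun] at hm ⊢
  have hmark : |m| < T := by
    by_contra! hle
    simp [Machine.run_tape_eq_false T hle] at hm
  have hhead := M.abs_run_head_le T
  have hbound := hT.le_busyBeaver
  rw [abs_le] at hhead
  rw [abs_lt] at hmark ⊢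
  omega

theorem exists_coding {α : Type*} {q : ℕ} (A : Finset α) {x : α} (hx : x ∈ A) (hA : A.card ≤ q)
    (h0 : 0 < q) : ∃ (e : α → Fin q) (d : Fin q → α), (∀ y ∈ A, d (e y) = y) ∧ e x = ⟨0, h0⟩ := by
  classical
  obtain ⟨g⟩ : Nonempty (A ↪ Fin q) := Function.Embedding.nonempty_of_card_le (by simpa using hA)
  let g' := g.setValue ⟨x, hx⟩ ⟨0, h0⟩
  let e := Function.extend Subtype.val g' fun _ => ⟨0, h0⟩
  have he (y : A) : e y = g' y := Subtype.val_injective.extend_apply _ _ y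
  refine ⟨e, Function.extend g' Subtype.val fun _ => x, fun y hy => ?_, ?_⟩
  · rw [he ⟨y, hy⟩, g'.injective.extend_apply]
  · rw [he ⟨x, hx⟩, Function.Embedding.setValue_eq]

variable {Λ : Type*} [Inhabited Λ] {q : ℕ}

/-- The transitions of a machine that writes `W 0, …, W n` from right to left, and then imitates a
Post machine. The states `(s, false)` are those of the Post machine, and `(s, true)` precedes
`(s, false)` after a symbol was written. -/
def postTransition (M : Turing.TM0.Machine Bool Λ) (W : ℕ → Bool) (n : ℕ) :
    ℕ ⊕ Λ × Bool → Bool → Bool × Move × Option (ℕ ⊕ Λ × Bool)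
  | .inl i, _ => (W i, .left, some (if i < n then .inl (i + 1) else .inr (default, true)))
  | .inr (s, true), a => (a, .right, some (.inr (s, false)))
  | .inr (s, false), a =>
    match M s a with
    | none => (a, .right, none)
    | some (s', .move .left) => (a, .left, some (.inr (s', false)))
    | some (s', .move .right) => (a, .right, some (.inr (s', false)))
    | some (s', .write b) => (b, .left, some (.inr (s', true)))

/-- The machine with transitions `m` on states that are coded by numbers. -/
def Machine.ofCoding {α : Type*} (e : α → Fin q) (d : Fin q → α)
    (m : α → Bool → Bool × Move × Option α) : Machine q :=
  fun s a => ((m (d s) a).1, (m (d s) a).2.1, (m (d s) a).2.2.map e)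

theorem Machine.step_ofCoding {α : Type*} {e : α → Fin q} {d : Fin q → α}
    {m : α → Bool → Bool × Move × Option α} {s : α} (hs : d (e s) = s) (tape : ℤ → Bool) (p : ℤ)
    {b : Bool} {mv : Move} {t : Option α} (hm : m s (tape p) = (b, mv, t)) :
    (Machine.ofCoding e d m).step ⟨some (e s), tape, p⟩ =
      ⟨t.map e, Function.update tape p b,
        match mv with
        | .left => p - 1
        | .right => p + 1⟩ := by
  simp only [Machine.step, Machine.ofCoding, hs, hm]
  cases mv <;> rfl

variable {M : Turing.TM0.Machine Bool Λ} {e : ℕ ⊕ Λ × Bool → Fin q} {d : Fin q → ℕ ⊕ Λ × Bool}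

/-- The configuration that represents the label `s` and the tape `T` with head at `p`. -/
def postConfig (e : ℕ ⊕ Λ × Bool → Fin q) (s : Λ) (T : Turing.Tape Bool) (p : ℤ) : Config q :=
  ⟨some (e (.inr (s, false))), fun z => T.nth (z - p), p⟩

theorem update_nth (T : Turing.Tape Bool) (p : ℤ) (b : Bool) :
    Function.update (fun z => T.nth (z - p)) p b = fun z => (T.write b).nth (z - p) := by
  funext z
  rw [Function.update_apply, Turing.Tape.write_nth]
  simp only [sub_eq_zero]

theorem update_nth_self (T : Turing.Tape Bool) (p : ℤ) :
    Function.update (fun z => T.nth (z - p)) p (T.nth (p - p)) = fun z => T.nth (z - p) :=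
  Function.update_eq_self _ _

theorem exists_iterate_postConfig {W : ℕ → Bool} {n : ℕ} {s s' : Λ} {T T' : Turing.Tape Bool}
    (hs : d (e (.inr (s, false))) = .inr (s, false))
    (hs' : d (e (.inr (s', true))) = .inr (s', true))
    (h : Turing.TM0.step M ⟨s, T⟩ = some ⟨s', T'⟩) (p : ℤ) :
    ∃ t p', (Machine.ofCoding e d (postTransition M W n)).step^[t] (postConfig e s T p) =
      postConfig e s' T' p' := by
  simp only [Turing.TM0.step, Option.map_eq_some_iff, Turing.TM0.Cfg.mk.injEq] at h
  obtain ⟨⟨s', o⟩, hM, rfl, rfl⟩ := h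
  have hT : T.nth (p - p) = T.head := by rw [sub_self, Turing.Tape.nth_zero]
  rcases o with (_ | _) | b
  · refine ⟨1, p - 1, ?_⟩
    rw [Function.iterate_one, postConfig, Machine.step_ofCoding hs _ _
      (b := T.nth (p - p)) (mv := .left) (t := some (.inr (s', false)))
      (by simp only [postTransition, hT, hM]), update_nth_self, postConfig]
    simp only [Option.map_some, Turing.Tape.move_left_nth, sub_sub_eq_add_sub, add_sub_cancel_right,
      add_sub_right_comm]
  · refine ⟨1, p + 1, ?_⟩
    rw [Function.iterate_one, postConfig, Machine.step_ofCoding hs _ _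
      (b := T.nth (p - p)) (mv := .right) (t := some (.inr (s', false)))
      (by simp only [postTransition, hT, hM]), update_nth_self, postConfig]
    simp only [Option.map_some, Turing.Tape.move_right_nth, sub_add_eq_sub_sub, sub_add_cancel]
  · refine ⟨2, p, ?_⟩
    rw [Function.iterate_succ, Function.iterate_one, Function.comp_apply, postConfig,
      Machine.step_ofCoding hs _ _ (b := b) (mv := .left) (t := some (.inr (s', true)))
      (by simp only [postTransition, hT, hM]), update_nth, Option.map_some,
      Machine.step_ofCoding hs' _ _ (mv := .right) (t := some (.inr (s', false)))
      (by simp only [postTransition]; rfl), Function.update_eq_self, postConfig]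
    simp

theorem step_postConfig_of_none {W : ℕ → Bool} {n : ℕ} {s : Λ} {T : Turing.Tape Bool}
    (hs : d (e (.inr (s, false))) = .inr (s, false)) (h : Turing.TM0.step M ⟨s, T⟩ = none) (p : ℤ) :
    (Machine.ofCoding e d (postTransition M W n)).step (postConfig e s T p) =
      ⟨none, fun z => T.nth (z - p), p + 1⟩ := by
  simp only [Turing.TM0.step, Option.map_eq_none_iff] at h
  have hT : T.nth (p - p) = T.head := by rw [sub_self, Turing.Tape.nth_zero]
  rw [postConfig, Machine.step_ofCoding hs _ _ (b := T.nth (p - p)) (mv := .right)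
    (t := none) (by simp only [postTransition, hT, h]), update_nth_self]
  rfl

theorem run_postTransition_of_le {W : ℕ → Bool} {n : ℕ} (h0 : 0 < q) (he : e (.inl 0) = ⟨0, h0⟩)
    (hd : ∀ i ≤ n, d (e (.inl i)) = .inl i) {i : ℕ} (hi : i ≤ n + 1) :
    (Machine.ofCoding e d (postTransition M W n)).run i =
      ⟨some (e (if i ≤ n then .inl i else .inr (default, true))),
        fun z => if -(i : ℤ) < z ∧ z ≤ 0 then W (-z).toNat else false, -i⟩ := by
  induction i with
  | zero =>
    have hempty (z : ℤ) : ¬(0 < z ∧ z ≤ 0) := by omega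
    simp only [Machine.run, Function.iterate_zero, id, Config.init, dif_pos h0, Nat.zero_le,
      if_true, he, if_neg (hempty _), Nat.cast_zero, neg_zero]
  | succ i ih =>
    rw [Machine.run_succ, ih (by omega), if_pos (by omega),
      Machine.step_ofCoding (hd i (by omega)) _ _ (b := W i) (mv := .left)
      (t := some (if i < n then .inl (i + 1) else .inr (default, true))) rfl]
    simp only [Option.map_some, Order.add_one_le_iff, Nat.cast_add, Nat.cast_one, neg_add']
    congr 1
    funext z
    rcases eq_or_ne z (-i) with rfl | hz
    · rw [Function.update_self, if_pos (by omega), neg_neg, Int.toNat_natCast]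
    · rw [Function.update_of_ne hz]
      exact if_congr (by omega) rfl rfl

theorem run_postTransition {n : ℕ} {T : Turing.Tape Bool} (h0 : 0 < q) (he : e (.inl 0) = ⟨0, h0⟩)
    (hd : ∀ i ≤ n, d (e (.inl i)) = .inl i)
    (hd' : d (e (.inr (default, true))) = .inr (default, true))
    (hT : ∀ j : ℤ, j < 0 ∨ n < j → T.nth j = false) :
    (Machine.ofCoding e d (postTransition M (fun i => T.nth (n - i)) n)).run (n + 2) =
      postConfig e default T (-n) := by
  rw [Machine.run_succ, run_postTransition_of_le h0 he hd le_rfl, if_neg (by omega),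
    Machine.step_ofCoding hd' _ _ (mv := .right) (t := some (.inr (default, false)))
    (by simp only [postTransition]; rfl), Function.update_eq_self, postConfig]
  simp only [Option.map_some]
  congr 1
  · funext z
    split_ifs with h
    · congr 1
      omega
    · exact (hT _ (by omega)).symm
  · push_cast
    omega

theorem exists_run_eq_postConfig {S : Set Λ} (hS : Turing.TM0.Supports M S) {W : ℕ → Bool} {n : ℕ}
    (hd : ∀ s ∈ S, ∀ b, d (e (.inr (s, b))) = .inr (s, b)) {T : Turing.Tape Bool} {t₀ : ℕ} {p₀ : ℤ}
    (hinit : (Machine.ofCoding e d (postTransition M W n)).run t₀ = postConfig e default T p₀)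
    {c : Turing.TM0.Cfg Bool Λ}
    (hc : StateTransition.Reaches (Turing.TM0.step M) ⟨default, T⟩ c) :
    c.q ∈ S ∧ ∃ t p, (Machine.ofCoding e d (postTransition M W n)).run t =
      postConfig e c.q c.Tape p := by
  induction hc with
  | refl => exact ⟨hS.1, t₀, p₀, hinit⟩
  | @tail c c' _ hstep ih =>
    obtain ⟨hc, t, p, hrun⟩ := ih
    have hc' : c'.q ∈ S := Turing.TM0.step_supports M hS hstep hc
    obtain ⟨t', p', hiter⟩ := exists_iterate_postConfig (W := W) (n := n) (hd _ hc false)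
      (hd _ hc' true) (s' := c'.q) (T' := c'.Tape) hstep p
    refine ⟨hc', t' + t, p', ?_⟩
    rw [Machine.run, Function.iterate_add_apply, ← Machine.run, hrun, hiter]

theorem le_busyBeaver_of_post {S : Finset Λ} (hS : Turing.TM0.Supports M ↑S) {n : ℕ}
    {T T' : Turing.Tape Bool} {s : Λ} (hT : ∀ j : ℤ, j < 0 ∨ n < j → T.nth j = false)
    (h : (⟨s, T'⟩ : Turing.TM0.Cfg Bool Λ) ∈
      StateTransition.eval (Turing.TM0.step M) ⟨default, T⟩)
    {j : ℕ} (hj : T'.nth j = true) (hq : n + 1 + 2 * S.card ≤ q) : j ≤ 2 * busyBeaver q := by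
  have h0 : 0 < q := by omega
  obtain ⟨e, d, hd, he⟩ := exists_coding
    ((Finset.range (n + 1)).disjSum (S ×ˢ (Finset.univ : Finset Bool))) (x := .inl 0)
    (by simp) (q := q) (by
      rw [Finset.card_disjSum, Finset.card_range, Finset.card_product, Finset.card_univ,
        Fintype.card_bool]
      omega) h0
  have hwriting : ∀ i ≤ n, d (e (.inl i)) = .inl i := fun i hi => hd _ (by simp; omega)
  have himitating : ∀ s ∈ (S : Set Λ), ∀ b, d (e (.inr (s, b))) = .inr (s, b) :=
    fun s hs b => hd _ (by simpa using hs)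
  obtain ⟨hreach, hnone⟩ := StateTransition.mem_eval.1 h
  obtain ⟨hs, t, p, hrun⟩ := exists_run_eq_postConfig hS himitating
    (run_postTransition h0 he hwriting (himitating _ hS.1 true) hT) hreach
  have hhalt := (Machine.run_succ t).trans
    ((congrArg _ hrun).trans (step_postConfig_of_none (himitating _ hs false) hnone p))
  have hdist := Machine.abs_sub_head_lt_of_halted (t := t + 1) (m := j + p) (by rw [hhalt])
    (by rw [hhalt]; simpa using hj)
  rw [hhalt, abs_lt] at hdist
  dsimp only at hdist
  omega

end PostMachines

/-! ### Stack machines -/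

section StackMachines

open Turing

theorem append_nth_length_add {Γ : Type*} [Inhabited Γ] (l : List Γ) (L : ListBlank Γ) (i : ℕ) :
    (L.append l).nth (l.length + i) = L.nth i := by
  induction l with
  | nil => simp [ListBlank.append]
  | cons a l ih =>
    rw [List.length_cons, Nat.succ_add, ListBlank.nth_succ, ListBlank.append,
      ListBlank.tail_cons, ih]

theorem append_nth_of_lt {Γ : Type*} [Inhabited Γ] (l : List Γ) (L : ListBlank Γ) {i : ℕ}
    (hi : i < l.length) : (L.append l).nth i = l[i] := by
  induction l generalizing i with
  | nil => simp at hi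
  | cons a l ih =>
    rcases i with _ | i
    · rw [ListBlank.append, ListBlank.nth_zero, ListBlank.head_cons, List.getElem_cons_zero]
    · rw [ListBlank.append, ListBlank.nth_succ, ListBlank.tail_cons, List.getElem_cons_succ,
        ih (by simpa using hi)]

theorem exists_flatMap_nth_eq_true {Γ : Type*} [Inhabited Γ] {n : ℕ} {f : Γ → List Bool}
    (hf : ∃ n, f default = List.replicate n default) (hn : ∀ a, (f a).length = n)
    (hmark : ∀ a, a ≠ default → true ∈ f a) (i : ℕ) (L : ListBlank Γ) (hL : L.nth i ≠ default) :
    ∃ j, i ≤ j ∧ (L.flatMap f hf).nth j = true := by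
  have hpos : 0 < n := by
    rw [← hn]
    exact List.length_pos_of_mem (hmark _ hL)
  induction i generalizing L with
  | zero =>
    obtain ⟨a, L, rfl⟩ := L.exists_cons
    rw [ListBlank.nth_zero, ListBlank.head_cons] at hL
    obtain ⟨j, hj, htrue⟩ := List.mem_iff_getElem.1 (hmark a hL)
    exact ⟨j, Nat.zero_le _, by rw [ListBlank.cons_flatMap, append_nth_of_lt _ _ hj, htrue]⟩
  | succ i ih =>
    obtain ⟨a, L, rfl⟩ := L.exists_cons
    rw [ListBlank.nth_succ, ListBlank.tail_cons] at hL
    obtain ⟨j, hj, htrue⟩ := ih L hL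
    refine ⟨(f a).length + j, by rw [hn]; omega, ?_⟩
    rw [ListBlank.cons_flatMap, append_nth_length_add, htrue]

theorem true_mem_toList_of_ne_default {Γ : Type*} [Inhabited Γ] {n : ℕ}
    {enc : Γ → List.Vector Bool n} {dec : List.Vector Bool n → Γ}
    (henc : enc default = List.Vector.replicate n false) (hdec : ∀ a, dec (enc a) = a) {a : Γ}
    (ha : a ≠ default) : true ∈ (enc a).toList := by
  by_contra hunmarked
  have hblank : (enc a).toList = List.replicate n false :=
    List.eq_replicate_iff.2 ⟨(enc a).toList_length, fun b hb =>
      Bool.eq_false_of_not_eq_true fun h => hunmarked (h ▸ hb)⟩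
  refine ha ?_
  rw [← hdec a, ← hdec default, henc]
  exact congrArg dec (List.Vector.toList_injective hblank)

section Stacks

variable {K : Type*} {Γ : K → Type*}

theorem addBottom_nth_ne_default {L : ListBlank (∀ k, Option (Γ k))} {k : K} {l : List (Γ k)}
    (hL : ListBlank.map (proj k) L = ListBlank.mk (l.map some).reverse) {i : ℕ}
    (hi : i < l.length) : (TM2to1.addBottom L).nth i ≠ default := by
  intro h
  have htop : ((TM2to1.addBottom L).nth i).2 k = none := by
    rw [h]
    rfl
  rw [TM2to1.addBottom_nth_snd, TM2to1.stk_nth_val _ hL, List.getElem?_eq_none_iff,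
    List.length_reverse] at htop
  omega

theorem length_trInit_le [DecidableEq K] (k : K) (l : List (Γ k)) :
    (TM2to1.trInit k l).length ≤ l.length + 1 :=
  Nat.succ_le_succ ((List.tail_sublist _).length_le.trans_eq
    ((List.length_map _).trans List.length_reverse))

theorem trTape_mk₁_nth_eq_default [DecidableEq K] {n : ℕ}
    {enc : TM2to1.Γ' K Γ → List.Vector Bool n}
    (henc : enc default = List.Vector.replicate n false) (k : K) (l : List (Γ k)) {i : ℤ}
    (hi : i < 0 ∨ (n * (l.length + 1) : ℕ) < i) :
    (TM1to1.trTape henc (Tape.mk₁ (TM2to1.trInit k l))).nth i = false := by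
  rw [Tape.mk₁, Tape.mk₂, TM1to1.trTape_mk', TM1to1.trTape']
  rcases i with i | i
  · rw [Int.ofNat_eq_natCast] at hi ⊢
    have hlt : n * (l.length + 1) < i := by omega
    rw [Tape.mk'_nth_nat, ListBlank.flatMap_mk, ListBlank.nth_mk, List.getI_eq_default]
    · rfl
    · simp only [List.length_flatMap, List.Vector.toList_length, List.map_const',
        List.sum_replicate, smul_eq_mul]
      calc (TM2to1.trInit k l).length * n ≤ (l.length + 1) * n :=
            Nat.mul_le_mul_right n (length_trInit_le k l)
        _ ≤ i := by rw [mul_comm]; exact hlt.le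
  · exact List.getI_nil i

theorem exists_le_busyBeaver_of_stack [DecidableEq K] [Finite K] [∀ k, Finite (Γ k)]
    {Λ σ : Type*} [Inhabited Λ] [Inhabited σ] [Finite σ] (M : Λ → TM2.Stmt Γ Λ σ)
    {S : Finset Λ} (hS : TM2.Supports M S) :
    ∃ A B : ℕ, ∀ (k : K) (L : List (Γ k)) (c : TM2.Cfg Γ Λ σ),
      c ∈ StateTransition.eval (TM2.step M) (TM2.init k L) →
      ∀ q, A + B * (L.length + 1) ≤ q → ∀ k', (c.stk k').length ≤ 2 * busyBeaver q + 1 := by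
  classical
  have := Fintype.ofFinite K
  have := Fintype.ofFinite σ
  have (k : K) := Fintype.ofFinite (Γ k)
  obtain ⟨n, enc, dec, henc, hdec⟩ := TM1to1.exists_enc_dec (Γ := TM2to1.Γ' K Γ)
  have hsupp := TM1to0.tr_supports _
    (TM1to1.tr_supports (enc := enc) (dec := dec) (TM2to1.tr M) (TM2to1.tr_supports M hS))
  refine ⟨1 + 2 * (TM1to0.trStmts (TM1to1.tr enc dec (TM2to1.tr M))
    (TM1to1.trSupp (TM2to1.tr M) (TM2to1.trSupp M S))).card, n, fun k L c hc q hq k' => ?_⟩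
  rcases Nat.eq_zero_or_pos (c.stk k').length with hlen | hlen
  · omega
  obtain ⟨c₁, hc₁, heval₁⟩ :=
    StateTransition.tr_eval (TM2to1.tr_respects M) (TM2to1.trCfg_init k L) hc
  obtain ⟨_, rfl, heval₂⟩ := StateTransition.tr_eval
    (TM1to1.tr_respects dec (TM2to1.tr M) (enc0 := henc) hdec) rfl heval₁
  obtain ⟨_, rfl, heval₃⟩ := StateTransition.tr_eval (TM1to0.tr_respects _) rfl heval₂
  obtain @⟨l, v, stk, L', hL'⟩ := hc₁
  dsimp only at hlen ⊢
  obtain ⟨j, hj, hmark⟩ := exists_flatMap_nth_eq_true (f := fun x => (enc x).toList)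
    ⟨n, by rw [henc]; rfl⟩ (fun a => (enc a).toList_length)
    (fun a => true_mem_toList_of_ne_default henc hdec) _ _
    (addBottom_nth_ne_default (hL' k') (Nat.sub_lt hlen one_pos))
  suffices j ≤ 2 * busyBeaver q by omega
  refine le_busyBeaver_of_post hsupp (n := n * (L.length + 1))
    (fun i hi => trTape_mk₁_nth_eq_default henc k L hi) heval₃ ?_ (by omega)
  rw [TM1to1.trTape_mk', TM1to1.trTape', Tape.mk'_nth_nat]
  exact hmark

end Stacks

end StackMachines

/-! ### Domination of computable functions -/

section Codes

open Turing Turing.PartrecToTM2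

instance : Fintype K' := ⟨{.main, .rev, .aux, .stack}, fun k => by cases k <;> decide⟩

theorem length_trPosNum_le (p : PosNum) : (trPosNum p).length ≤ p := by
  induction p with
  | one => simp [trPosNum]
  | bit1 p ih =>
    rw [trPosNum, List.length_cons, PosNum.cast_bit1]
    omega
  | bit0 p ih =>
    have := p.cast_pos (α := ℕ)
    rw [trPosNum, List.length_cons, PosNum.cast_bit0]
    omega

theorem lt_two_pow_length_trPosNum (p : PosNum) : (p : ℕ) < 2 ^ (trPosNum p).length := by
  induction p with
  | one => simp [trPosNum]
  | bit1 p ih =>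
    rw [trPosNum, List.length_cons, PosNum.cast_bit1, pow_succ]
    omega
  | bit0 p ih =>
    rw [trPosNum, List.length_cons, PosNum.cast_bit0, pow_succ]
    omega

theorem length_trNum_le : ∀ n : Num, (trNum n).length ≤ n
  | .zero => Nat.zero_le _
  | .pos p => length_trPosNum_le p

theorem lt_two_pow_length_trNum : ∀ n : Num, (n : ℕ) < 2 ^ (trNum n).length
  | .zero => Nat.one_pos
  | .pos p => lt_two_pow_length_trPosNum p

theorem length_trNat_le (n : ℕ) : (trNat n).length ≤ n :=
  (length_trNum_le n).trans_eq (Num.to_of_nat n)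

theorem lt_two_pow_length_trNat (n : ℕ) : n < 2 ^ (trNat n).length :=
  (Num.to_of_nat n).symm.trans_lt (lt_two_pow_length_trNum n)

theorem exists_length_trNat_le (c : ToPartrec.Code) :
    ∃ A B : ℕ, ∀ k v, [v] ∈ c.eval [k] → ∀ q, A + B * (k + 2) ≤ q →
      (trNat v).length ≤ 2 * busyBeaver q := by
  let _ : Inhabited Λ' := ⟨trNormal c Cont'.halt⟩
  obtain ⟨A, B, h⟩ := exists_le_busyBeaver_of_stack tr (tr_supports c Cont'.halt)
  refine ⟨A, B, fun k v hv q hq => ?_⟩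
  have hinit : (init c [k] : TM2.Cfg (fun _ : K' => Γ') Λ' (Option Γ')) =
      TM2.init K'.main (trList [k]) := by
    rw [init, TM2.init]
    congr 1
    funext k'
    cases k' <;> rfl
  have heval : halt [v] ∈ StateTransition.eval (TM2.step tr) (TM2.init K'.main (trList [k])) := by
    rw [← hinit, tr_eval]
    exact Part.mem_map _ hv
  have hlength (m : ℕ) : (trList [m]).length = (trNat m).length + 1 := by simp [trList]
  have hstates : A + B * ((trList [k]).length + 1) ≤ q := by
    rw [hlength]
    exact (Nat.add_le_add_left (Nat.mul_le_mul_left B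
      (Nat.add_le_add_right (length_trNat_le k) 2)) A).trans hq
  have hstack : (trList [v]).length ≤ 2 * busyBeaver q + 1 :=
    h K'.main (trList [k]) _ heval q hstates K'.main
  rw [hlength] at hstack
  omega

theorem exists_code_of_computable {f : ℕ → ℕ} (hf : Computable f) :
    ∃ c : ToPartrec.Code, ∀ k, [f k] ∈ c.eval [k] := by
  obtain ⟨c, hc⟩ := ToPartrec.Code.exists_code (Nat.Partrec'.part_iff₁.2 hf)
  refine ⟨c, fun k => ?_⟩
  have heval : c.eval [k] = pure <$> (f k : Part ℕ) := hc (k ::ᵥ List.Vector.nil)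
  simp [heval]

end Codes

section Domination

theorem computable_sum_range_succ {f : ℕ → ℕ} (hf : Computable f) :
    Computable fun m => ∑ i ∈ Finset.range (m + 1), f i := by
  have hstep : Computable₂ fun (_ : ℕ) (x : ℕ × ℕ) => x.2 + f (x.1 + 1) :=
    (Primrec.nat_add.to_comp.comp (Computable.snd.comp Computable.snd)
      (hf.comp (Computable.succ.comp (Computable.fst.comp Computable.snd)))).to₂
  refine (Computable.nat_rec Computable.id (Computable.const (f 0)) hstep).of_eq fun m => ?_
  induction m with
  | zero => simp
  | succ m ih => rw [Finset.sum_range_succ, ← ih]; rfl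

theorem computable_two_pow : Computable fun n : ℕ => 2 ^ n :=
  (Primrec₂.unpaired'.1 Nat.Primrec.pow).to_comp.comp (Computable.const 2) Computable.id

theorem eventually_lt_busyBeaver {f : ℕ → ℕ} (hf : Computable f) (r : ℕ) :
    ∀ᶠ d in Filter.atTop, f d < busyBeaver (d - r) := by
  let F (m : ℕ) : ℕ := ∑ i ∈ Finset.range (m + 1), f i
  have hcomputable : Computable fun k : ℕ => 2 ^ (2 * F (k * k)) :=
    computable_two_pow.comp (Primrec.nat_mul.to_comp.comp (Computable.const 2)
      ((computable_sum_range_succ hf).comp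
        (Primrec.nat_mul.to_comp.comp Computable.id Computable.id)))
  obtain ⟨c, hc⟩ := exists_code_of_computable hcomputable
  obtain ⟨A, B, hAB⟩ := exists_length_trNat_le c
  refine Filter.eventually_atTop.2 ⟨(A + B + r + 10) * (A + B + r + 10), fun d hd => ?_⟩
  have hsqrt : A + B + r + 10 ≤ d.sqrt := Nat.le_sqrt.2 hd
  have hstates : A + B * (d.sqrt + 1 + 2) ≤ d - r := by
    have hle : A + B * (d.sqrt + 1 + 2) + r ≤ d.sqrt * d.sqrt := by nlinarith
    have := Nat.sqrt_le d
    omega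
  have hdigits := hAB _ _ (hc (d.sqrt + 1)) _ hstates
  have hexponent := (Nat.pow_lt_pow_iff_right one_lt_two).1
    (lt_two_pow_length_trNat (2 ^ (2 * F ((d.sqrt + 1) * (d.sqrt + 1)))))
  have hf_le : f d ≤ F ((d.sqrt + 1) * (d.sqrt + 1)) :=
    Finset.single_le_sum (fun _ _ => Nat.zero_le _)
      (Finset.mem_range_succ_iff.2 (Nat.lt_succ_sqrt d).le)
  omega

end Domination

section LargestThreshold

variable {C : ℝ}

theorem isGreatest_sSup_isThreshold (hC : 3 / 2 ≤ C) {d : ℕ} (hd : 3 < d) :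
    IsGreatest {n | IsThreshold C d n} (sSup {n | IsThreshold C d n}) := by
  have hfin := finite_setOf_isThreshold C d
  obtain ⟨c, rfl⟩ := Nat.exists_eq_add_of_le' (show 2 ≤ d by omega)
  have hne : {n | IsThreshold C (c + 2) n}.Nonempty :=
    ⟨1, isThreshold_of_lt_pow hC le_rfl (by omega) le_rfl (Nat.one_lt_pow (by omega) (by omega))⟩
  exact ⟨Nat.sSup_mem hne hfin.bddAbove, fun n hn => le_csSup hfin.bddAbove hn⟩

theorem two_pow_le_of_isGreatest (hC : 3 / 2 ≤ C) {b N : ℕ} (hb : 3 ≤ b)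
    (hN : IsGreatest {n | IsThreshold C (b + 2 + 2) n} N) : 2 ^ (b ^ (b + 1) - 1) ≤ N := by
  obtain ⟨n, hle, hn⟩ := exists_isThreshold_two_pow hC hb
  exact hle.trans (hN.2 hn)

end LargestThreshold

end SizeDriven

open SizeDriven in
theorem mainTheorem1_general {C : ℝ} (hC : 3 / 2 ≤ C) :
    ∃ N : ℕ → ℕ,
      (∀ d : ℕ, 3 < d → IsGreatest {n : ℕ | IsThreshold C d n} (N d)) ∧
      IsThreshold C 4 2 ∧
      IsThreshold C 6 15 ∧
      IsThreshold C 7 84 ∧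
      IsThreshold C 8 420 ∧
      (∀ q : ℕ, busyBeaver q ≤ N (q + 4)) ∧
      33 * 10 ^ 6 ≤ N 9 ∧
      52 * 10 ^ 36533 ≤ N 10 ∧
      (∀ f : ℕ → ℕ, Computable f → ∀ᶠ d in Filter.atTop, f d < N d) := by
  have hgreatest (d : ℕ) (hd : 3 < d) := isGreatest_sSup_isThreshold hC hd
  have hbusy (q : ℕ) := busyBeaver_le_of_isGreatest hC (hgreatest (q + 4) (by omega))
  refine ⟨fun d => sSup {n | IsThreshold C d n}, hgreatest, ?_, ?_, ?_, ?_, hbusy, ?_, ?_,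
    fun f hf => ?_⟩
  · exact isThreshold_of_lt_pow hC (c := 2) (k := 1) le_rfl le_rfl (by norm_num) (by norm_num)
  · exact isThreshold_of_lt_pow hC (c := 4) (k := 2) one_le_two le_rfl (by norm_num) (by norm_num)
  · exact isThreshold_of_lt_pow hC (c := 5) (k := 2) one_le_two (by norm_num) (by norm_num)
      (by norm_num)
  · exact isThreshold_of_lt_pow hC (c := 6) (k := 3) (by norm_num) le_rfl (by norm_num)
      (by norm_num)
  · calc 33 * 10 ^ 6 ≤ 2 ^ (5 ^ (5 + 1) - 1) :=
          le_trans (by norm_num) (mul_ten_pow_le_two_pow (m := 6) (by norm_num))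
      _ ≤ _ := two_pow_le_of_isGreatest hC (b := 5) (by norm_num) (hgreatest 9 (by norm_num))
  · exact (mul_ten_pow_le_two_pow (by norm_num)).trans
      (two_pow_le_of_isGreatest hC (b := 6) (by norm_num) (hgreatest 10 (by norm_num)))
  · filter_upwards [eventually_lt_busyBeaver hf 4, Filter.eventually_ge_atTop 4] with d hd hd4
    obtain ⟨q, rfl⟩ := Nat.exists_eq_add_of_le' hd4
    exact hd.trans_le (hbusy q)

theorem mainTheorem1 :
    ∃ C : ℝ, 0 < C ∧ ∃ N : ℕ → ℕ,
      (∀ d : ℕ, 3 < d → IsGreatest {n : ℕ | SizeDriven.IsThreshold C d n} (N d)) ∧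
      SizeDriven.IsThreshold C 4 2 ∧
      SizeDriven.IsThreshold C 6 15 ∧
      SizeDriven.IsThreshold C 7 84 ∧
      SizeDriven.IsThreshold C 8 420 ∧
      (∀ q : ℕ, (SizeDriven.busyBeaver q : ℝ) / Real.sqrt 2 ≤ (N (q + 4) : ℝ)) ∧
      33 * 10 ^ 6 ≤ N 9 ∧
      52 * 10 ^ 36533 ≤ N 10 ∧
      (∀ f : ℕ → ℕ, Computable f → ∀ᶠ d in Filter.atTop, f d < N d) := by
  obtain ⟨N, hgreatest, h4, h6, h7, h8, hbusy, hrest⟩ := mainTheorem1_general (C := 2) (by norm_num)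
  refine ⟨2, two_pos, N, hgreatest, h4, h6, h7, h8, fun q => ?_, hrest⟩
  exact (div_le_self (Nat.cast_nonneg _) (Real.one_le_sqrt.2 one_le_two)).trans
    (Nat.cast_le.2 (hbusy q))
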